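/- Let $N\ge 1$ be an integer, $n>0$ real, $\psi(s)=|s|^{-\frac n{n+1}}s$ (with $\psi(0)=0$). For an integer $m\ge1$ and a bounded domain $\Omega\subset\mathbb R^N$ let $\tilde D^m=\Delta^{m/2}$ for even $m$ and $\tilde D^m=\nabla\Delta^{(m-1)/2}$ for odd $m$, and let $$\lambda_1=\lambda_1(\Omega)=\inf_{0\ne\varphi\in C_c^\infty(\Omega)}\frac{\int_\Omega|\tilde D^m\varphi|^2\,dx}{\int_\Omega\varphi^2\,dx}$$ be the first Dirichlet eigenvalue of $(-\Delta)^m$ in $\Omega$. A first eigenfunction is a function $0\ne e\in H^m_0(\Omega)$ with $(-\Delta)^m e=\lambda_1 e$ in the sense of distributions in $\Omega$. For $f:\mathbb R\to\mathbb R$ and $0<\tau\le\infty$, a solution on $[0,\tau)$ of $$(\psi(v))_t=(-1)^{m+1}\Delta^m v+f(v)\ \text{ in }\Omega,\qquad v=Dv=\dots=D^{m-1}v=0\ \text{ on }\partial\Omega,\qquad v(\cdot,0)=v_0,\qquad(*)$$ is a function $v$ with $v\in L^1(0,t;H^m_0(\Omega))$ and $\psi(v(t))\in L^2(\Omega)$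 for every $t\in[0,\tau)$, $v(0)=v_0$, and, for all $t\in[0,\tau)$ and $\eta\in C_c^\infty(\Omega)$, $$\int_\Omega\psi(v(t))\eta\,dx=\int_\Omega\psi(v_0)\eta\,dx+\int_0^t\Big((-1)^{m+1}\int_\Omega v\,\Delta^m\eta\,dx+\int_\Omega f(v)\eta\,dx\Big)dr .$$ For a positive first eigenfunction $e_1$ put $$J(t)=\int_\Omega\psi(v(x,t))e_1(x)\,dx,\qquad c_2=\Big(\int_\Omega e_1\,dx\Big)^{-n},$$ and, when $\lambda_1<1$ and $J(0)>0$, $$A=\Big(\frac1{nc_2(1-\lambda_1)}\Big)^{1/n},\qquad T=\frac{J(0)^{-n}}{nc_2(1-\lambda_1)} .$$ (1) Let $m\ge2$ and let $\Omega=B_R$ be the ball of radius $R>0$ centred at $0$. Every first eigenfunction is either positive a.e. or negative a.e. in $\Omega$. Suppose $\lambda_1<1$, let $e_1>0$ be a first eigenfunction, and let $v$ (possibly of changing sign) be a solution of $(*)$ on $[0,\tau)$ with $f(v)=|v|$. If $J(0)=\int_\Omega\psi(v_0)e_1\,dx>0$, then $$J(t)\ge A\,(T-t)^{-1/n}\qquad\text{for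 all } t\in[0,\tau),$$ and $\tau\le T$. So the solution blows up in finite time, in the sense that it cannot be continued beyond time $T$; in particular it is not global. (2) Let $m=1$ and let $\Omega$ be any bounded domain. Every first eigenfunction is either positive a.e. or negative a.e. in $\Omega$. Suppose $\lambda_1<1$, let $e_1>0$ be a first eigenfunction, and let $v\ge0$ be a nonnegative solution of $(*)$ on $[0,\tau)$ with $f(v)=v$ and $v_0\not\equiv0$. Then $J(0)>0$, $\tau\le T$, and $J(t)\ge A\,(T-t)^{-1/n}$ for all $t\in[0,\tau)$. -/

import Mathlib

open MeasureTheory Set Filter Topology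
open scoped ContDiff

noncomputable section

namespace PolyBlowup

/-- Euclidean space `ℝ^N`. -/
abbrev E (N : ℕ) : Type := EuclideanSpace ℝ (Fin N)

/-- Test functions: elements of `C_c^∞(Ω)`, extended by zero. -/
def IsTestFunction {N : ℕ} (Ω : Set (E N)) (φ : E N → ℝ) : Prop :=
  ContDiff ℝ ∞ φ ∧ HasCompactSupport φ ∧ tsupport φ ⊆ Ω

/-- The iterated Laplacian `Δ^k φ`. -/
def iterLaplacian {N : ℕ} (k : ℕ) (φ : E N → ℝ) : E N → ℝ :=
  (fun f : E N → ℝ => Laplacian.laplacian f)^[k] φ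

/-- Families `(F_0, …, F_m)` in which `F_j` is an `L²` field of `j`-linear forms on `ℝ^N`,
with the product topology; a function with square integrable (weak) derivatives up to order `m`
gives the family of these derivatives. -/
abbrev SobolevJet (N m : ℕ) : Type :=
  (j : Fin (m + 1)) →
    Lp (ContinuousMultilinearMap ℝ (fun _ : Fin (j : ℕ) => E N) ℝ) 2 (volume : Measure (E N))

/-- The Sobolev space `H^m_0(Ω)`: the closure of the test functions in the `H^m` norm. An element
is recorded together with its weak derivatives of order `1, …, m`. -/
def sobolevH0 {N : ℕ} (m : ℕ) (Ω : Set (E N)) : Set (SobolevJet N m) :=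
  closure {F | ∃ φ : E N → ℝ, IsTestFunction Ω φ ∧
    ∀ j : Fin (m + 1), F j =ᵐ[volume] iteratedFDeriv ℝ (j : ℕ) φ}

/-- The function underlying a family of derivatives (its component of order `0`). -/
def SobolevJet.toFun {N m : ℕ} (F : SobolevJet N m) : E N → ℝ :=
  fun x => (F 0 : E N → _) x (fun _ => 0)

/-- `u` belongs to `H^m_0(Ω)`. -/
def MemH0 {N : ℕ} (m : ℕ) (Ω : Set (E N)) (u : E N → ℝ) : Prop :=
  ∃ F ∈ sobolevH0 m Ω, SobolevJet.toFun F =ᵐ[volume.restrict Ω] u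

/-- `∫ |D̃^m φ|²`, where `D̃^m = Δ^{m/2}` for even `m` and `D̃^m = ∇ Δ^{(m-1)/2}` for odd `m`. -/
def dirichletEnergy {N : ℕ} (m : ℕ) (φ : E N → ℝ) : ℝ :=
  if Even m then ∫ x, (iterLaplacian (m / 2) φ x) ^ 2
  else ∫ x, ‖gradient (iterLaplacian (m / 2) φ) x‖ ^ 2

/-- The first Dirichlet eigenvalue `λ₁(Ω)` of `(-Δ)^m`: the infimum of the Rayleigh quotient
`∫ |D̃^m φ|² / ∫ φ²`, that is, `1 / λ₁` is the sharp constant in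
`∫ φ² ≤ C ∫ |D̃^m φ|²`. -/
def firstEigenvalue {N : ℕ} (m : ℕ) (Ω : Set (E N)) : ℝ :=
  sInf {q | ∃ φ : E N → ℝ, IsTestFunction Ω φ ∧ φ ≠ 0 ∧
    q = dirichletEnergy m φ / ∫ x, (φ x) ^ 2}

/-- `e` is an eigenfunction of `(-Δ)^m` in `Ω` with Dirichlet boundary conditions for the first
eigenvalue: `0 ≠ e ∈ H^m_0(Ω)` and `(-Δ)^m e = λ₁(Ω) e` in the sense of distributions in `Ω`. -/
structure IsFirstEigenfunction {N : ℕ} (m : ℕ) (Ω : Set (E N)) (e : E N → ℝ) : Prop where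
  memH0 : MemH0 m Ω e
  ne_zero : ¬ e =ᵐ[volume.restrict Ω] 0
  eigen : ∀ η : E N → ℝ, IsTestFunction Ω η →
    (-1) ^ m * ∫ x in Ω, e x * iterLaplacian m η x = firstEigenvalue m Ω * ∫ x in Ω, e x * η x

/-- The nonlinearity `ψ(v) = |v|^{-n/(n+1)} v`. -/
def psi (n : ℝ) (s : ℝ) : ℝ := |s| ^ (-(n / (n + 1))) * s

/-- `v` is a weak solution on `Ω × [0, τ)`, `0 < τ ≤ ∞`, of the equation
`(ψ(v))_t = (-1)^{m+1} Δ^m v + f(v)` with the Dirichlet conditions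
`v = Dv = … = D^{m-1} v = 0` on `∂Ω`, and with initial datum `v 0`:
`v ∈ L¹(0, t; H^m_0(Ω))` for all `t < τ`, `ψ(v(t)) ∈ L²(Ω)` for all `t < τ`, and the equation
holds in the sense of distributions in `Ω`, integrated over `(0, t)`. -/
structure IsWeakSolution {N : ℕ} (m : ℕ) (n : ℝ) (Ω : Set (E N)) (f : ℝ → ℝ) (τ : EReal)
    (v : ℝ → E N → ℝ) : Prop where
  pos : 0 < τ
  memLp : ∀ t : ℝ, 0 ≤ t → (t : EReal) < τ →
    MemLp (fun x => psi n (v t x)) 2 (volume.restrict Ω)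
  sobolev : ∃ V : ℝ → SobolevJet N m,
    (∀ t : ℝ, 0 ≤ t → (t : EReal) < τ → IntegrableOn V (Ioc 0 t)) ∧
    ∀ᵐ r : ℝ, 0 < r → (r : EReal) < τ →
      V r ∈ sobolevH0 m Ω ∧ SobolevJet.toFun (V r) =ᵐ[volume.restrict Ω] v r
  equation : ∀ t : ℝ, 0 ≤ t → (t : EReal) < τ → ∀ η : E N → ℝ, IsTestFunction Ω η →
    ∫ x in Ω, psi n (v t x) * η x = (∫ x in Ω, psi n (v 0 x) * η x) +
      ∫ r in (0 : ℝ)..t,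
        ((-1) ^ (m + 1) * (∫ x in Ω, v r x * iterLaplacian m η x) + ∫ x in Ω, f (v r x) * η x)

/-- The first Fourier coefficient `J = ∫_Ω ψ(w) e dx`. -/
def fourierJ {N : ℕ} (n : ℝ) (Ω : Set (E N)) (e w : E N → ℝ) : ℝ :=
  ∫ x in Ω, psi n (w x) * e x

/-- `c₂ = (∫_Ω e dx)^{-n}`. -/
def c2 {N : ℕ} (n : ℝ) (Ω : Set (E N)) (e : E N → ℝ) : ℝ := (∫ x in Ω, e x) ^ (-n)

/-- `A = (1 / (n c₂ (1 - λ₁)))^{1/n}`. -/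
def ampA {N : ℕ} (m : ℕ) (n : ℝ) (Ω : Set (E N)) (e : E N → ℝ) : ℝ :=
  (1 / (n * c2 n Ω e * (1 - firstEigenvalue m Ω))) ^ (1 / n)

/-- `T = J₀^{-n} / (n c₂ (1 - λ₁))`. -/
def timeT {N : ℕ} (m : ℕ) (n : ℝ) (Ω : Set (E N)) (e : E N → ℝ) (J₀ : ℝ) : ℝ :=
  J₀ ^ (-n) / (n * c2 n Ω e * (1 - firstEigenvalue m Ω))

end PolyBlowup

end

open PolyBlowup

/-!
A positive first eigenfunction `e₁` turns the equation into an ordinary differential inequality.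
Formally, testing with `e₁` and using `(-Δ)^m e₁ = λ₁ e₁`,
`J' = -λ₁ ∫ v e₁ + ∫ |v| e₁ ≥ (1 - λ₁) ∫ |v| e₁ ≥ (1 - λ₁) c₂ |J|^{n+1}`,
where the last step is Hölder's inequality, because `|ψ(v)| = |v|^{1/(n+1)}`. Comparison with the
explicit solution of `y' = (1 - λ₁) c₂ y^{n+1}` gives the blow-up rate and the bound on the
existence time (`blowup_of_integral_inequality`, `IsWeakSolution.blowup`). Since `e₁` is only a
limit of test functions `η_l` in the energy norm, the equation is tested with `η_l` first. By the
Cauchy–Schwarz inequality for the energy form, the error in `(-1)^m ∫ v Δ^m η_l ≈ λ₁ ∫ v e₁` is at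
most `ε_l ‖v‖_{H^m}` with `ε_l → 0`, which is integrable in time
(`EnergyApprox.exists_jet_rate`, `IsWeakSolution.exists_fourierJ_eq`).

The other half is the sign of the first eigenfunctions.

In a ball of radius `R` this rests on Boggio's positivity theorem. For `|y| < R`, with
`D = |x - y|²` and `P = (R² - |x|²)(R² - |y|²) / R²`, the function
`W(x) = ∫_0^P p^{m-1} (D + p)^{-N/2} dp` is positive in the ball, vanishes to order `m` on the
sphere, and is a multiple of the Green function of `(-Δ)^m`. To avoid singular integrals the power
`s^{-N/2}` is replaced by a smooth regularisation `Φ_ε` at scale `ε`, which increases as `ε`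
decreases. The Laplacian of the kernel of order `m` then splits into the kernel of order `m - 1`, a
term `(R² - |x|²)^{m-2}` times a harmonic function, which is annihilated by `Δ^{m-1}` (Almansi),
and a term supported where `D < ε²`. By induction `(-Δ)^m W_ε` is exactly a rescaled, compactly
supported kernel of positive mass, centred at `y` (`iterLaplacian_boggio`,
`Profile.kernel_scale`, `Profile.integral_kernel_pos`). Testing `(-Δ)^m u = f ≥ 0` with `W_ε`,
cut off near the sphere with bounded energy, and letting `ε → 0` at a Lebesgue point `y` of `u`
gives `u(y) > 0` unless `f = 0` (`EnergyApprox.nonneg_and_pos_of_ball`). If now `e` is a first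
eigenfunction, the solution `g` of `(-Δ)^m g = λ₁ |e|` satisfies `g ≥ |e|`, and the Rayleigh
quotient forces `g = |e|`. Hence `|e| ± e` solve the equation with right-hand sides `λ₁ (|e| ± e)`,
and each of them is zero or positive.

For `m = 1` in a general domain, `|e|` solves the eigenvalue equation because it minimises the
Rayleigh quotient (`IsFirstEigenfunction.weakForm_abs_eq`), and Boggio's theorem is replaced by the
strong maximum principle for the weakly superharmonic functions `|e| ± e`
(`ae_eq_zero_or_ae_pos`), which is proved with the same regularised powers: the means of a
superharmonic function against the kernels belonging to `Φ_ε` increase as `ε → 0`.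
-/

namespace PolyBlowup

variable {N : ℕ}

/-! ### Partial derivatives and the Laplacian of smooth functions -/

/-- The partial derivative `∂ᵢ f`. -/
noncomputable def pd (i : Fin N) (f : E N → ℝ) : E N → ℝ :=
  fun x => fderiv ℝ f x (EuclideanSpace.single i 1)

/-- The Laplacian, restricted to real functions on `ℝ^N`. -/
noncomputable abbrev lap (f : E N → ℝ) : E N → ℝ := Laplacian.laplacian f

theorem contDiff_pd {f : E N → ℝ} (hf : ContDiff ℝ ∞ f) (i : Fin N) : ContDiff ℝ ∞ (pd i f) :=
  (hf.fderiv_right (m := ∞) (by simp)).clm_apply contDiff_const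

theorem lap_eq_sum_pd {f : E N → ℝ} (hf : ContDiff ℝ ∞ f) :
    lap f = fun x => ∑ i, pd i (pd i f) x := by
  unfold lap
  rw [InnerProductSpace.laplacian_eq_iteratedFDeriv_orthonormalBasis f
    (EuclideanSpace.basisFun (Fin N) ℝ)]
  funext x
  refine Finset.sum_congr rfl fun i _ => ?_
  rw [iteratedFDeriv_two_apply]
  have h : DifferentiableAt ℝ (fderiv ℝ f) x :=
    ((hf.fderiv_right (m := ∞) (by simp)).differentiable (by simp)) x
  change _ = fderiv ℝ (fun x => fderiv ℝ f x (EuclideanSpace.single i 1)) x _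
  rw [fderiv_clm_apply h (by fun_prop)]
  simp

theorem contDiff_lap {f : E N → ℝ} (hf : ContDiff ℝ ∞ f) : ContDiff ℝ ∞ (lap f) := by
  rw [lap_eq_sum_pd hf]
  exact ContDiff.sum fun i _ => contDiff_pd (contDiff_pd hf i) i

theorem iterLaplacian_zero (f : E N → ℝ) : iterLaplacian 0 f = f := rfl

theorem iterLaplacian_succ (k : ℕ) (f : E N → ℝ) :
    iterLaplacian (k + 1) f = iterLaplacian k (lap f) := rfl

theorem iterLaplacian_succ' (k : ℕ) (f : E N → ℝ) :
    iterLaplacian (k + 1) f = lap (iterLaplacian k f) :=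
  Function.iterate_succ_apply' _ _ _

theorem iterLaplacian_add (j k : ℕ) (f : E N → ℝ) :
    iterLaplacian (j + k) f = iterLaplacian j (iterLaplacian k f) :=
  Function.iterate_add_apply _ _ _ _

theorem contDiff_iterLaplacian {f : E N → ℝ} (hf : ContDiff ℝ ∞ f) (k : ℕ) :
    ContDiff ℝ ∞ (iterLaplacian k f) := by
  induction k with
  | zero => exact hf
  | succ k ih => rw [iterLaplacian_succ']; exact contDiff_lap ih

theorem pd_add {f g : E N → ℝ} (hf : ContDiff ℝ ∞ f) (hg : ContDiff ℝ ∞ g) (i : Fin N) :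
    pd i (fun x => f x + g x) = fun x => pd i f x + pd i g x := by
  funext x
  simp only [pd]
  rw [fderiv_fun_add (hf.differentiable (by simp) x) (hg.differentiable (by simp) x)]
  rfl

theorem pd_mul {f g : E N → ℝ} (hf : ContDiff ℝ ∞ f) (hg : ContDiff ℝ ∞ g) (i : Fin N) :
    pd i (fun x => f x * g x) = fun x => f x * pd i g x + g x * pd i f x := by
  funext x
  simp only [pd]
  rw [fderiv_fun_mul (hf.differentiable (by simp) x) (hg.differentiable (by simp) x)]
  simp

theorem pd_const_mul {f : E N → ℝ} (hf : ContDiff ℝ ∞ f) (c : ℝ) (i : Fin N) :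
    pd i (fun x => c * f x) = fun x => c * pd i f x := by
  funext x
  simp only [pd]
  rw [fderiv_const_mul (hf.differentiable (by simp) x)]
  simp

theorem pd_comp {φ : ℝ → ℝ} {q : E N → ℝ} (hφ : ContDiff ℝ ∞ φ) (hq : ContDiff ℝ ∞ q)
    (i : Fin N) : pd i (fun x => φ (q x)) = fun x => deriv φ (q x) * pd i q x := by
  funext x
  simp only [pd]
  have h := ((hφ.differentiable (by simp) (q x)).hasDerivAt).comp_hasFDerivAt x
    (hq.differentiable (by simp) x).hasFDerivAt
  change fderiv ℝ (φ ∘ q) x _ = _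
  rw [h.fderiv]
  simp

theorem pd_comm {f : E N → ℝ} (hf : ContDiff ℝ ∞ f) (i j : Fin N) :
    pd i (pd j f) = pd j (pd i f) := by
  funext x
  have h : DifferentiableAt ℝ (fderiv ℝ f) x :=
    ((hf.fderiv_right (m := ∞) (by simp)).differentiable (by simp)) x
  change fderiv ℝ (fun x => fderiv ℝ f x (EuclideanSpace.single j 1)) x _ =
    fderiv ℝ (fun x => fderiv ℝ f x (EuclideanSpace.single i 1)) x _
  rw [fderiv_clm_apply h (by fun_prop), fderiv_clm_apply h (by fun_prop)]
  have hs : IsSymmSndFDerivAt ℝ f x := hf.contDiffAt.isSymmSndFDerivAt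
      (by simpa using WithTop.coe_le_coe.2 (le_top : (2 : ℕ∞) ≤ ⊤))
  simpa using hs _ _

theorem pd_sum {ι : Type*} (s : Finset ι) {f : ι → E N → ℝ} (hf : ∀ a, ContDiff ℝ ∞ (f a))
    (i : Fin N) : pd i (fun x => ∑ a ∈ s, f a x) = fun x => ∑ a ∈ s, pd i (f a) x := by
  funext x
  simp only [pd]
  rw [fderiv_fun_sum fun a _ => (hf a).differentiable (by simp) x]
  simp

theorem lap_add {f g : E N → ℝ} (hf : ContDiff ℝ ∞ f) (hg : ContDiff ℝ ∞ g) :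
    lap (fun x => f x + g x) = fun x => lap f x + lap g x := by
  rw [lap_eq_sum_pd (hf.add hg), lap_eq_sum_pd hf, lap_eq_sum_pd hg]
  funext x
  rw [← Finset.sum_add_distrib]
  refine Finset.sum_congr rfl fun i _ => ?_
  rw [pd_add hf hg, pd_add (contDiff_pd hf i) (contDiff_pd hg i)]

theorem lap_const_mul {f : E N → ℝ} (hf : ContDiff ℝ ∞ f) (c : ℝ) :
    lap (fun x => c * f x) = fun x => c * lap f x := by
  rw [lap_eq_sum_pd (contDiff_const.mul hf), lap_eq_sum_pd hf]
  funext x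
  rw [Finset.mul_sum]
  refine Finset.sum_congr rfl fun i _ => ?_
  rw [pd_const_mul hf, pd_const_mul (contDiff_pd hf i)]

theorem lap_sum {ι : Type*} (s : Finset ι) {f : ι → E N → ℝ} (hf : ∀ a, ContDiff ℝ ∞ (f a)) :
    lap (fun x => ∑ a ∈ s, f a x) = fun x => ∑ a ∈ s, lap (f a) x := by
  rw [lap_eq_sum_pd (ContDiff.sum fun a _ => hf a)]
  funext x
  simp_rw [fun a => lap_eq_sum_pd (hf a)]
  rw [Finset.sum_comm]
  refine Finset.sum_congr rfl fun i _ => ?_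
  rw [pd_sum s hf, pd_sum s fun a => contDiff_pd (hf a) i]

/-- Product rule for the Laplacian. -/
theorem lap_mul {f g : E N → ℝ} (hf : ContDiff ℝ ∞ f) (hg : ContDiff ℝ ∞ g) :
    lap (fun x => f x * g x) =
      fun x => f x * lap g x + 2 * (∑ i, pd i f x * pd i g x) + g x * lap f x := by
  rw [lap_eq_sum_pd (hf.mul hg), lap_eq_sum_pd hf, lap_eq_sum_pd hg]
  funext x
  rw [Finset.mul_sum, Finset.mul_sum, Finset.mul_sum, ← Finset.sum_add_distrib,
    ← Finset.sum_add_distrib]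
  refine Finset.sum_congr rfl fun i _ => ?_
  rw [pd_mul hf hg, pd_add (hf.mul (contDiff_pd hg i)) (hg.mul (contDiff_pd hf i)),
    pd_mul hf (contDiff_pd hg i), pd_mul hg (contDiff_pd hf i)]
  ring

theorem contDiff_deriv {φ : ℝ → ℝ} (hφ : ContDiff ℝ ∞ φ) : ContDiff ℝ ∞ (deriv φ) := by
  exact (contDiff_infty_iff_deriv.1 hφ).2

/-- Chain rule for the Laplacian. -/
theorem lap_comp {φ : ℝ → ℝ} {q : E N → ℝ} (hφ : ContDiff ℝ ∞ φ) (hq : ContDiff ℝ ∞ q) :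
    lap (fun x => φ (q x)) =
      fun x => deriv (deriv φ) (q x) * (∑ i, pd i q x * pd i q x) + deriv φ (q x) * lap q x := by
  have hd := contDiff_deriv hφ
  rw [lap_eq_sum_pd (f := fun x => φ (q x)) (hφ.comp hq), lap_eq_sum_pd hq]
  funext x
  rw [Finset.mul_sum, Finset.mul_sum, ← Finset.sum_add_distrib]
  refine Finset.sum_congr rfl fun i _ => ?_
  rw [pd_comp hφ hq, pd_mul (f := fun x => deriv φ (q x)) (hd.comp hq) (contDiff_pd hq i),
      pd_comp hd hq]
  ring

theorem lap_pd {f : E N → ℝ} (hf : ContDiff ℝ ∞ f) (i : Fin N) :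
    lap (pd i f) = pd i (lap f) := by
  rw [lap_eq_sum_pd (contDiff_pd hf i), lap_eq_sum_pd hf,
    pd_sum _ fun j => contDiff_pd (contDiff_pd hf j) j]
  funext x
  refine Finset.sum_congr rfl fun j _ => ?_
  rw [pd_comm hf j i, pd_comm (contDiff_pd hf j) j i]

theorem lap_congr_on {f g : E N → ℝ} {U : Set (E N)} (hU : IsOpen U) (h : EqOn f g U) :
    EqOn (lap f) (lap g) U := fun _ hx =>
  (InnerProductSpace.laplacian_congr_nhds (h.eventuallyEq_of_mem (hU.mem_nhds hx))).eq_of_nhds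

theorem iterLaplacian_congr_on {f g : E N → ℝ} {U : Set (E N)} (hU : IsOpen U) (h : EqOn f g U)
    (k : ℕ) : EqOn (iterLaplacian k f) (iterLaplacian k g) U := by
  induction k with
  | zero => exact h
  | succ k ih => rw [iterLaplacian_succ', iterLaplacian_succ']; exact lap_congr_on hU ih

theorem iterLaplacian_add_fun {f g : E N → ℝ} (hf : ContDiff ℝ ∞ f) (hg : ContDiff ℝ ∞ g)
    (k : ℕ) : iterLaplacian k (fun x => f x + g x) =
      fun x => iterLaplacian k f x + iterLaplacian k g x := by
  induction k with
  | zero => rfl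
  | succ k ih =>
    rw [iterLaplacian_succ', ih, lap_add (contDiff_iterLaplacian hf k)
      (contDiff_iterLaplacian hg k), iterLaplacian_succ', iterLaplacian_succ']

theorem iterLaplacian_const_mul {f : E N → ℝ} (hf : ContDiff ℝ ∞ f) (c : ℝ) (k : ℕ) :
    iterLaplacian k (fun x => c * f x) = fun x => c * iterLaplacian k f x := by
  induction k with
  | zero => rfl
  | succ k ih =>
    rw [iterLaplacian_succ', ih, lap_const_mul (contDiff_iterLaplacian hf k), iterLaplacian_succ']

theorem pd_comp_smul_sub {f : E N → ℝ} (hf : ContDiff ℝ ∞ f) (c : ℝ) (y : E N) (i : Fin N) :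
    pd i (fun x => f (c • (x - y))) = fun x => c * pd i f (c • (x - y)) := by
  funext x
  simp only [pd]
  have h1 : HasFDerivAt (fun x : E N => c • (x - y)) (c • ContinuousLinearMap.id ℝ (E N)) x :=
    ((hasFDerivAt_id x).sub_const y).const_smul c
  have h := (hf.differentiable (by simp) (c • (x - y))).hasFDerivAt.comp x h1
  change fderiv ℝ (f ∘ fun x => c • (x - y)) x _ = _
  rw [h.fderiv]
  simp

/-- The iterated Laplacian under translation and dilation. -/
theorem iterLaplacian_comp_smul_sub {f : E N → ℝ} (hf : ContDiff ℝ ∞ f) (c : ℝ) (y : E N)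
    (k : ℕ) : iterLaplacian k (fun x => f (c • (x - y))) =
      fun x => c ^ (2 * k) * iterLaplacian k f (c • (x - y)) := by
  have hsm : ∀ {g : E N → ℝ}, ContDiff ℝ ∞ g → ContDiff ℝ ∞ (fun x => g (c • (x - y))) :=
    fun hg => hg.comp (by fun_prop)
  have h1 : ∀ {g : E N → ℝ}, ContDiff ℝ ∞ g →
      lap (fun x => g (c • (x - y))) = fun x => c ^ 2 * lap g (c • (x - y)) := by
    intro g hg
    rw [lap_eq_sum_pd (hsm hg), lap_eq_sum_pd hg]
    funext x
    rw [Finset.mul_sum]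
    refine Finset.sum_congr rfl fun i _ => ?_
    rw [pd_comp_smul_sub hg, pd_const_mul (hsm (contDiff_pd hg i)),
      pd_comp_smul_sub (contDiff_pd hg i)]
    ring
  induction k with
  | zero => funext x; simp [iterLaplacian_zero]
  | succ k ih =>
    rw [iterLaplacian_succ', ih, lap_const_mul (hsm (contDiff_iterLaplacian hf k)),
      h1 (contDiff_iterLaplacian hf k), iterLaplacian_succ']
    funext x; ring

/-! ### Test functions and integration by parts -/

theorem support_pd_subset (f : E N → ℝ) (i : Fin N) : tsupport (pd i f) ⊆ tsupport f := by
  refine closure_minimal (fun x hx => ?_) (isClosed_tsupport f)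
  by_contra h
  refine hx ?_
  have h0 : f =ᶠ[𝓝 x] fun _ => 0 := notMem_tsupport_iff_eventuallyEq.1 h
  simp [pd, h0.fderiv_eq]

theorem tsupport_lap_subset {f : E N → ℝ} (hf : ContDiff ℝ ∞ f) :
    tsupport (lap f) ⊆ tsupport f := by
  refine closure_minimal (fun x hx => ?_) (isClosed_tsupport f)
  by_contra h
  refine hx ?_
  rw [lap_eq_sum_pd hf]
  refine Finset.sum_eq_zero fun i _ => ?_
  exact image_eq_zero_of_notMem_tsupport fun h' =>
    h (support_pd_subset f i (support_pd_subset _ i h'))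

namespace IsTestFunction

variable {Ω : Set (E N)} {φ η : E N → ℝ}

theorem mono {Ω' : Set (E N)} (h : IsTestFunction Ω φ) (hs : Ω ⊆ Ω') : IsTestFunction Ω' φ :=
  ⟨h.1, h.2.1, h.2.2.trans hs⟩

theorem add (h : IsTestFunction Ω φ) (h' : IsTestFunction Ω η) :
    IsTestFunction Ω (fun x => φ x + η x) :=
  ⟨h.1.add h'.1, h.2.1.add h'.2.1,
    (tsupport_add φ η).trans (union_subset h.2.2 h'.2.2)⟩

theorem mul_left {f : E N → ℝ} (hf : ContDiff ℝ ∞ f) (h : IsTestFunction Ω φ) :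
    IsTestFunction Ω (fun x => f x * φ x) :=
  ⟨hf.mul h.1, h.2.1.mul_left, (tsupport_mul_subset_right).trans h.2.2⟩

theorem const_mul (c : ℝ) (h : IsTestFunction Ω φ) : IsTestFunction Ω (fun x => c * φ x) :=
  mul_left contDiff_const h

theorem sub (h : IsTestFunction Ω φ) (h' : IsTestFunction Ω η) :
    IsTestFunction Ω (fun x => φ x - η x) := by
  simpa [sub_eq_add_neg] using h.add (h'.const_mul (-1))

theorem zero : IsTestFunction Ω (fun _ => 0) :=
  ⟨contDiff_const, HasCompactSupport.zero, by
    have : tsupport (fun _ : E N => (0 : ℝ)) = ∅ := tsupport_eq_empty_iff.2 rfl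
    rw [this]; exact empty_subset _⟩

theorem pd (h : IsTestFunction Ω φ) (i : Fin N) : IsTestFunction Ω (pd i φ) :=
  ⟨contDiff_pd h.1 i, h.2.1.of_isClosed_subset (isClosed_tsupport _) (support_pd_subset φ i),
    (support_pd_subset φ i).trans h.2.2⟩

theorem lap (h : IsTestFunction Ω φ) : IsTestFunction Ω (lap φ) :=
  ⟨contDiff_lap h.1, h.2.1.of_isClosed_subset (isClosed_tsupport _) (tsupport_lap_subset h.1),
    (tsupport_lap_subset h.1).trans h.2.2⟩

theorem iterLaplacian (h : IsTestFunction Ω φ) (k : ℕ) : IsTestFunction Ω (iterLaplacian k φ) := by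
  induction k with
  | zero => exact h
  | succ k ih => rw [iterLaplacian_succ']; exact ih.lap

theorem continuous (h : IsTestFunction Ω φ) : Continuous φ := h.1.continuous

theorem memLp (h : IsTestFunction Ω φ) (p : ENNReal) : MemLp φ p (volume : Measure (E N)) :=
  h.continuous.memLp_of_hasCompactSupport h.2.1

theorem integrable (h : IsTestFunction Ω φ) : Integrable φ (volume : Measure (E N)) :=
  h.continuous.integrable_of_hasCompactSupport h.2.1

theorem integrable_mul (h : IsTestFunction Ω φ) {f : E N → ℝ} (hf : Continuous f) :
    Integrable (fun x => φ x * f x) (volume : Measure (E N)) :=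
  (h.continuous.mul hf).integrable_of_hasCompactSupport h.2.1.mul_right

theorem eq_zero_of_notMem (h : IsTestFunction Ω φ) {x : E N} (hx : x ∉ Ω) : φ x = 0 :=
  image_eq_zero_of_notMem_tsupport fun h' => hx (h.2.2 h')

/-- Integrals against a test function may be taken over the whole space. -/
theorem setIntegral_mul (h : IsTestFunction Ω φ) (f : E N → ℝ) :
    ∫ x in Ω, f x * φ x = ∫ x, f x * φ x := by
  refine setIntegral_eq_integral_of_forall_compl_eq_zero fun x hx => ?_
  rw [h.eq_zero_of_notMem hx, mul_zero]

theorem integral_mul_pd (h : IsTestFunction Ω φ) {f : E N → ℝ} (hf : ContDiff ℝ ∞ f) (i : Fin N) :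
    ∫ x, φ x * PolyBlowup.pd i f x = - ∫ x, PolyBlowup.pd i φ x * f x :=
  integral_mul_fderiv_eq_neg_fderiv_mul_of_integrable
    ((h.pd i).integrable_mul hf.continuous) (h.integrable_mul (contDiff_pd hf i).continuous)
    (h.integrable_mul hf.continuous)
    (fun x _ => h.1.differentiable (by simp) x) (fun x _ => hf.differentiable (by simp) x)

theorem integral_mul_lap_eq_neg (h : IsTestFunction Ω φ) {f : E N → ℝ} (hf : ContDiff ℝ ∞ f) :
    ∫ x, φ x * PolyBlowup.lap f x =
      - ∫ x, ∑ i, PolyBlowup.pd i φ x * PolyBlowup.pd i f x := by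
  rw [lap_eq_sum_pd hf]
  simp_rw [Finset.mul_sum]
  rw [integral_finsetSum _ fun i _ =>
      h.integrable_mul (contDiff_pd (contDiff_pd hf i) i).continuous,
    integral_finsetSum _ fun i _ =>
      (h.pd i).integrable_mul (contDiff_pd hf i).continuous, ← Finset.sum_neg_distrib]
  exact Finset.sum_congr rfl fun i _ => h.integral_mul_pd (contDiff_pd hf i) i

theorem integral_mul_lap (h : IsTestFunction Ω φ) {f : E N → ℝ} (hf : ContDiff ℝ ∞ f) :
    ∫ x, φ x * PolyBlowup.lap f x = ∫ x, PolyBlowup.lap φ x * f x := by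
  rw [h.integral_mul_lap_eq_neg hf, lap_eq_sum_pd h.1]
  simp_rw [Finset.sum_mul]
  rw [integral_finsetSum _ fun i _ =>
      ((h.pd i).pd i).integrable_mul hf.continuous,
    integral_finsetSum _ fun i _ =>
      (h.pd i).integrable_mul (contDiff_pd hf i).continuous, ← Finset.sum_neg_distrib]
  refine Finset.sum_congr rfl fun i _ => ?_
  rw [(h.pd i).integral_mul_pd hf i, neg_neg]

theorem integral_mul_iterLaplacian (h : IsTestFunction Ω φ) {f : E N → ℝ} (hf : ContDiff ℝ ∞ f)
    (k : ℕ) : ∫ x, φ x * PolyBlowup.iterLaplacian k f x =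
      ∫ x, PolyBlowup.iterLaplacian k φ x * f x := by
  induction k generalizing φ with
  | zero => rfl
  | succ k ih =>
    rw [iterLaplacian_succ', h.integral_mul_lap (contDiff_iterLaplacian hf k), ih h.lap]
    rfl

end IsTestFunction

/-! ### The energy form -/

/-- The bilinear form `∫ φ (-Δ)^m η` associated with the Dirichlet energy. -/
noncomputable def energyForm (m : ℕ) (φ η : E N → ℝ) : ℝ :=
  (-1) ^ m * ∫ x, φ x * iterLaplacian m η x

theorem norm_gradient_sq (f : E N → ℝ) (x : E N) :
    ‖gradient f x‖ ^ 2 = ∑ i, pd i f x * pd i f x := by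
  rw [EuclideanSpace.norm_sq_eq]
  refine Finset.sum_congr rfl fun i _ => ?_
  have h : (gradient f x) i = pd i f x := by
    have h1 : inner ℝ (gradient f x) (EuclideanSpace.single i (1 : ℝ)) = pd i f x := by
      simp [gradient, pd]
    rw [← h1, EuclideanSpace.inner_single_right]
    simp
  rw [h, Real.norm_eq_abs, sq_abs, sq]

section

variable {Ω : Set (E N)} {φ η : E N → ℝ}

theorem energyForm_comm (hφ : IsTestFunction Ω φ) (hη : IsTestFunction Ω η) (m : ℕ) :
    energyForm m φ η = energyForm m η φ := by
  unfold energyForm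
  rw [hφ.integral_mul_iterLaplacian hη.1]
  simp_rw [mul_comm (η _)]

theorem energyForm_self (hφ : IsTestFunction Ω φ) (m : ℕ) :
    energyForm m φ φ = dirichletEnergy m φ := by
  unfold energyForm dirichletEnergy
  split_ifs with h
  · obtain ⟨k, rfl⟩ := h
    rw [Even.neg_one_pow ⟨k, rfl⟩, one_mul, iterLaplacian_add,
      hφ.integral_mul_iterLaplacian (contDiff_iterLaplacian hφ.1 k),
      show (k + k) / 2 = k by omega]
    simp_rw [sq]
  · obtain ⟨k, rfl⟩ := Nat.not_even_iff_odd.1 h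
    rw [show (2 * k + 1) / 2 = k by omega, Odd.neg_one_pow ⟨k, rfl⟩,
      show 2 * k + 1 = k + (k + 1) by ring, iterLaplacian_add,
      hφ.integral_mul_iterLaplacian (contDiff_iterLaplacian hφ.1 _), iterLaplacian_succ',
      (hφ.iterLaplacian k).integral_mul_lap_eq_neg (contDiff_iterLaplacian hφ.1 k)]
    simp_rw [norm_gradient_sq]
    ring

theorem dirichletEnergy_nonneg (m : ℕ) (φ : E N → ℝ) : 0 ≤ dirichletEnergy m φ := by
  unfold dirichletEnergy
  split_ifs
  · exact integral_nonneg fun x => sq_nonneg _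
  · exact integral_nonneg fun x => sq_nonneg _

theorem energyForm_add_right (hφ : IsTestFunction Ω φ) {η₁ η₂ : E N → ℝ}
    (h₁ : IsTestFunction Ω η₁) (h₂ : IsTestFunction Ω η₂) (m : ℕ) :
    energyForm m φ (fun x => η₁ x + η₂ x) = energyForm m φ η₁ + energyForm m φ η₂ := by
  unfold energyForm
  rw [iterLaplacian_add_fun h₁.1 h₂.1]
  simp_rw [mul_add]
  rw [integral_add (hφ.integrable_mul (h₁.iterLaplacian m).continuous)
    (hφ.integrable_mul (h₂.iterLaplacian m).continuous)]
  ring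

theorem energyForm_const_mul_right {η₁ : E N → ℝ}
    (h₁ : IsTestFunction Ω η₁) (c : ℝ) (φ : E N → ℝ) (m : ℕ) :
    energyForm m φ (fun x => c * η₁ x) = c * energyForm m φ η₁ := by
  unfold energyForm
  rw [iterLaplacian_const_mul h₁.1]
  simp_rw [mul_left_comm _ c, integral_const_mul]
  ring

theorem energyForm_add_left (hη : IsTestFunction Ω η) {φ₁ φ₂ : E N → ℝ}
    (h₁ : IsTestFunction Ω φ₁) (h₂ : IsTestFunction Ω φ₂) (m : ℕ) :
    energyForm m (fun x => φ₁ x + φ₂ x) η = energyForm m φ₁ η + energyForm m φ₂ η := by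
  rw [energyForm_comm (h₁.add h₂) hη, energyForm_add_right hη h₁ h₂, energyForm_comm hη h₁,
    energyForm_comm hη h₂]

theorem energyForm_const_mul_left (φ₁ : E N → ℝ) (c : ℝ) (η : E N → ℝ) (m : ℕ) :
    energyForm m (fun x => c * φ₁ x) η = c * energyForm m φ₁ η := by
  unfold energyForm
  simp_rw [mul_assoc, integral_const_mul]
  ring

end

/-- The space of test functions. -/
def testSubmodule (Ω : Set (E N)) : Submodule ℝ (E N → ℝ) where
  carrier := {φ | IsTestFunction Ω φ}
  add_mem' h h' := h.add h'
  zero_mem' := IsTestFunction.zero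
  smul_mem' c _ h := h.const_mul c

/-- The energy form as a bilinear form on the space of test functions. -/
noncomputable def energyBilin (m : ℕ) (Ω : Set (E N)) :
    LinearMap.BilinForm ℝ (testSubmodule Ω) :=
  LinearMap.mk₂ ℝ (fun φ η => energyForm m (φ : E N → ℝ) (η : E N → ℝ))
    (fun φ₁ φ₂ η => energyForm_add_left η.2 φ₁.2 φ₂.2 m)
    (fun c φ η => energyForm_const_mul_left φ.1 c η.1 m)
    (fun φ η₁ η₂ => energyForm_add_right φ.2 η₁.2 η₂.2 m)
    (fun c φ η => energyForm_const_mul_right η.2 c φ.1 m)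

theorem energyForm_self_nonneg {Ω : Set (E N)} {φ : E N → ℝ} (h : IsTestFunction Ω φ) (m : ℕ) :
    0 ≤ energyForm m φ φ := by
  rw [energyForm_self h]; exact dirichletEnergy_nonneg m φ

/-- Cauchy–Schwarz inequality for the energy form. -/
theorem energyForm_sq_le {Ω : Set (E N)} {φ η : E N → ℝ} (hφ : IsTestFunction Ω φ)
    (hη : IsTestFunction Ω η) (m : ℕ) :
    energyForm m φ η ^ 2 ≤ energyForm m φ φ * energyForm m η η := by
  have h := LinearMap.BilinForm.apply_mul_apply_le_of_forall_zero_le (energyBilin m Ω)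
    (fun φ => energyForm_self_nonneg φ.2 m) ⟨φ, hφ⟩ ⟨η, hη⟩
  have h' : energyForm m φ η * energyForm m η φ ≤ energyForm m φ φ * energyForm m η η := h
  rwa [energyForm_comm hη hφ, ← sq] at h'

/-! ### Bounds by the full derivative of the same order -/

theorem norm_iteratedFDeriv_pd_le {f : E N → ℝ} (hf : ContDiff ℝ ∞ f) (i : Fin N) (j : ℕ)
    (x : E N) : ‖iteratedFDeriv ℝ j (pd i f) x‖ ≤ ‖iteratedFDeriv ℝ (j + 1) f x‖ := by
  have h := (ContinuousLinearMap.apply ℝ ℝ (EuclideanSpace.single i (1 : ℝ) :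
    E N)).norm_iteratedFDeriv_comp_left (f := fderiv ℝ f) (x := x) (N := ∞) (n := j)
    ((hf.fderiv_right (m := ∞) (by simp)).contDiffAt) (by exact_mod_cast le_top)
  have h1 : ‖ContinuousLinearMap.apply ℝ ℝ (EuclideanSpace.single i (1 : ℝ) : E N)‖ ≤ 1 := by
    refine ContinuousLinearMap.opNorm_le_bound _ zero_le_one fun L => ?_
    have := L.le_opNorm (EuclideanSpace.single i (1 : ℝ) : E N)
    simpa using this
  rw [norm_iteratedFDeriv_fderiv] at h
  exact h.trans (mul_le_of_le_one_left (norm_nonneg _) h1)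

theorem norm_iteratedFDeriv_iterLaplacian_le {f : E N → ℝ} (hf : ContDiff ℝ ∞ f) (k j : ℕ)
    (x : E N) : ‖iteratedFDeriv ℝ j (iterLaplacian k f) x‖ ≤
      (N : ℝ) ^ k * ‖iteratedFDeriv ℝ (j + 2 * k) f x‖ := by
  induction k generalizing j with
  | zero => simp [iterLaplacian_zero]
  | succ k ih =>
    have hg := contDiff_iterLaplacian hf k
    rw [iterLaplacian_succ', lap_eq_sum_pd hg,
      iteratedFDeriv_sum fun i _ => ((contDiff_pd (contDiff_pd hg i) i).of_le
        (by exact_mod_cast le_top))]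
    calc ‖(∑ i, iteratedFDeriv ℝ j (pd i (pd i (iterLaplacian k f)))) x‖
        ≤ ∑ i : Fin N, ‖iteratedFDeriv ℝ (j + 2) (iterLaplacian k f) x‖ := by
          rw [Finset.sum_apply]
          refine (norm_sum_le _ _).trans (Finset.sum_le_sum fun i _ => ?_)
          exact (norm_iteratedFDeriv_pd_le (contDiff_pd hg i) i j x).trans
            (norm_iteratedFDeriv_pd_le hg i (j + 1) x)
      _ ≤ ∑ i : Fin N, (N : ℝ) ^ k * ‖iteratedFDeriv ℝ (j + 2 * (k + 1)) f x‖ := by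
          refine Finset.sum_le_sum fun i _ => ?_
          have := ih (j + 2)
          rwa [show j + 2 + 2 * k = j + 2 * (k + 1) by ring] at this
      _ = _ := by simp [pow_succ]; ring

/-- The integrand of the Dirichlet energy is controlled by the full derivative of order `m`. -/
theorem dirichletEnergy_le_integral {Ω : Set (E N)} {φ : E N → ℝ} (h : IsTestFunction Ω φ)
    (m : ℕ) : dirichletEnergy m φ ≤
      ((N : ℝ) ^ (m / 2)) ^ 2 * ∫ x, ‖iteratedFDeriv ℝ m φ x‖ ^ 2 := by
  have hc : Integrable (fun x => ((N : ℝ) ^ (m / 2)) ^ 2 * ‖iteratedFDeriv ℝ m φ x‖ ^ 2)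
      (volume : Measure (E N)) := by
    refine Integrable.const_mul (Continuous.integrable_of_hasCompactSupport ?_ ?_) _
    · exact ((h.1.continuous_iteratedFDeriv (by exact_mod_cast le_top)).norm).pow 2
    · have := h.2.1.iteratedFDeriv (𝕜 := ℝ) m
      exact this.comp_left (g := fun T => ‖T‖ ^ 2) (by simp)
  unfold dirichletEnergy
  rw [← integral_const_mul]
  split_ifs with hm
  · refine integral_mono_of_nonneg (ae_of_all _ fun x => sq_nonneg _) hc (ae_of_all _ fun x => ?_)
    have h1 := norm_iteratedFDeriv_iterLaplacian_le h.1 (m / 2) 0 x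
    rw [norm_iteratedFDeriv_zero, zero_add, Nat.mul_div_cancel' hm.two_dvd] at h1
    simp only
    rw [← mul_pow, ← sq_abs]
    exact pow_le_pow_left₀ (abs_nonneg _) h1 2
  · refine integral_mono_of_nonneg (ae_of_all _ fun x => sq_nonneg _) hc (ae_of_all _ fun x => ?_)
    have h1 := norm_iteratedFDeriv_iterLaplacian_le h.1 (m / 2) 1 x
    have hm' := Nat.odd_iff.1 (Nat.not_even_iff_odd.1 hm)
    rw [norm_iteratedFDeriv_one, show 1 + 2 * (m / 2) = m by omega] at h1
    simp only
    rw [← mul_pow]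
    refine pow_le_pow_left₀ (norm_nonneg _) ?_ 2
    simpa [gradient] using h1

/-! ### Quadratic polynomials and Almansi's identity -/

theorem pd_coord (i j : Fin N) : pd j (fun x : E N => x i) = fun _ => if i = j then 1 else 0 := by
  funext x
  have h : HasFDerivAt (fun x : E N => x i) (EuclideanSpace.proj i : E N →L[ℝ] ℝ) x :=
    (EuclideanSpace.proj i : E N →L[ℝ] ℝ).hasFDerivAt
  simp only [pd]
  rw [h.fderiv]
  simp

theorem contDiff_coord (i : Fin N) : ContDiff ℝ ∞ (fun x : E N => x i) :=
  (EuclideanSpace.proj i : E N →L[ℝ] ℝ).contDiff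

theorem pd_const (c : ℝ) (i : Fin N) : pd i (fun _ : E N => c) = fun _ => 0 := by
  funext x; simp [pd]

theorem lap_coord (i : Fin N) : lap (fun x : E N => x i) = fun _ => 0 := by
  rw [lap_eq_sum_pd (contDiff_coord i)]
  funext x
  refine Finset.sum_eq_zero fun j _ => ?_
  rw [pd_coord, pd_const]

/-- A general isotropic quadratic polynomial, `a |x|² - 2 ⟨x, z⟩ + c`. -/
noncomputable def quad (a : ℝ) (z : E N) (c : ℝ) (x : E N) : ℝ :=
  a * ‖x‖ ^ 2 - 2 * inner ℝ x z + c

theorem contDiff_quad (a : ℝ) (z : E N) (c : ℝ) : ContDiff ℝ ∞ (quad a z c) := by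
  unfold quad
  exact ((contDiff_const.mul (contDiff_norm_sq ℝ)).sub (contDiff_const.mul
    (contDiff_id.inner ℝ contDiff_const))).add contDiff_const

theorem pd_quad (a : ℝ) (z : E N) (c : ℝ) (i : Fin N) :
    pd i (quad a z c) = fun x => 2 * (a * x i - z i) := by
  funext x
  have h1 : HasFDerivAt (fun x : E N => ‖x‖ ^ 2) (2 • innerSL ℝ x) x :=
    (hasStrictFDerivAt_norm_sq x).hasFDerivAt
  have h2 : HasFDerivAt (fun x : E N => inner ℝ x z) (innerSL ℝ z) x := by
    have := (innerSL ℝ z : E N →L[ℝ] ℝ).hasFDerivAt (x := x)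
    simpa [real_inner_comm] using this
  have h : HasFDerivAt (quad a z c) (a • (2 • innerSL ℝ x) - (2 : ℝ) • innerSL ℝ z) x :=
    ((h1.const_mul a).sub (h2.const_mul 2)).add_const c
  simp only [pd]
  rw [h.fderiv]
  simp [EuclideanSpace.inner_single_right]
  ring

theorem lap_quad (a : ℝ) (z : E N) (c : ℝ) : lap (quad a z c) = fun _ => 2 * N * a := by
  rw [lap_eq_sum_pd (contDiff_quad a z c)]
  funext x
  have h : ∀ i, pd i (pd i (quad a z c)) x = 2 * a := by
    intro i
    have : pd i (quad a z c) = quad 0 (EuclideanSpace.single i (-a)) (-2 * z i) := by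
      rw [pd_quad]
      funext x
      simp [quad, EuclideanSpace.inner_single_right]
      ring
    rw [this, pd_quad]
    simp
  simp [h]
  ring

/-- Inner product of the gradients of two isotropic quadratic polynomials. -/
theorem sum_pd_quad (a b : ℝ) (z w : E N) (c d : ℝ) (x : E N) :
    ∑ i, pd i (quad a z c) x * pd i (quad b w d) x =
      4 * (a * b * ‖x‖ ^ 2 - a * inner ℝ x w - b * inner ℝ x z + inner ℝ z w) := by
  simp_rw [pd_quad]
  rw [EuclideanSpace.norm_sq_eq]
  simp only [PiLp.inner_apply, Real.norm_eq_abs, sq_abs]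
  rw [Finset.mul_sum, Finset.mul_sum, Finset.mul_sum, ← Finset.sum_sub_distrib,
    ← Finset.sum_sub_distrib, ← Finset.sum_add_distrib, Finset.mul_sum]
  refine Finset.sum_congr rfl fun i _ => ?_
  simp
  ring

/-- The Euler operator `∑ xᵢ ∂ᵢ`. -/
noncomputable def euler (f : E N → ℝ) (x : E N) : ℝ := ∑ i, x i * pd i f x

theorem contDiff_euler {f : E N → ℝ} (hf : ContDiff ℝ ∞ f) : ContDiff ℝ ∞ (euler f) :=
  ContDiff.sum fun i _ => (contDiff_coord i).mul (contDiff_pd hf i)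

theorem lap_euler {f : E N → ℝ} (hf : ContDiff ℝ ∞ f) :
    lap (euler f) = fun x => euler (lap f) x + 2 * lap f x := by
  unfold euler
  rw [lap_sum _ fun i => (contDiff_coord i).mul (contDiff_pd hf i)]
  funext x
  rw [show lap f x = ∑ i, pd i (pd i f) x by rw [lap_eq_sum_pd hf], Finset.mul_sum,
    ← Finset.sum_add_distrib]
  refine Finset.sum_congr rfl fun i _ => ?_
  rw [lap_mul (contDiff_coord i) (contDiff_pd hf i), lap_coord, lap_pd hf]
  simp [pd_coord]

theorem lap_normSq_mul {f : E N → ℝ} (hf : ContDiff ℝ ∞ f) :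
    lap (fun x => ‖x‖ ^ 2 * f x) = fun x => ‖x‖ ^ 2 * lap f x + 4 * euler f x + 2 * N * f x := by
  have h : (fun x : E N => ‖x‖ ^ 2 * f x) = fun x => quad 1 0 0 x * f x := by
    funext x; simp [quad]
  rw [h, lap_mul (contDiff_quad _ _ _) hf, lap_quad]
  funext x
  simp_rw [pd_quad]
  simp only [quad, euler]
  have : ∑ i, 2 * (1 * x i - (0 : E N) i) * pd i f x = 2 * ∑ i, x i * pd i f x := by
    rw [Finset.mul_sum]
    refine Finset.sum_congr rfl fun i _ => ?_
    simp; ring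
  rw [this]
  simp
  ring

theorem iterLaplacian_normSq_mul {f : E N → ℝ} (hf : ContDiff ℝ ∞ f) (k : ℕ) :
    ∃ c : ℝ, iterLaplacian (k + 1) (fun x => ‖x‖ ^ 2 * f x) = fun x =>
      ‖x‖ ^ 2 * iterLaplacian (k + 1) f x + 4 * (k + 1) * euler (iterLaplacian k f) x +
        c * iterLaplacian k f x := by
  induction k with
  | zero =>
    refine ⟨2 * N, ?_⟩
    rw [iterLaplacian_succ', iterLaplacian_zero, lap_normSq_mul hf]
    simp [iterLaplacian_succ', iterLaplacian_zero]
  | succ k ih =>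
    obtain ⟨c, hc⟩ := ih
    have h0 := contDiff_iterLaplacian hf k
    have h1 := contDiff_iterLaplacian hf (k + 1)
    have hn : ContDiff ℝ ∞ fun x : E N => ‖x‖ ^ 2 := contDiff_norm_sq ℝ
    refine ⟨2 * N + 8 * (k + 1) + c, ?_⟩
    rw [iterLaplacian_succ', hc, lap_add ((hn.mul h1).add (contDiff_const.mul (contDiff_euler h0)))
      (contDiff_const.mul h0), lap_add (hn.mul h1) (contDiff_const.mul (contDiff_euler h0)),
      lap_normSq_mul h1, lap_const_mul (contDiff_euler h0), lap_euler h0, lap_const_mul h0,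
      ← iterLaplacian_succ', ← iterLaplacian_succ']
    funext x
    push_cast
    ring

/-- **Almansi**: multiplying a function annihilated by `Δ^k` by `a + b |x|²` gives a function
annihilated by `Δ^{k+1}`. -/
theorem iterLaplacian_affine_normSq_mul_eq_zero {f : E N → ℝ} (hf : ContDiff ℝ ∞ f) {U : Set (E N)}
    (hU : IsOpen U) {k : ℕ} (h : ∀ x ∈ U, iterLaplacian k f x = 0) (a b : ℝ) :
    ∀ x ∈ U, iterLaplacian (k + 1) (fun x => (a + b * ‖x‖ ^ 2) * f x) x = 0 := by
  intro x hx
  have hn : ContDiff ℝ ∞ fun x : E N => ‖x‖ ^ 2 := contDiff_norm_sq ℝ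
  have he : (fun x : E N => (a + b * ‖x‖ ^ 2) * f x) =
      fun x => a * f x + b * (‖x‖ ^ 2 * f x) := by funext x; ring
  obtain ⟨c, hc⟩ := iterLaplacian_normSq_mul hf k
  have h1 : iterLaplacian (k + 1) f x = 0 := by
    rw [iterLaplacian_succ', lap_congr_on hU (g := fun _ => 0) h hx]
    exact congrFun InnerProductSpace.laplacian_const x
  have h2 : euler (iterLaplacian k f) x = 0 := by
    refine Finset.sum_eq_zero fun i _ => ?_
    have : iterLaplacian k f =ᶠ[𝓝 x] fun _ => 0 := by
      filter_upwards [hU.mem_nhds hx] with y hy using h y hy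
    simp [pd, this.fderiv_eq]
  rw [he, iterLaplacian_add_fun (contDiff_const.mul hf) (contDiff_const.mul (hn.mul hf)),
    iterLaplacian_const_mul hf, iterLaplacian_const_mul (hn.mul hf), hc]
  simp [h1, h2, h x hx]

theorem iterLaplacian_pow_mul_eq_zero {f : E N → ℝ} (hf : ContDiff ℝ ∞ f) {U : Set (E N)}
    (hU : IsOpen U) (h : ∀ x ∈ U, lap f x = 0) (a b : ℝ) (k : ℕ) :
    ∀ x ∈ U, iterLaplacian (k + 1) (fun x => (a + b * ‖x‖ ^ 2) ^ k * f x) x = 0 := by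
  induction k with
  | zero => simpa [iterLaplacian_succ', iterLaplacian_zero] using h
  | succ k ih =>
    have hn : ContDiff ℝ ∞ fun x : E N => ‖x‖ ^ 2 := contDiff_norm_sq ℝ
    have := iterLaplacian_affine_normSq_mul_eq_zero
      ((((contDiff_const (c := a)).add ((contDiff_const (c := b)).mul hn)).pow k).mul hf) hU ih a b
    simpa [pow_succ', mul_assoc] using this

/-! ### Integrals depending smoothly on a parameter -/

theorem hasFDerivAt_integral_unitInterval {H F : Type*} [NormedAddCommGroup H] [NormedSpace ℝ H]
    [FiniteDimensional ℝ H] [NormedAddCommGroup F] [NormedSpace ℝ F] {f : H × ℝ → F}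
    (hf : ContDiff ℝ 1 f) (x : H) :
    HasFDerivAt (fun x => ∫ θ in (0 : ℝ)..1, f (x, θ))
      (∫ θ in (0 : ℝ)..1, (fderiv ℝ f (x, θ)).comp (ContinuousLinearMap.inl ℝ H ℝ)) x := by
  have hc : Continuous fun p : H × ℝ => (fderiv ℝ f p).comp (ContinuousLinearMap.inl ℝ H ℝ) :=
    (hf.continuous_fderiv (by simp)).clm_comp continuous_const
  obtain ⟨C, hC⟩ := ((isCompact_closedBall x 1).prod (isCompact_Icc (a := (0 : ℝ))
    (b := 1))).exists_bound_of_continuousOn hc.continuousOn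
  refine intervalIntegral.hasFDerivAt_integral_of_dominated_of_fderiv_le (bound := fun _ => C)
    (F' := fun x θ => (fderiv ℝ f (x, θ)).comp (ContinuousLinearMap.inl ℝ H ℝ))
    (Metric.ball_mem_nhds x one_pos) ?_ ?_ ?_ ?_ ?_ ?_
  · exact Eventually.of_forall fun y => (hf.continuous.comp
      (Continuous.prodMk_right y)).aestronglyMeasurable
  · exact (hf.continuous.comp (Continuous.prodMk_right x)).intervalIntegrable _ _
  · exact (hc.comp (Continuous.prodMk_right x)).aestronglyMeasurable
  · refine ae_of_all _ fun θ hθ y hy => hC (y, θ) ⟨Metric.ball_subset_closedBall hy, ?_⟩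
    rw [uIoc_of_le zero_le_one] at hθ
    exact ⟨hθ.1.le, hθ.2⟩
  · exact intervalIntegrable_const
  · refine ae_of_all _ fun θ _ y _ => ?_
    have h1 := (hf.differentiable (by simp) (y, θ)).hasFDerivAt
    exact h1.comp y (hasFDerivAt_prodMk_left y θ)

theorem contDiff_integral_unitInterval {H : Type} [NormedAddCommGroup H] [NormedSpace ℝ H]
    [FiniteDimensional ℝ H] (n : ℕ) : ∀ {F : Type} [NormedAddCommGroup F] [NormedSpace ℝ F]
    {f : H × ℝ → F}, ContDiff ℝ ∞ f →
    ContDiff ℝ n (fun x => ∫ θ in (0 : ℝ)..1, f (x, θ)) := by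
  induction n with
  | zero =>
    intro F _ _ f hf
    have h1 : ContDiff ℝ 1 f := hf.of_le (by exact_mod_cast le_top)
    exact contDiff_zero.2 (continuous_iff_continuousAt.2 fun x =>
      (hasFDerivAt_integral_unitInterval h1 x).continuousAt)
  | succ n ih =>
    intro F _ _ f hf
    have h1 : ContDiff ℝ 1 f := hf.of_le (by exact_mod_cast le_top)
    have hd : fderiv ℝ (fun x => ∫ θ in (0 : ℝ)..1, f (x, θ)) = fun x =>
        ∫ θ in (0 : ℝ)..1, (fderiv ℝ f (x, θ)).comp (ContinuousLinearMap.inl ℝ H ℝ) :=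
      funext fun x => (hasFDerivAt_integral_unitInterval h1 x).fderiv
    push_cast
    refine contDiff_succ_iff_fderiv.2
      ⟨fun x => (hasFDerivAt_integral_unitInterval h1 x).differentiableAt, by simp, ?_⟩
    rw [hd]
    exact ih (f := fun p => (fderiv ℝ f p).comp (ContinuousLinearMap.inl ℝ H ℝ))
      ((hf.fderiv_right (m := ∞) (by simp)).clm_comp contDiff_const)

theorem contDiff_infty_integral_unitInterval {f : E N × ℝ → ℝ} (hf : ContDiff ℝ ∞ f) :
    ContDiff ℝ ∞ (fun x => ∫ θ in (0 : ℝ)..1, f (x, θ)) :=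
  contDiff_infty.2 fun n => contDiff_integral_unitInterval n hf

theorem contDiff_uncurry_pd {f : E N × ℝ → ℝ} (hf : ContDiff ℝ ∞ f) (i : Fin N) :
    ContDiff ℝ ∞ (fun p : E N × ℝ => pd i (fun x => f (x, p.2)) p.1) ∧
    pd i (fun x => ∫ θ in (0 : ℝ)..1, f (x, θ)) =
      fun x => ∫ θ in (0 : ℝ)..1, pd i (fun x => f (x, θ)) x := by
  have h1 : ContDiff ℝ 1 f := hf.of_le (by exact_mod_cast le_top)
  have key : ∀ x θ, pd i (fun x => f (x, θ)) x =
      (fderiv ℝ f (x, θ)).comp (ContinuousLinearMap.inl ℝ (E N) ℝ) (EuclideanSpace.single i 1) := by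
    intro x θ
    have h := ((h1.differentiable (by simp) (x, θ)).hasFDerivAt).comp x
      (hasFDerivAt_prodMk_left (𝕜 := ℝ) x θ)
    simp only [pd]
    change fderiv ℝ (f ∘ fun e => (e, θ)) x _ = _
    rw [h.fderiv]
  refine ⟨?_, ?_⟩
  · simp_rw [key]
    exact ((hf.fderiv_right (m := ∞) (by simp)).clm_comp contDiff_const).clm_apply contDiff_const
  · funext x
    simp_rw [key]
    simp only [pd]
    rw [(hasFDerivAt_integral_unitInterval h1 x).fderiv, ContinuousLinearMap.intervalIntegral_apply]
    have hc : Continuous fun p : E N × ℝ =>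
        (fderiv ℝ f p).comp (ContinuousLinearMap.inl ℝ (E N) ℝ) :=
      (h1.continuous_fderiv (by simp)).clm_comp continuous_const
    exact (hc.comp (Continuous.prodMk_right x)).intervalIntegrable _ _

theorem lap_integral_unitInterval {f : E N × ℝ → ℝ} (hf : ContDiff ℝ ∞ f) :
    lap (fun x => ∫ θ in (0 : ℝ)..1, f (x, θ)) =
      fun x => ∫ θ in (0 : ℝ)..1, lap (fun x => f (x, θ)) x := by
  have hs : ∀ θ, ContDiff ℝ ∞ fun x => f (x, θ) := fun θ =>
    hf.comp (contDiff_id.prodMk contDiff_const)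
  rw [lap_eq_sum_pd (contDiff_infty_integral_unitInterval hf)]
  simp_rw [fun θ => lap_eq_sum_pd (hs θ)]
  funext x
  have h1 := fun i => contDiff_uncurry_pd hf i
  have h2 := fun i => contDiff_uncurry_pd (h1 i).1 i
  have h3 : ∀ i ∈ (Finset.univ : Finset (Fin N)), IntervalIntegrable
      (fun θ => pd i (pd i fun x => f (x, θ)) x) volume 0 1 := fun i _ =>
    (((h2 i).1.continuous.comp (Continuous.prodMk_right x)).intervalIntegrable _ _)
  rw [intervalIntegral.integral_finsetSum h3]
  refine Finset.sum_congr rfl fun i _ => ?_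
  rw [(h1 i).2, (h2 i).2]

/-! ### Regularised powers -/

/-- A smooth regularisation `Φ` of `s ↦ s^{-N/2}` which is a multiple of that power for `s ≥ δ`,
that is, the defect `b₀ = 4 s Φ' + 2 N Φ` vanishes for `s ≥ δ`; the functions `b₁, b₂, …` are
the iterated antiderivatives of the defect (up to sign) vanishing for `s ≥ δ`. -/
structure Profile (N : ℕ) (δ : ℝ) where
  Φ : ℝ → ℝ
  b : ℕ → ℝ → ℝ
  contDiff_Φ : ContDiff ℝ ∞ Φ
  contDiff_b : ∀ k, ContDiff ℝ ∞ (b k)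
  defect : ∀ s, 4 * s * deriv Φ s + 2 * N * Φ s = b 0 s
  deriv_b : ∀ k s, deriv (b (k + 1)) s = - b k s
  b_eq_zero : ∀ k s, δ ≤ s → b k s = 0

namespace Profile

variable {δ : ℝ} (p : Profile N δ)

theorem defect_deriv (s : ℝ) :
    4 * s * deriv (deriv p.Φ) s + (2 * N + 4) * deriv p.Φ s = deriv (p.b 0) s := by
  have h : p.b 0 = fun s => 4 * s * deriv p.Φ s + 2 * N * p.Φ s := funext fun s => (p.defect s).symm
  have h1 : HasDerivAt p.Φ (deriv p.Φ s) s :=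
    (p.contDiff_Φ.differentiable (by simp) s).hasDerivAt
  have h2 : HasDerivAt (deriv p.Φ) (deriv (deriv p.Φ) s) s :=
    ((contDiff_deriv p.contDiff_Φ).differentiable (by simp) s).hasDerivAt
  have h3 := ((((hasDerivAt_id s).const_mul 4).mul h2).add (h1.const_mul (2 * (N : ℝ)))).deriv
  rw [h]
  refine Eq.trans ?_ h3.symm
  simp only [id]
  ring

theorem hasDerivAt_b (k : ℕ) (s : ℝ) : HasDerivAt (p.b (k + 1)) (- p.b k s) s := by
  rw [← p.deriv_b]
  exact ((p.contDiff_b _).differentiable (by simp) s).hasDerivAt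

theorem deriv_b_zero_eq_zero {s : ℝ} (hs : δ < s) : deriv (p.b 0) s = 0 := by
  have : p.b 0 =ᶠ[𝓝 s] fun _ => 0 := by
    filter_upwards [lt_mem_nhds hs] with t ht using p.b_eq_zero 0 t ht.le
  rw [this.deriv_eq]; simp

/-- Repeated integration by parts trades the powers of `θ P` for antiderivatives of the defect; no
boundary term appears at `θ = 1`, where all `b j` vanish. -/
theorem integral_pow_mul_b {D P : ℝ} (h : δ ≤ D + P) (k : ℕ) : ∀ j,
    ∫ θ in (0 : ℝ)..1, θ ^ k * P ^ (k + 1) * p.b j (D + θ * P) =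
      k.factorial * p.b (j + k + 1) D := by
  have hd : ∀ j θ, HasDerivAt (fun θ => p.b (j + 1) (D + θ * P)) (- p.b j (D + θ * P) * P) θ := by
    intro j θ
    have h1 : HasDerivAt (fun θ : ℝ => D + θ * P) P θ := by
      simpa using ((hasDerivAt_id θ).mul_const P).const_add D
    exact (p.hasDerivAt_b j _).comp θ h1
  have hc : ∀ j, Continuous fun θ : ℝ => p.b j (D + θ * P) := fun j =>
    (p.contDiff_b j).continuous.comp (by fun_prop)
  induction k with
  | zero =>
    intro j
    have := intervalIntegral.integral_eq_sub_of_hasDerivAt (a := 0) (b := 1)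
      (fun θ _ => (hd j θ).neg) (by
        have := hc j
        exact Continuous.intervalIntegrable (by fun_prop) _ _)
    simp only [neg_mul, neg_neg] at this
    simp only [pow_zero, one_mul, zero_add, pow_one, Nat.factorial_zero, Nat.cast_one, add_zero]
    simp_rw [mul_comm P]
    rw [this]
    simp [p.b_eq_zero _ _ h]
  | succ k ih =>
    intro j
    have h1 : ∀ θ : ℝ, HasDerivAt
        (fun θ => - (θ ^ (k + 1) * P ^ (k + 1) * p.b (j + 1) (D + θ * P)))
        (θ ^ (k + 1) * P ^ (k + 1 + 1) * p.b j (D + θ * P) -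
          (k + 1) * (θ ^ k * P ^ (k + 1) * p.b (j + 1) (D + θ * P))) θ := by
      intro θ
      refine ((((hasDerivAt_pow (k + 1) θ).mul_const (P ^ (k + 1))).mul (hd j
        θ)).neg).congr_deriv ?_
      push_cast [Nat.add_sub_cancel]
      ring
    have hj := hc j
    have hj1 := hc (j + 1)
    have hi1 : IntervalIntegrable (fun θ => θ ^ (k + 1) * P ^ (k + 1 + 1) * p.b j (D + θ * P))
        volume 0 1 := Continuous.intervalIntegrable (by fun_prop) _ _
    have hi2 : IntervalIntegrable (fun θ => ((k : ℝ) + 1) *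
        (θ ^ k * P ^ (k + 1) * p.b (j + 1) (D + θ * P)))
        volume 0 1 := Continuous.intervalIntegrable (by fun_prop) _ _
    have h2 := intervalIntegral.integral_eq_sub_of_hasDerivAt (a := 0) (b := 1)
      (fun θ _ => h1 θ) (hi1.sub hi2)
    rw [intervalIntegral.integral_sub hi1 hi2, intervalIntegral.integral_const_mul,
      ih (j + 1)] at h2
    simp only [one_mul, p.b_eq_zero _ _ h] at h2
    rw [Nat.factorial_succ, show j + (k + 1) + 1 = j + 1 + k + 1 by ring]
    push_cast
    simp at h2
    linarith

theorem integral_pow_mul_deriv_b {D P : ℝ} (h : δ ≤ D + P) (k : ℕ) :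
    ∫ θ in (0 : ℝ)..1, θ ^ k * P ^ (k + 1) * deriv (p.b 0) (D + θ * P) =
      - (k.factorial * p.b k D) := by
  have hd : ∀ θ, HasDerivAt (fun θ => p.b 0 (D + θ * P)) (deriv (p.b 0) (D + θ * P) * P) θ := by
    intro θ
    have h1 : HasDerivAt (fun θ : ℝ => D + θ * P) P θ := by
      simpa using ((hasDerivAt_id θ).mul_const P).const_add D
    exact (((p.contDiff_b 0).differentiable (by simp) _).hasDerivAt).comp θ h1
  have hc : Continuous fun θ : ℝ => p.b 0 (D + θ * P) :=
    (p.contDiff_b 0).continuous.comp (by fun_prop)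
  have hc' : Continuous fun θ : ℝ => deriv (p.b 0) (D + θ * P) :=
    (contDiff_deriv (p.contDiff_b 0)).continuous.comp (by fun_prop)
  cases k with
  | zero =>
    have := intervalIntegral.integral_eq_sub_of_hasDerivAt (a := 0) (b := 1)
      (fun θ _ => hd θ) (Continuous.intervalIntegrable (by fun_prop) _ _)
    simp only [pow_zero, one_mul, zero_add, pow_one, Nat.factorial_zero, Nat.cast_one]
    simp_rw [mul_comm P]
    rw [this]
    simp [p.b_eq_zero _ _ h]
  | succ k =>
    have h1 : ∀ θ : ℝ, HasDerivAt
        (fun θ => θ ^ (k + 1) * P ^ (k + 1) * p.b 0 (D + θ * P))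
        (θ ^ (k + 1) * P ^ (k + 1 + 1) * deriv (p.b 0) (D + θ * P) +
          (k + 1) * (θ ^ k * P ^ (k + 1) * p.b 0 (D + θ * P))) θ := by
      intro θ
      refine (((hasDerivAt_pow (k + 1) θ).mul_const (P ^ (k + 1))).mul (hd θ)).congr_deriv ?_
      push_cast [Nat.add_sub_cancel]
      ring
    have hi1 : IntervalIntegrable (fun θ => θ ^ (k + 1) * P ^ (k + 1 + 1) *
        deriv (p.b 0) (D + θ * P)) volume 0 1 := Continuous.intervalIntegrable (by fun_prop) _ _
    have hi2 : IntervalIntegrable (fun θ => ((k : ℝ) + 1) *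
        (θ ^ k * P ^ (k + 1) * p.b 0 (D + θ * P)))
        volume 0 1 := Continuous.intervalIntegrable (by fun_prop) _ _
    have h2 := intervalIntegral.integral_eq_sub_of_hasDerivAt (a := 0) (b := 1)
      (fun θ _ => h1 θ) (hi1.add hi2)
    rw [intervalIntegral.integral_add hi1 hi2, intervalIntegral.integral_const_mul,
      p.integral_pow_mul_b h k 0] at h2
    simp only [one_mul, p.b_eq_zero _ _ h] at h2
    rw [Nat.factorial_succ]
    push_cast
    simp at h2
    linarith

end Profile

/-! ### Boggio's kernel and its Laplacian -/

/-- Integrand of the regularised Boggio kernel of order `2 (k + 1)` for the ball of radius `R`,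
with pole `y`; here `κ = 1 - |y|² / R²`, and with `P = κ (R² - |x|²)` and `D = |x - y|²` the
integrand is `θ^k P^{k+1} Φ(D + θ P)`. -/
noncomputable def boggioIntegrand (Φ : ℝ → ℝ) (y : E N) (κ R : ℝ) (k : ℕ) (q : E N × ℝ) : ℝ :=
  q.2 ^ k * ((κ * (R ^ 2 - ‖q.1‖ ^ 2)) ^ (k + 1) *
    Φ (‖q.1 - y‖ ^ 2 + q.2 * (κ * (R ^ 2 - ‖q.1‖ ^ 2))))

/-- The regularised Boggio kernel: with `Φ(s) = s^{-N/2}` and `p = θ P` this is the Green function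
`∫_0^P p^k (D + p)^{-N/2} dp` of `(-Δ)^{k+1}`, up to a constant factor. -/
noncomputable def boggio (Φ : ℝ → ℝ) (y : E N) (κ R : ℝ) (k : ℕ) (x : E N) : ℝ :=
  ∫ θ in (0 : ℝ)..1, boggioIntegrand Φ y κ R k (x, θ)

section

variable {Φ : ℝ → ℝ} (y : E N) (κ R : ℝ) (k : ℕ)

theorem contDiff_boggioIntegrand (hΦ : ContDiff ℝ ∞ Φ) :
    ContDiff ℝ ∞ (boggioIntegrand Φ y κ R k) := by
  have hn : ContDiff ℝ ∞ fun q : E N × ℝ => ‖q.1‖ ^ 2 := (contDiff_norm_sq ℝ).comp contDiff_fst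
  have hd : ContDiff ℝ ∞ fun q : E N × ℝ => ‖q.1 - y‖ ^ 2 :=
    (contDiff_norm_sq ℝ).comp (contDiff_fst.sub contDiff_const)
  unfold boggioIntegrand
  exact (contDiff_snd.pow k).mul (((contDiff_const.mul (contDiff_const.sub hn)).pow _).mul
    (hΦ.comp (hd.add (contDiff_snd.mul (contDiff_const.mul (contDiff_const.sub hn))))))

theorem contDiff_boggio (hΦ : ContDiff ℝ ∞ Φ) : ContDiff ℝ ∞ (boggio Φ y κ R k) :=
  contDiff_infty_integral_unitInterval (contDiff_boggioIntegrand y κ R k hΦ)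

theorem lap_pow {q : E N → ℝ} (hq : ContDiff ℝ ∞ q) (k : ℕ) : lap (fun x => q x ^ (k + 1)) =
    fun x => (k + 1) * k * q x ^ (k - 1) * (∑ i, pd i q x * pd i q x) +
      (k + 1) * q x ^ k * lap q x := by
  have h1 : deriv (fun t : ℝ => t ^ (k + 1)) = fun t : ℝ => ((k : ℝ) + 1) * t ^ k := by
    funext t; simp
  have h2 : deriv (fun t : ℝ => ((k : ℝ) + 1) * t ^ k) =
      fun t : ℝ => ((k : ℝ) + 1) * k * t ^ (k - 1) := by
    funext t; simp; ring
  rw [lap_comp (φ := fun t => t ^ (k + 1)) (contDiff_id.pow _) hq, h1, h2]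

theorem pd_pow {q : E N → ℝ} (hq : ContDiff ℝ ∞ q) (k : ℕ) (i : Fin N) :
    pd i (fun x => q x ^ (k + 1)) = fun x => (k + 1) * q x ^ k * pd i q x := by
  rw [pd_comp (φ := fun t => t ^ (k + 1)) (contDiff_id.pow _) hq]
  funext x; simp

/-- The function of `θ` whose derivative is the exact part of the Laplacian of the integrand;
`P = κ (R² - r)` and `D = r - 2 s + (1 - κ) R²`, where `r = |x|²` and `s = ⟨x, y⟩`. -/
noncomputable def boggioFlux (N : ℕ) (Φ : ℝ → ℝ) (κ R : ℝ) (k : ℕ) (r s θ : ℝ) : ℝ :=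
  θ ^ (k + 1) * (κ * (R ^ 2 - r)) ^ k *
      deriv Φ (r - 2 * s + (1 - κ) * R ^ 2 + θ * (κ * (R ^ 2 - r))) *
      (-4 * (κ * (R ^ 2 - r)) + 8 * κ * (s - r) + θ * (4 * κ ^ 2 * r)) +
    k * (4 * θ ^ k * (κ * (R ^ 2 - r)) ^ k +
      θ ^ (k + 1) * (κ * (R ^ 2 - r)) ^ (k - 1) * (4 * κ ^ 2 * r)) *
      Φ (r - 2 * s + (1 - κ) * R ^ 2 + θ * (κ * (R ^ 2 - r))) -
    θ ^ (k + 1) * (κ * (R ^ 2 - r)) ^ k *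
      Φ (r - 2 * s + (1 - κ) * R ^ 2 + θ * (κ * (R ^ 2 - r))) * (2 * N * κ)

variable {y κ R}

theorem normSq_sub_eq (hκ : ‖y‖ ^ 2 = (1 - κ) * R ^ 2) (x : E N) :
    ‖x - y‖ ^ 2 = ‖x‖ ^ 2 - 2 * inner ℝ x y + (1 - κ) * R ^ 2 := by
  rw [norm_sub_sq_real, hκ]

/-- Up to an exact `θ`-derivative, the Laplacian of the Boggio integrand of order `k + 1` is
`-4 k²` times the integrand of order `k`, plus a term containing the derivative of the defect. -/
theorem hasDerivAt_boggioFlux {δ : ℝ} (p : Profile N δ) (hκ : ‖y‖ ^ 2 = (1 - κ) * R ^ 2) (x : E N)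
    (θ : ℝ) : HasDerivAt (boggioFlux N p.Φ κ R k (‖x‖ ^ 2) (inner ℝ x y))
      (lap (fun x => boggioIntegrand p.Φ y κ R k (x, θ)) x +
        4 * k ^ 2 * (θ ^ (k - 1) * ((κ * (R ^ 2 - ‖x‖ ^ 2)) ^ k *
          p.Φ (‖x - y‖ ^ 2 + θ * (κ * (R ^ 2 - ‖x‖ ^ 2))))) -
        θ ^ k * (κ * (R ^ 2 - ‖x‖ ^ 2)) ^ (k + 1) *
          deriv (p.b 0) (‖x - y‖ ^ 2 + θ * (κ * (R ^ 2 - ‖x‖ ^ 2)))) θ := by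
  -- the Laplacian of the integrand
  have hP := contDiff_quad (-κ) (0 : E N) (κ * R ^ 2)
  have hQ := contDiff_quad (1 - θ * κ) y (‖y‖ ^ 2 + θ * κ * R ^ 2)
  have he : (fun x => boggioIntegrand p.Φ y κ R k (x, θ)) = fun x => θ ^ k *
      (quad (-κ) (0 : E N) (κ * R ^ 2) x ^ (k + 1) *
        p.Φ (quad (1 - θ * κ) y (‖y‖ ^ 2 + θ * κ * R ^ 2) x)) := by
    funext x
    have e1 : quad (-κ) (0 : E N) (κ * R ^ 2) x = κ * (R ^ 2 - ‖x‖ ^ 2) := by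
      simp [quad]; ring
    have e2 : quad (1 - θ * κ) y (‖y‖ ^ 2 + θ * κ * R ^ 2) x =
        ‖x - y‖ ^ 2 + θ * (κ * (R ^ 2 - ‖x‖ ^ 2)) := by
      rw [norm_sub_sq_real]; simp [quad]; ring
    rw [e1, e2]; rfl
  have hΦQ : ContDiff ℝ ∞ fun x => p.Φ (quad (1 - θ * κ) y (‖y‖ ^ 2 + θ * κ * R ^ 2) x) :=
    p.contDiff_Φ.comp hQ
  rw [he, lap_const_mul ((hP.pow _).mul hΦQ), lap_mul (hP.pow _) hΦQ, lap_comp p.contDiff_Φ hQ,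
    lap_pow hP]
  simp_rw [pd_pow hP, pd_comp p.contDiff_Φ hQ]
  have hsum : ∑ i, (k + 1) * quad (-κ) (0 : E N) (κ * R ^ 2) x ^ k *
      pd i (quad (-κ) (0 : E N) (κ * R ^ 2)) x *
      (deriv p.Φ (quad (1 - θ * κ) y (‖y‖ ^ 2 + θ * κ * R ^ 2) x) *
        pd i (quad (1 - θ * κ) y (‖y‖ ^ 2 + θ * κ * R ^ 2)) x) =
      (k + 1) * quad (-κ) (0 : E N) (κ * R ^ 2) x ^ k *
        deriv p.Φ (quad (1 - θ * κ) y (‖y‖ ^ 2 + θ * κ * R ^ 2) x) *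
      ∑ i, pd i (quad (-κ) (0 : E N) (κ * R ^ 2)) x *
        pd i (quad (1 - θ * κ) y (‖y‖ ^ 2 + θ * κ * R ^ 2)) x := by
    rw [Finset.mul_sum]
    exact Finset.sum_congr rfl fun i _ => by ring
  rw [hsum, sum_pd_quad, sum_pd_quad, sum_pd_quad, lap_quad, lap_quad, ← p.defect_deriv,
    normSq_sub_eq hκ]
  simp only [inner_zero_right, inner_zero_left, real_inner_self_eq_norm_sq]
  rw [hκ]
  have e1 : quad (-κ) (0 : E N) (κ * R ^ 2) x = κ * (R ^ 2 - ‖x‖ ^ 2) := by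
    simp [quad]; ring
  have e2 : quad (1 - θ * κ) y ((1 - κ) * R ^ 2 + θ * κ * R ^ 2) x =
      ‖x‖ ^ 2 - 2 * inner ℝ x y + (1 - κ) * R ^ 2 + θ * (κ * (R ^ 2 - ‖x‖ ^ 2)) := by
    simp [quad]; ring
  rw [e1, e2]
  generalize ‖x‖ ^ 2 = r
  generalize inner ℝ x y = s
  -- the derivative of the flux
  have hq : HasDerivAt (fun θ : ℝ => r - 2 * s + (1 - κ) * R ^ 2 + θ * (κ * (R ^ 2 - r)))
      (κ * (R ^ 2 - r)) θ := by
    simpa using ((hasDerivAt_id θ).mul_const (κ * (R ^ 2 - r))).const_add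
      (r - 2 * s + (1 - κ) * R ^ 2)
  have d1 := (p.contDiff_Φ.differentiable (by simp)
    (r - 2 * s + (1 - κ) * R ^ 2 + θ * (κ * (R ^ 2 - r)))).hasDerivAt.comp θ hq
  have d2 := ((contDiff_deriv p.contDiff_Φ).differentiable (by simp)
    (r - 2 * s + (1 - κ) * R ^ 2 + θ * (κ * (R ^ 2 - r)))).hasDerivAt.comp θ hq
  have t1 := (((hasDerivAt_pow (k + 1) θ).mul_const ((κ * (R ^ 2 - r)) ^ k)).mul d2).mul
    (((hasDerivAt_id θ).mul_const (4 * κ ^ 2 * r)).const_add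
      (-4 * (κ * (R ^ 2 - r)) + 8 * κ * (s - r)))
  have t2 := ((((((hasDerivAt_pow k θ).const_mul 4).mul_const ((κ * (R ^ 2 - r)) ^ k)).add
    (((hasDerivAt_pow (k + 1) θ).mul_const ((κ * (R ^ 2 - r)) ^ (k - 1))).mul_const
      (4 * κ ^ 2 * r))).const_mul (k : ℝ)).mul d1)
  have t3 := ((((hasDerivAt_pow (k + 1) θ).mul_const ((κ * (R ^ 2 - r)) ^ k)).mul d1).mul_const
    (2 * (N : ℝ) * κ))
  refine ((t1.add t2).sub t3).congr_deriv ?_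
  simp only [Function.comp, id, Nat.add_sub_cancel, Pi.add_apply, Pi.mul_apply]
  set q := r - 2 * s + (1 - κ) * R ^ 2 + θ * (κ * (R ^ 2 - r)) with hqdef
  clear_value q
  generalize deriv (deriv p.Φ) q = f2
  generalize deriv p.Φ q = f1
  generalize p.Φ q = f0
  rcases k with _ | j
  · subst hqdef
    simp
    ring
  · subst hqdef
    simp only [Nat.add_sub_cancel]
    push_cast
    ring

end

/-! ### The polyharmonic Laplacian of the truncated Green function -/

section

variable {δ : ℝ} (p : Profile N δ) {y : E N} {κ R : ℝ}

/-- The Laplacian of the regularised Boggio kernel: the flux at `θ = 1`, the kernel of lower order,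
and a term supported near the pole. The flux at `θ = 1` simplifies
because `Φ` is a power there. -/
theorem lap_boggio (hκ : ‖y‖ ^ 2 = (1 - κ) * R ^ 2) (k : ℕ) {x : E N}
    (hx : δ ≤ quad (1 - κ) y (R ^ 2) x) :
    lap (boggio p.Φ y κ R k) x =
      4 * k * κ * ((κ * (R ^ 2 - ‖x‖ ^ 2)) ^ (k - 1) * ((R ^ 2 - (1 - κ) * ‖x‖ ^ 2) *
        p.Φ (quad (1 - κ) y (R ^ 2) x))) -
      4 * k ^ 2 * (∫ θ in (0 : ℝ)..1, θ ^ (k - 1) * ((κ * (R ^ 2 - ‖x‖ ^ 2)) ^ k *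
          p.Φ (‖x - y‖ ^ 2 + θ * (κ * (R ^ 2 - ‖x‖ ^ 2))))) -
      k.factorial * p.b k (‖x - y‖ ^ 2) := by
  have hf := contDiff_boggioIntegrand y κ R k p.contDiff_Φ
  have hS : ‖x - y‖ ^ 2 + κ * (R ^ 2 - ‖x‖ ^ 2) = quad (1 - κ) y (R ^ 2) x := by
    rw [normSq_sub_eq hκ]; simp [quad]; ring
  have hlap : Continuous fun θ : ℝ => lap (fun x => boggioIntegrand p.Φ y κ R k (x, θ)) x := by
    have hs : ∀ θ, ContDiff ℝ ∞ fun x => boggioIntegrand p.Φ y κ R k (x, θ) := fun θ =>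
      hf.comp (contDiff_id.prodMk contDiff_const)
    simp_rw [fun θ => lap_eq_sum_pd (hs θ)]
    exact continuous_finsetSum _ fun i _ =>
      (contDiff_uncurry_pd (contDiff_uncurry_pd hf i).1 i).1.continuous.comp
        (Continuous.prodMk_right x)
  have hΦ : Continuous p.Φ := p.contDiff_Φ.continuous
  have hb : Continuous (deriv (p.b 0)) := (contDiff_deriv (p.contDiff_b 0)).continuous
  have i1 : IntervalIntegrable (fun θ : ℝ => lap (fun x => boggioIntegrand p.Φ y κ R k (x, θ)) x)
      volume 0 1 := hlap.intervalIntegrable _ _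
  have i2 : IntervalIntegrable (fun θ : ℝ => 4 * (k : ℝ) ^ 2 * (θ ^ (k - 1) *
      ((κ * (R ^ 2 - ‖x‖ ^ 2)) ^ k * p.Φ (‖x - y‖ ^ 2 + θ * (κ * (R ^ 2 - ‖x‖ ^ 2))))))
      volume 0 1 := Continuous.intervalIntegrable (by fun_prop) _ _
  have i3 : IntervalIntegrable (fun θ : ℝ => θ ^ k * (κ * (R ^ 2 - ‖x‖ ^ 2)) ^ (k + 1) *
      deriv (p.b 0) (‖x - y‖ ^ 2 + θ * (κ * (R ^ 2 - ‖x‖ ^ 2))))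
      volume 0 1 := Continuous.intervalIntegrable (by fun_prop) _ _
  have key := intervalIntegral.integral_eq_sub_of_hasDerivAt
    (fun θ _ => hasDerivAt_boggioFlux k p hκ x θ) ((i1.add i2).sub i3)
  rw [intervalIntegral.integral_sub (i1.add i2) i3, intervalIntegral.integral_add i1 i2,
    intervalIntegral.integral_const_mul, p.integral_pow_mul_deriv_b (hS ▸ hx)] at key
  have h0 : boggioFlux N p.Φ κ R k (‖x‖ ^ 2) (inner ℝ x y) 0 = 0 := by
    rcases k with _ | k <;> simp [boggioFlux]
  have h1 : boggioFlux N p.Φ κ R k (‖x‖ ^ 2) (inner ℝ x y) 1 =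
      4 * k * κ * ((κ * (R ^ 2 - ‖x‖ ^ 2)) ^ (k - 1) * ((R ^ 2 - (1 - κ) * ‖x‖ ^ 2) *
        p.Φ (quad (1 - κ) y (R ^ 2) x))) := by
    have hd := p.defect (quad (1 - κ) y (R ^ 2) x)
    rw [p.b_eq_zero 0 _ hx] at hd
    unfold boggioFlux
    rw [one_mul, ← normSq_sub_eq hκ, hS]
    have e : quad (1 - κ) y (R ^ 2) x = (1 - κ) * ‖x‖ ^ 2 - 2 * inner ℝ x y + R ^ 2 := rfl
    have hd' : deriv p.Φ (quad (1 - κ) y (R ^ 2) x) *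
        (-4 * (κ * (R ^ 2 - ‖x‖ ^ 2)) + 8 * κ * (inner ℝ x y - ‖x‖ ^ 2) + 4 * κ ^ 2 * ‖x‖ ^ 2) =
        2 * N * κ * p.Φ (quad (1 - κ) y (R ^ 2) x) := by
      rw [e] at hd ⊢
      linear_combination (-κ) * hd
    rcases k with _ | k
    · simp only [one_pow, pow_zero, CharP.cast_eq_zero]
      linear_combination hd'
    · simp only [one_pow, Nat.add_sub_cancel]
      push_cast
      linear_combination (κ * (R ^ 2 - ‖x‖ ^ 2)) ^ (k + 1) * hd'
  rw [h0, h1, sub_zero] at key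
  unfold boggio
  rw [lap_integral_unitInterval hf]
  linarith

/-- The function `(R² - μ |x|²) Φ(S)` with `S = μ |x|² - 2 ⟨x, y⟩ + R²`, `|y|² = μ R²`, is harmonic
where `Φ` is a power: up to a factor this is the Poisson kernel of the ball of radius
`R² / |y|` centred at `0`, with pole at the image of `y` under inversion. -/
theorem lap_poisson_eq_zero (hκ : ‖y‖ ^ 2 = (1 - κ) * R ^ 2) {x : E N}
    (hx : δ < quad (1 - κ) y (R ^ 2) x) :
    lap (fun x => quad (-(1 - κ)) 0 (R ^ 2) x * p.Φ (quad (1 - κ) y (R ^ 2) x)) x = 0 := by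
  have hA := contDiff_quad (-(1 - κ)) (0 : E N) (R ^ 2)
  have hS := contDiff_quad (1 - κ) y (R ^ 2)
  have hΦS : ContDiff ℝ ∞ fun x => p.Φ (quad (1 - κ) y (R ^ 2) x) := p.contDiff_Φ.comp hS
  rw [lap_mul hA hΦS, lap_comp p.contDiff_Φ hS, lap_quad, lap_quad]
  simp_rw [pd_comp p.contDiff_Φ hS]
  have hsum : ∑ i, pd i (quad (-(1 - κ)) (0 : E N) (R ^ 2)) x *
      (deriv p.Φ (quad (1 - κ) y (R ^ 2) x) * pd i (quad (1 - κ) y (R ^ 2)) x) =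
      deriv p.Φ (quad (1 - κ) y (R ^ 2) x) * ∑ i, pd i (quad (-(1 - κ)) (0 : E N) (R ^ 2)) x *
      pd i (quad (1 - κ) y (R ^ 2)) x := by
    rw [Finset.mul_sum]
    exact Finset.sum_congr rfl fun i _ => by ring
  simp only [hsum, sum_pd_quad, inner_zero_right, inner_zero_left, real_inner_self_eq_norm_sq]
  have h1 := p.defect (quad (1 - κ) y (R ^ 2) x)
  have h2 := p.defect_deriv (quad (1 - κ) y (R ^ 2) x)
  rw [p.b_eq_zero 0 _ hx.le] at h1
  rw [p.deriv_b_zero_eq_zero hx] at h2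
  have e1 : quad (1 - κ) y (R ^ 2) x = (1 - κ) * ‖x‖ ^ 2 - 2 * inner ℝ x y + R ^ 2 := rfl
  have e2 : quad (-(1 - κ)) (0 : E N) (R ^ 2) x = R ^ 2 - (1 - κ) * ‖x‖ ^ 2 := by
    simp [quad]; ring
  rw [e2, hκ]
  rw [e1] at h1 h2 ⊢
  linear_combination (1 - κ) * (R ^ 2 - (1 - κ) * ‖x‖ ^ 2) * h2 - (1 - κ) * h1

/-- For `x` and `y` in the ball, `|x - y|² + P ≥ (R - |y|)²`, so that a profile with small `δ` is a
power at the end point `θ = 1` of the Boggio integral. -/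
theorem sq_sub_norm_le_quad (hR : 0 < R) (hκ : ‖y‖ ^ 2 = (1 - κ) * R ^ 2) (hy : ‖y‖ ≤ R) {x : E N}
    (hx : ‖x‖ ≤ R) : (R - ‖y‖) ^ 2 ≤ quad (1 - κ) y (R ^ 2) x := by
  have h1 : inner ℝ x y ≤ ‖x‖ * ‖y‖ := real_inner_le_norm x y
  have e : (1 - κ) = (‖y‖ / R) ^ 2 := by
    rw [div_pow, hκ]; field_simp
  have h2 : ‖y‖ / R * ‖x‖ ≤ ‖y‖ := by
    rw [div_mul_eq_mul_div, div_le_iff₀ hR]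
    exact mul_le_mul_of_nonneg_left hx (norm_nonneg _)
  have h3 : (R - ‖y‖) ^ 2 ≤ (R - ‖y‖ / R * ‖x‖) ^ 2 :=
    pow_le_pow_left₀ (by linarith) (by linarith) 2
  have h4 : (R - ‖y‖ / R * ‖x‖) ^ 2 = (‖y‖ / R) ^ 2 * ‖x‖ ^ 2 - 2 * (‖x‖ * ‖y‖) + R ^ 2 := by
    field_simp; ring
  rw [h4] at h3
  unfold quad
  rw [e]
  linarith

/-- The image of the regularised Boggio kernel under `(-Δ)^{k+1}`, as a function of `x - y`. -/
noncomputable def Profile.kernel : ℕ → E N → ℝ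
  | 0 => fun z => p.b 0 (‖z‖ ^ 2)
  | k + 1 => fun z => 4 * (k + 1) ^ 2 * Profile.kernel k z +
      (-1) ^ (k + 1) * (k + 1).factorial *
        iterLaplacian (k + 1) (fun z : E N => p.b (k + 1) (‖z‖ ^ 2)) z

theorem Profile.contDiff_radial (k : ℕ) : ContDiff ℝ ∞ fun z : E N => p.b k (‖z‖ ^ 2) :=
  (p.contDiff_b k).comp (contDiff_norm_sq ℝ)

theorem iterLaplacian_comp_sub {f : E N → ℝ} (hf : ContDiff ℝ ∞ f) (y : E N) (k : ℕ) (x : E N) :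
    iterLaplacian k (fun x => f (x - y)) x = iterLaplacian k f (x - y) := by
  have := congrFun (iterLaplacian_comp_smul_sub hf 1 y k) x
  simpa using this

/-- The regularised Boggio kernel is an approximate fundamental solution of `(-Δ)^{k+1}` in the
ball. The remainder of each step is `(R² - |x|²)^{k-1}` times a harmonic function, hence is
annihilated by `Δ^k`. -/
theorem iterLaplacian_boggio (hR : 0 < R) (hκ : ‖y‖ ^ 2 = (1 - κ) * R ^ 2) (hy : ‖y‖ ≤ R)
    (hδ : δ < (R - ‖y‖) ^ 2) (k : ℕ) : ∀ x ∈ Metric.ball (0 : E N) R,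
    (-1) ^ (k + 1) * iterLaplacian (k + 1) (boggio p.Φ y κ R k) x = p.kernel k (x - y) := by
  have hq : ∀ x ∈ Metric.ball (0 : E N) R, δ < quad (1 - κ) y (R ^ 2) x := fun x hx =>
    hδ.trans_le (sq_sub_norm_le_quad hR hκ hy (mem_ball_zero_iff.1 hx).le)
  induction k with
  | zero =>
    intro x hx
    rw [iterLaplacian_succ', iterLaplacian_zero, lap_boggio p hκ 0 (hq x hx).le]
    simp [Profile.kernel]
  | succ k ih =>
    intro x hx
    set H : E N → ℝ := fun x => quad (-(1 - κ)) 0 (R ^ 2) x * p.Φ (quad (1 - κ) y (R ^ 2) x)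
    have hH : ContDiff ℝ ∞ H := (contDiff_quad _ _ _).mul (p.contDiff_Φ.comp (contDiff_quad _ _ _))
    have hW := contDiff_boggio y κ R k p.contDiff_Φ
    have hn : ContDiff ℝ ∞ fun x : E N => ‖x‖ ^ 2 := contDiff_norm_sq ℝ
    have hPH : ContDiff ℝ ∞ fun x => (κ * R ^ 2 + (-κ) * ‖x‖ ^ 2) ^ k * H x :=
      ((contDiff_const.add (contDiff_const.mul hn)).pow k).mul hH
    have hb : ContDiff ℝ ∞ fun x : E N => p.b (k + 1) (‖x - y‖ ^ 2) :=
      (p.contDiff_radial (k + 1)).comp (contDiff_id.sub contDiff_const)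
    have h1 : EqOn (lap (boggio p.Φ y κ R (k + 1))) (fun x =>
        (-(4 * (k + 1) ^ 2) * boggio p.Φ y κ R k x +
        4 * (k + 1) * κ * ((κ * R ^ 2 + (-κ) * ‖x‖ ^ 2) ^ k * H x)) +
        (-(k + 1).factorial) * p.b (k + 1) (‖x - y‖ ^ 2)) (Metric.ball 0 R) := by
      intro x hx
      rw [lap_boggio p hκ (k + 1) (hq x hx).le]
      simp only [Nat.add_sub_cancel, boggio, boggioIntegrand, H]
      have : quad (-(1 - κ)) (0 : E N) (R ^ 2) x = R ^ 2 - (1 - κ) * ‖x‖ ^ 2 := by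
        simp [quad]; ring
      rw [this]
      push_cast
      ring
    have h2 : iterLaplacian (k + 1) (fun x => (κ * R ^ 2 + (-κ) * ‖x‖ ^ 2) ^ k * H x) x = 0 :=
      iterLaplacian_pow_mul_eq_zero hH Metric.isOpen_ball
        (fun x hx => lap_poisson_eq_zero p hκ (hq x hx)) _ _ k x hx
    rw [iterLaplacian_succ, iterLaplacian_congr_on Metric.isOpen_ball h1 (k + 1) hx,
      iterLaplacian_add_fun ((contDiff_const.mul hW).add (contDiff_const.mul hPH))
        (contDiff_const.mul hb), iterLaplacian_add_fun (contDiff_const.mul hW)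
        (contDiff_const.mul hPH), iterLaplacian_const_mul hW, iterLaplacian_const_mul hPH,
      iterLaplacian_const_mul hb]
    simp only [Profile.kernel]
    rw [h2, iterLaplacian_comp_sub (p.contDiff_radial (k + 1))]
    rw [← ih x hx]
    ring

theorem Profile.contDiff_kernel (k : ℕ) : ContDiff ℝ ∞ (p.kernel k) := by
  induction k with
  | zero => exact p.contDiff_radial 0
  | succ k ih =>
    exact (contDiff_const.mul ih).add (contDiff_const.mul
      (contDiff_iterLaplacian (p.contDiff_radial (k + 1)) (k + 1)))

theorem Profile.isTestFunction_radial (hδ : 0 ≤ δ) (k : ℕ) :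
    IsTestFunction (Metric.closedBall (0 : E N) (√δ)) (fun z : E N => p.b k (‖z‖ ^ 2)) := by
  have h : tsupport (fun z : E N => p.b k (‖z‖ ^ 2)) ⊆ Metric.closedBall 0 (√δ) := by
    refine closure_minimal (fun z hz => ?_) Metric.isClosed_closedBall
    by_contra hz'
    refine hz (p.b_eq_zero k _ ?_)
    have h1 : √δ < ‖z‖ := by simpa using hz'
    calc δ = √δ ^ 2 := (Real.sq_sqrt hδ).symm
      _ ≤ ‖z‖ ^ 2 := pow_le_pow_left₀ (Real.sqrt_nonneg _) h1.le 2
  exact ⟨p.contDiff_radial k, (isCompact_closedBall _ _).of_isClosed_subset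
    (isClosed_tsupport _) h, h⟩

theorem Profile.isTestFunction_kernel (hδ : 0 ≤ δ) (k : ℕ) :
    IsTestFunction (Metric.closedBall (0 : E N) (√δ)) (p.kernel k) := by
  induction k with
  | zero => exact p.isTestFunction_radial hδ 0
  | succ k ih =>
    exact (ih.const_mul _).add (((p.isTestFunction_radial hδ (k + 1)).iterLaplacian _).const_mul _)

theorem IsTestFunction.integral_lap_eq_zero {Ω : Set (E N)} {φ : E N → ℝ}
    (h : IsTestFunction Ω φ) : ∫ x, PolyBlowup.lap φ x = 0 := by
  have := h.integral_mul_lap (f := fun _ => 1) contDiff_const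
  simpa [PolyBlowup.lap, InnerProductSpace.laplacian_const] using this.symm

/-- Only the lowest order term contributes to the mass of the kernel. -/
theorem Profile.integral_kernel_pos (hδ : 0 ≤ δ) (h : 0 < ∫ z : E N, p.b 0 (‖z‖ ^ 2)) (k : ℕ) :
    0 < ∫ z, p.kernel k z := by
  induction k with
  | zero => exact h
  | succ k ih =>
    have hr := p.isTestFunction_radial hδ (k + 1)
    simp only [Profile.kernel]
    rw [integral_add ((p.isTestFunction_kernel hδ k).const_mul _).integrable
      ((hr.iterLaplacian _).const_mul _).integrable, integral_const_mul, integral_const_mul,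
      iterLaplacian_succ', (hr.iterLaplacian k).integral_lap_eq_zero, mul_zero, add_zero]
    positivity

/-- The profile rescaled by `ε` in the variable `√s`; the factor `ε^{-N}` keeps the power
`s^{-N/2}` unchanged. -/
noncomputable def Profile.scale {ε : ℝ} (hε : 0 < ε) : Profile N (ε ^ 2 * δ) where
  Φ s := (ε ^ N)⁻¹ * p.Φ (s / ε ^ 2)
  b k s := (ε ^ N)⁻¹ * (ε ^ (2 * k) * p.b k (s / ε ^ 2))
  contDiff_Φ := contDiff_const.mul (p.contDiff_Φ.comp (contDiff_id.div_const _))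
  contDiff_b k := contDiff_const.mul (contDiff_const.mul
    ((p.contDiff_b k).comp (contDiff_id.div_const _)))
  defect s := by
    have h1 : HasDerivAt (fun s => (ε ^ N)⁻¹ * p.Φ (s / ε ^ 2))
        ((ε ^ N)⁻¹ * (deriv p.Φ (s / ε ^ 2) * (1 / ε ^ 2))) s :=
      (((p.contDiff_Φ.differentiable (by simp) _).hasDerivAt).comp s
        ((hasDerivAt_id s).div_const (ε ^ 2))).const_mul _
    rw [h1.deriv, ← p.defect, mul_zero, pow_zero]
    field_simp
  deriv_b k s := by
    have h1 : HasDerivAt (fun s => (ε ^ N)⁻¹ * (ε ^ (2 * (k + 1)) * p.b (k + 1) (s / ε ^ 2)))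
        ((ε ^ N)⁻¹ * (ε ^ (2 * (k + 1)) * (-p.b k (s / ε ^ 2) * (1 / ε ^ 2)))) s :=
      (((p.hasDerivAt_b k _).comp s
        ((hasDerivAt_id s).div_const (ε ^ 2))).const_mul _).const_mul _
    rw [h1.deriv]
    field_simp
    ring
  b_eq_zero k s hs := by
    rw [p.b_eq_zero k]
    · simp
    · rw [le_div_iff₀ (by positivity)]; linarith

theorem Profile.kernel_scale {ε : ℝ} (hε : 0 < ε) (k : ℕ) (z : E N) :
    (p.scale hε).kernel k z = (ε ^ N)⁻¹ * p.kernel k (ε⁻¹ • z) := by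
  have hnorm : ∀ z : E N, ‖ε⁻¹ • z‖ ^ 2 = ‖z‖ ^ 2 / ε ^ 2 := by
    intro z
    rw [norm_smul, mul_pow, norm_inv, inv_pow, Real.norm_eq_abs, sq_abs]
    field_simp
  induction k with
  | zero => simp [Profile.kernel, Profile.scale, hnorm]
  | succ k ih =>
    simp only [Profile.kernel]
    rw [ih]
    have h1 : (fun z : E N => (p.scale hε).b (k + 1) (‖z‖ ^ 2)) = fun z =>
        ((ε ^ N)⁻¹ * ε ^ (2 * (k + 1))) *
          (fun z : E N => p.b (k + 1) (‖z‖ ^ 2)) (ε⁻¹ • (z - 0)) := by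
      funext z
      simp only [Profile.scale, sub_zero, hnorm]
      ring
    have hc : ContDiff ℝ ∞ fun z : E N =>
        (fun z : E N => p.b (k + 1) (‖z‖ ^ 2)) (ε⁻¹ • (z - 0)) :=
      (p.contDiff_radial (k + 1)).comp (by fun_prop)
    rw [h1, iterLaplacian_const_mul hc,
      iterLaplacian_comp_smul_sub (p.contDiff_radial (k + 1))]
    simp only [sub_zero]
    have : ε ^ (2 * (k + 1)) * ε⁻¹ ^ (2 * (k + 1)) = 1 := by
      rw [← mul_pow, mul_inv_cancel₀ hε.ne', one_pow]
    linear_combination ((-1) ^ (k + 1) * ((k + 1).factorial : ℝ) * (ε ^ N)⁻¹ *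
      iterLaplacian (k + 1) (fun z : E N => p.b (k + 1) (‖z‖ ^ 2)) (ε⁻¹ • z)) * this

end

/-! ### The standard profile -/

/-- A smooth step from `0` (for `s ≤ 1/2`) to `1` (for `s ≥ 1`). -/
noncomputable def step (s : ℝ) : ℝ := Real.smoothTransition (2 * s - 1)

theorem contDiff_step : ContDiff ℝ ∞ step :=
  Real.smoothTransition.contDiff.comp (by fun_prop)

theorem step_mono : Monotone step := fun _ _ h =>
  Real.smoothTransition.monotone (by linarith)

theorem step_nonneg (s : ℝ) : 0 ≤ step s := Real.smoothTransition.nonneg _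

theorem step_le_one (s : ℝ) : step s ≤ 1 := Real.smoothTransition.le_one _

theorem step_eq_zero {s : ℝ} (h : s ≤ 1 / 2) : step s = 0 :=
  Real.smoothTransition.zero_of_nonpos (by linarith)

theorem step_eq_one {s : ℝ} (h : 1 ≤ s) : step s = 1 :=
  Real.smoothTransition.one_of_one_le (by linarith)

theorem deriv_step_eq_zero {s : ℝ} (h : 1 ≤ s) : deriv step s = 0 := by
  have : IsLocalMax step s := Eventually.of_forall fun t => by
    simpa [step_eq_one h] using step_le_one t
  exact this.deriv_eq_zero

/-- The power `s^{-N/2}`, cut off for `s ≤ 1/2`. -/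
noncomputable def stdΦ (N : ℕ) (s : ℝ) : ℝ := s ^ (-(N / 2 : ℝ)) * step s

theorem contDiff_stdΦ : ContDiff ℝ ∞ (stdΦ N) := by
  refine contDiff_iff_contDiffAt.2 fun s => ?_
  rcases lt_or_ge s (1 / 2) with h | h
  · have : stdΦ N =ᶠ[𝓝 s] fun _ => 0 := by
      filter_upwards [gt_mem_nhds h] with t ht
      simp [stdΦ, step_eq_zero (le_of_lt ht)]
    exact contDiffAt_const.congr_of_eventuallyEq this
  · exact (Real.contDiffAt_rpow_const_of_ne (by linarith)).mul contDiff_step.contDiffAt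

theorem stdΦ_nonneg (s : ℝ) : 0 ≤ stdΦ N s := by
  rcases le_or_gt s (1 / 2) with h | h
  · simp [stdΦ, step_eq_zero h]
  · exact mul_nonneg (Real.rpow_nonneg (by linarith) _) (step_nonneg s)

theorem stdΦ_defect (s : ℝ) : 4 * s * deriv (stdΦ N) s + 2 * N * stdΦ N s =
    if s ≤ 0 then 0 else 4 * (s * s ^ (-(N / 2 : ℝ))) * deriv step s := by
  split_ifs with h
  · have : stdΦ N =ᶠ[𝓝 s] fun _ => 0 := by
      filter_upwards [gt_mem_nhds (show s < 1 / 2 by linarith)] with t ht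
      simp [stdΦ, step_eq_zero (le_of_lt ht)]
    rw [this.deriv_eq, this.eq_of_nhds]; simp
  · have hs : 0 < s := not_le.1 h
    have h1 := (Real.hasDerivAt_rpow_const (p := -(N / 2 : ℝ)) (Or.inl hs.ne')).mul
      (contDiff_step.differentiable (by simp) s).hasDerivAt
    have h2 : deriv (stdΦ N) s = _ := h1.deriv
    rw [h2, Real.rpow_sub_one hs.ne']
    unfold stdΦ
    field_simp
    ring

/-- The functions obtained from `b` by iterating the integration `s ↦ ∫_s^1`. -/
noncomputable def antiderivs (b : ℝ → ℝ) : ℕ → ℝ → ℝ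
  | 0 => b
  | k + 1 => fun s => ∫ t in s..1, antiderivs b k t

theorem contDiff_antiderivs {b : ℝ → ℝ} (hb : ContDiff ℝ ∞ b) (k : ℕ) :
    ContDiff ℝ ∞ (antiderivs b k) ∧
      ∀ s, HasDerivAt (antiderivs b (k + 1)) (-antiderivs b k s) s := by
  have key : ∀ k, ContDiff ℝ ∞ (antiderivs b k) → ∀ s,
      HasDerivAt (antiderivs b (k + 1)) (-antiderivs b k s) s := by
    intro k hk s
    exact intervalIntegral.integral_hasDerivAt_left (hk.continuous.intervalIntegrable _ _)
      (hk.continuous.stronglyMeasurableAtFilter _ _) hk.continuous.continuousAt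
  induction k with
  | zero => exact ⟨hb, key 0 hb⟩
  | succ k ih =>
    have h : ContDiff ℝ ∞ (antiderivs b (k + 1)) := by
      refine contDiff_infty_iff_deriv.2 ⟨fun s => (ih.2 s).differentiableAt, ?_⟩
      rw [show deriv (antiderivs b (k + 1)) = fun s => -antiderivs b k s from
        funext fun s => (ih.2 s).deriv]
      exact ih.1.neg
    exact ⟨h, key _ h⟩

theorem antiderivs_eq_zero {b : ℝ → ℝ} (hb : ∀ s, 1 ≤ s → b s = 0) (k : ℕ) :
    ∀ s, 1 ≤ s → antiderivs b k s = 0 := by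
  induction k with
  | zero => exact hb
  | succ k ih =>
    intro s hs
    refine intervalIntegral.integral_zero_ae (ae_of_all _ fun t ht => ih t ?_)
    rw [uIoc_of_ge hs] at ht
    exact ht.1.le

/-- The profile built from the power `s^{-N/2}` cut off near `0`. -/
noncomputable def stdProfile (N : ℕ) : Profile N 1 where
  Φ := stdΦ N
  b := antiderivs fun s => 4 * s * deriv (stdΦ N) s + 2 * N * stdΦ N s
  contDiff_Φ := contDiff_stdΦ
  contDiff_b k := (contDiff_antiderivs (((contDiff_const.mul contDiff_id).mul
    (contDiff_deriv contDiff_stdΦ)).add (contDiff_const.mul contDiff_stdΦ)) k).1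
  defect _ := rfl
  deriv_b k s := ((contDiff_antiderivs (((contDiff_const.mul contDiff_id).mul
    (contDiff_deriv contDiff_stdΦ)).add (contDiff_const.mul contDiff_stdΦ)) k).2 s).deriv
  b_eq_zero k s hs := antiderivs_eq_zero (fun s hs => by
    rw [stdΦ_defect, deriv_step_eq_zero hs]; simp) k s hs

theorem stdProfile_b_zero_nonneg (s : ℝ) : 0 ≤ (stdProfile N).b 0 s := by
  rw [← (stdProfile N).defect]
  refine le_of_le_of_eq ?_ (stdΦ_defect s).symm
  split_ifs with h
  · exact le_rfl
  · have hs : 0 < s := not_le.1 h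
    have := step_mono.deriv_nonneg (x := s)
    positivity

theorem stdProfile_integral_pos (hN : 1 ≤ N) :
    0 < ∫ z : E N, (stdProfile N).b 0 (‖z‖ ^ 2) := by
  obtain ⟨c, hc, hd⟩ := exists_deriv_eq_slope step (show (1 / 2 : ℝ) < 1 by norm_num)
    contDiff_step.continuous.continuousOn (contDiff_step.differentiable (by simp)).differentiableOn
  rw [step_eq_one le_rfl, step_eq_zero le_rfl] at hd
  have hc0 : 0 < c := by linarith [hc.1]
  have hcont := ((stdProfile N).contDiff_radial 0).continuous
  refine hcont.integral_pos_of_hasCompactSupport_nonneg_nonzero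
    ((stdProfile N).isTestFunction_radial zero_le_one 0).2.1
    (fun z => stdProfile_b_zero_nonneg _) (x := EuclideanSpace.single ⟨0, hN⟩ (√c)) ?_
  rw [PiLp.norm_single, Real.norm_eq_abs, sq_abs, Real.sq_sqrt hc0.le,
    ← (stdProfile N).defect]
  refine ne_of_eq_of_ne (stdΦ_defect c) ?_
  rw [if_neg (not_le.2 hc0), hd]
  have := Real.rpow_pos_of_pos hc0 (-(N / 2 : ℝ))
  have : 0 < 4 * (c * c ^ (-(N / 2 : ℝ))) * ((1 - 0) / (1 - 1 / 2)) := by positivity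
  exact this.ne'

/-- Rescaling the standard profile only moves the cut-off. -/
theorem stdProfile_scale_Φ {ε s : ℝ} (hε : 0 < ε) (hs : 0 ≤ s) :
    ((stdProfile N).scale hε).Φ s = s ^ (-(N / 2 : ℝ)) * step (s / ε ^ 2) := by
  have h1 : (ε ^ 2) ^ (-(N / 2 : ℝ)) = (ε ^ N)⁻¹ := by
    rw [← Real.rpow_natCast ε 2, ← Real.rpow_mul hε.le, ← Real.rpow_natCast ε N,
      ← Real.rpow_neg hε.le]
    congr 1; push_cast; ring
  change (ε ^ N)⁻¹ * stdΦ N (s / ε ^ 2) = _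
  unfold stdΦ
  rw [Real.div_rpow hs (by positivity), h1]
  field_simp

theorem stdProfile_scale_Φ_nonneg {ε : ℝ} (hε : 0 < ε) (s : ℝ) :
    0 ≤ ((stdProfile N).scale hε).Φ s :=
  mul_nonneg (by positivity) (stdΦ_nonneg _)

theorem stdProfile_scale_Φ_anti {ε ε' s : ℝ} (hε : 0 < ε) (h : ε ≤ ε') (hs : 0 ≤ s) :
    ((stdProfile N).scale (hε.trans_le h)).Φ s ≤ ((stdProfile N).scale hε).Φ s := by
  rw [stdProfile_scale_Φ _ hs, stdProfile_scale_Φ _ hs]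
  refine mul_le_mul_of_nonneg_left (step_mono ?_) (Real.rpow_nonneg hs _)
  exact div_le_div_of_nonneg_left hs (by positivity) (pow_le_pow_left₀ hε.le h 2)

theorem stdProfile_scale_Φ_pos {ε s : ℝ} (hε : 0 < ε) (h : ε ^ 2 ≤ s) :
    0 < ((stdProfile N).scale hε).Φ s := by
  have hs : 0 < s := (by positivity : 0 < ε ^ 2).trans_le h
  rw [stdProfile_scale_Φ _ hs.le, step_eq_one ((one_le_div (by positivity)).2 h), mul_one]
  exact Real.rpow_pos_of_pos hs _

/-! ### Sign and boundary behaviour of Boggio's kernel -/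

theorem boggio_nonneg {Φ : ℝ → ℝ} (hΦ : ∀ s, 0 ≤ Φ s) {y : E N} {κ R : ℝ} (hκ : 0 ≤ κ) (k : ℕ)
    {x : E N} (hx : ‖x‖ ≤ R) : 0 ≤ boggio Φ y κ R k x := by
  refine intervalIntegral.integral_nonneg zero_le_one fun θ hθ => ?_
  have : 0 ≤ R ^ 2 - ‖x‖ ^ 2 := sub_nonneg.2 (pow_le_pow_left₀ (norm_nonneg _) hx 2)
  exact mul_nonneg (pow_nonneg hθ.1 _) (mul_nonneg (pow_nonneg (mul_nonneg hκ this) _) (hΦ _))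

theorem boggio_mono {Φ Ψ : ℝ → ℝ} (hΦ : Continuous Φ) (hΨ : Continuous Ψ)
    (h : ∀ s, 0 ≤ s → Φ s ≤ Ψ s) {y : E N} {κ R : ℝ} (hκ : 0 ≤ κ) (k : ℕ)
    {x : E N} (hx : ‖x‖ ≤ R) : boggio Φ y κ R k x ≤ boggio Ψ y κ R k x := by
  unfold boggio boggioIntegrand
  refine intervalIntegral.integral_mono_on zero_le_one
    (Continuous.intervalIntegrable (by fun_prop) _ _)
    (Continuous.intervalIntegrable (by fun_prop) _ _) fun θ hθ => ?_
  have : 0 ≤ R ^ 2 - ‖x‖ ^ 2 := sub_nonneg.2 (pow_le_pow_left₀ (norm_nonneg _) hx 2)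
  have h0 := hθ.1
  exact mul_le_mul_of_nonneg_left (mul_le_mul_of_nonneg_left
    (h _ (by positivity)) (by positivity)) (by positivity)

theorem boggio_pos {Φ : ℝ → ℝ} (hΦ : Continuous Φ) (h0 : ∀ s, 0 ≤ Φ s) {y : E N} {κ R : ℝ}
    (hκ : 0 < κ) (k : ℕ) {x : E N} (hx : ‖x‖ < R)
    (h : 0 < Φ (‖x - y‖ ^ 2 + κ * (R ^ 2 - ‖x‖ ^ 2))) : 0 < boggio Φ y κ R k x := by
  have hP : 0 < R ^ 2 - ‖x‖ ^ 2 := sub_pos.2 (pow_lt_pow_left₀ hx (norm_nonneg _) two_ne_zero)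
  unfold boggio boggioIntegrand
  refine intervalIntegral.integral_pos zero_lt_one (Continuous.continuousOn (by fun_prop))
    (fun θ hθ => ?_) ⟨1, ⟨zero_le_one, le_rfl⟩, ?_⟩
  · have h1 := h0 (‖x - y‖ ^ 2 + θ * (κ * (R ^ 2 - ‖x‖ ^ 2)))
    have := hθ.1
    positivity
  · simp only [one_mul, one_pow]
    positivity

/-- The regularised Boggio kernel satisfies the Dirichlet conditions on the sphere. -/
theorem boggio_eq_pow_mul {Φ : ℝ → ℝ} (hΦ : ContDiff ℝ ∞ Φ) (y : E N) (κ R : ℝ) (k : ℕ) :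
    ∃ g : E N → ℝ, ContDiff ℝ ∞ g ∧
      ∀ x, boggio Φ y κ R k x = (R ^ 2 - ‖x‖ ^ 2) ^ (k + 1) * g x := by
  have hn : ContDiff ℝ ∞ fun q : E N × ℝ => ‖q.1‖ ^ 2 := (contDiff_norm_sq ℝ).comp contDiff_fst
  have hd : ContDiff ℝ ∞ fun q : E N × ℝ => ‖q.1 - y‖ ^ 2 :=
    (contDiff_norm_sq ℝ).comp (contDiff_fst.sub contDiff_const)
  have hf : ContDiff ℝ ∞ fun q : E N × ℝ => q.2 ^ k * (κ ^ (k + 1) *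
      Φ (‖q.1 - y‖ ^ 2 + q.2 * (κ * (R ^ 2 - ‖q.1‖ ^ 2)))) :=
    (contDiff_snd.pow k).mul (contDiff_const.mul
      (hΦ.comp (hd.add (contDiff_snd.mul (contDiff_const.mul (contDiff_const.sub hn))))))
  refine ⟨_, contDiff_infty_integral_unitInterval hf, fun x => ?_⟩
  rw [← intervalIntegral.integral_const_mul]
  unfold boggio boggioIntegrand
  congr 1
  funext θ
  simp only
  rw [mul_pow]
  ring

/-! ### Cutting off functions which vanish to high order on the sphere -/

theorem natCast_le_infty (n : ℕ) : (n : WithTop ℕ∞) ≤ ∞ := by exact_mod_cast le_top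

theorem exists_bound_le_of_continuous {X : Type*} [TopologicalSpace X] {s : Set X}
    (hs : IsCompact s) {f : ℕ → X → ℝ} (hf : ∀ j, Continuous (f j)) (m : ℕ) :
    ∃ C, 1 ≤ C ∧ ∀ j ≤ m, ∀ x ∈ s, f j x ≤ C := by
  induction m with
  | zero =>
    obtain ⟨C, hC⟩ := hs.exists_bound_of_continuousOn (hf 0).continuousOn
    refine ⟨max 1 C, le_max_left _ _, fun j hj x hx => ?_⟩
    obtain rfl : j = 0 := by omega
    exact (le_abs_self _).trans ((hC x hx).trans (le_max_right _ _))
  | succ m ih =>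
    obtain ⟨C, hC1, hC⟩ := ih
    obtain ⟨C', hC'⟩ := hs.exists_bound_of_continuousOn (hf (m + 1)).continuousOn
    refine ⟨max C C', hC1.trans (le_max_left _ _), fun j hj x hx => ?_⟩
    rcases Nat.lt_or_ge m j with h | h
    · obtain rfl : j = m + 1 := by omega
      exact (le_abs_self _).trans ((hC' x hx).trans (le_max_right _ _))
    · exact (hC j h x hx).trans (le_max_left _ _)

/-- The power `t^m` cut off near `t = 0` at scale `ε`. -/
noncomputable def cutPow (m : ℕ) (ε t : ℝ) : ℝ := t ^ m * step (ε⁻¹ * t)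

theorem contDiff_cutPow (m : ℕ) (ε : ℝ) : ContDiff ℝ ∞ (cutPow m ε) :=
  (contDiff_id.pow m).mul (contDiff_step.comp (contDiff_const.mul contDiff_id))

theorem exists_cutPow_one_bound (m : ℕ) : ∃ C, 0 ≤ C ∧ ∀ j ≤ m, ∀ s, 0 ≤ s →
    |iteratedDeriv j (cutPow m 1) s| ≤ C * (1 + s) ^ (m - j) := by
  obtain ⟨C, hC1, hC⟩ := exists_bound_le_of_continuous (isCompact_Icc (a := (0 : ℝ)) (b := 2))
    (f := fun j s => |iteratedDeriv j (cutPow m 1) s|)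
    (fun j => ((contDiff_cutPow m 1).continuous_iteratedDeriv j (natCast_le_infty j)).abs) m
  have hf : (0 : ℝ) ≤ ∑ j ∈ Finset.range (m + 1), |∏ i ∈ Finset.range j, ((m : ℝ) - i)| :=
    Finset.sum_nonneg fun _ _ => abs_nonneg _
  refine ⟨C + ∑ j ∈ Finset.range (m + 1), |∏ i ∈ Finset.range j, ((m : ℝ) - i)|, by positivity,
    fun j hj s hs => ?_⟩
  rcases le_or_gt s 2 with h | h
  · calc |iteratedDeriv j (cutPow m 1) s| ≤
          (C + ∑ j ∈ Finset.range (m + 1), |∏ i ∈ Finset.range j, ((m : ℝ) - i)|) * 1 := by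
          linarith [hC j hj s ⟨hs, h⟩]
      _ ≤ _ := mul_le_mul_of_nonneg_left (one_le_pow₀ (by linarith)) (by linarith)
  · have he : cutPow m 1 =ᶠ[𝓝 s] fun t => t ^ m := by
      filter_upwards [lt_mem_nhds (show 1 < s by linarith)] with t ht
      simp [cutPow, step_eq_one (le_of_lt ht)]
    rw [(he.iteratedDeriv j).eq_of_nhds, iteratedDeriv_eq_iterate, iter_deriv_pow, abs_mul,
      abs_of_nonneg (by positivity : (0 : ℝ) ≤ s ^ (m - j))]
    have h1 := Finset.single_le_sum (f := fun j => |∏ i ∈ Finset.range j, ((m : ℝ) - i)|)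
      (fun _ _ => abs_nonneg _) (Finset.mem_range.2 (Nat.lt_succ_of_le hj))
    replace h1 := h1.trans (le_add_of_nonneg_left (by linarith : 0 ≤ C))
    exact mul_le_mul h1 (pow_le_pow_left₀ hs (by linarith) _) (by positivity) (by linarith)

/-- The derivatives of the cut-off powers up to order `m` are bounded uniformly in the scale, since
`cutPow m ε t = ε^m cutPow m 1 (t / ε)`. -/
theorem exists_cutPow_bound (m : ℕ) (M : ℝ) : ∃ C, 0 ≤ C ∧ ∀ ε, 0 < ε → ε ≤ 1 → ∀ j ≤ m,
    ∀ t ∈ Icc 0 M, ‖iteratedFDeriv ℝ j (cutPow m ε) t‖ ≤ C := by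
  obtain ⟨C, hC0, hC⟩ := exists_cutPow_one_bound m
  refine ⟨C * (1 + |M|) ^ m, by positivity, fun ε hε hε1 j hj t ht => ?_⟩
  have he : cutPow m ε = fun t => ε ^ m * (fun t => cutPow m 1 (ε⁻¹ * t)) t := by
    funext t
    simp only [cutPow, mul_pow, inv_one, one_mul]
    rw [← mul_assoc, ← mul_assoc, ← mul_pow, mul_inv_cancel₀ hε.ne', one_pow, one_mul]
  rw [norm_iteratedFDeriv_eq_norm_iteratedDeriv, he, iteratedDeriv_const_mul_field,
    iteratedDeriv_comp_const_smul ((contDiff_cutPow m 1).of_le (natCast_le_infty j))]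
  have h1 := hC j hj (ε⁻¹ * t) (mul_nonneg (inv_nonneg.2 hε.le) ht.1)
  simp only [smul_eq_mul]
  rw [Real.norm_eq_abs, abs_mul, abs_mul, abs_of_pos (by positivity : 0 < ε ^ m),
    abs_of_pos (by positivity : 0 < ε⁻¹ ^ j)]
  calc ε ^ m * (ε⁻¹ ^ j * |iteratedDeriv j (cutPow m 1) (ε⁻¹ * t)|)
      ≤ ε ^ m * (ε⁻¹ ^ j * (C * (1 + ε⁻¹ * t) ^ (m - j))) := by gcongr
    _ = C * (ε + t) ^ (m - j) := by
        obtain ⟨i, rfl⟩ := Nat.exists_eq_add_of_le hj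
        rw [Nat.add_sub_cancel_left]
        have : (ε + t) ^ i = ε ^ i * (1 + ε⁻¹ * t) ^ i := by
          rw [← mul_pow]; congr 1; field_simp
        have h2 : ε ^ j * ε⁻¹ ^ j = 1 := by rw [← mul_pow, mul_inv_cancel₀ hε.ne', one_pow]
        rw [this, pow_add]
        linear_combination C * ε ^ i * (1 + ε⁻¹ * t) ^ i * h2
    _ ≤ C * (1 + |M|) ^ (m - j) := by
        have := ht.1
        gcongr
        exact ht.2.trans (le_abs_self M)
    _ ≤ C * (1 + |M|) ^ m := by
        gcongr
        · linarith [abs_nonneg M]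
        · omega

theorem IsTestFunction.of_eq_zero {φ : E N → ℝ} (hφ : ContDiff ℝ ∞ φ) {K Ω : Set (E N)}
    (hK : IsCompact K) (hKΩ : K ⊆ Ω) (h : ∀ x ∉ K, φ x = 0) : IsTestFunction Ω φ := by
  have hs : tsupport φ ⊆ K := closure_minimal (fun x hx => by
    by_contra hx'; exact hx (h x hx')) hK.isClosed
  exact ⟨hφ, hK.of_isClosed_subset (isClosed_tsupport _) hs, hs.trans hKΩ⟩

/-- Cutting off `(R² - |x|²)^m g` near the sphere keeps the energy of order `m` bounded. -/
theorem exists_cutoff_energy_bound (m : ℕ) {R : ℝ} (hR : 0 < R) {g : E N → ℝ}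
    (hg : ContDiff ℝ ∞ g) : ∃ C, 0 ≤ C ∧ ∀ ε, 0 < ε → ε ≤ 1 →
      IsTestFunction (Metric.ball (0 : E N) R) (fun x => cutPow m ε (R ^ 2 - ‖x‖ ^ 2) * g x) ∧
      dirichletEnergy m (fun x => cutPow m ε (R ^ 2 - ‖x‖ ^ 2) * g x) ≤ C := by
  have hq : ContDiff ℝ ∞ fun x : E N => R ^ 2 - ‖x‖ ^ 2 := contDiff_const.sub (contDiff_norm_sq ℝ)
  have hK := isCompact_closedBall (0 : E N) R
  obtain ⟨C₁, hC₁0, hC₁⟩ := exists_cutPow_bound m (R ^ 2)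
  obtain ⟨D, hD1, hD⟩ := exists_bound_le_of_continuous hK
    (f := fun j x => ‖iteratedFDeriv ℝ j (fun x : E N => R ^ 2 - ‖x‖ ^ 2) x‖)
    (fun j => (hq.continuous_iteratedFDeriv (natCast_le_infty j)).norm) m
  obtain ⟨G, hG1, hG⟩ := exists_bound_le_of_continuous hK
    (f := fun j x => ‖iteratedFDeriv ℝ j g x‖)
    (fun j => (hg.continuous_iteratedFDeriv (natCast_le_infty j)).norm) m
  set B : ℝ := ∑ i ∈ Finset.range (m + 1), (m.choose i : ℝ) * (i.factorial * C₁ * D ^ i) * G with hB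
  have hB0 : 0 ≤ B := Finset.sum_nonneg fun i _ => by positivity
  refine ⟨((N : ℝ) ^ (m / 2)) ^ 2 * (B ^ 2 * volume.real (Metric.ball (0 : E N) R)), by positivity,
    fun ε hε hε1 => ?_⟩
  have hF := contDiff_cutPow m ε
  have hFq : ContDiff ℝ ∞ fun x : E N => cutPow m ε (R ^ 2 - ‖x‖ ^ 2) := hF.comp hq
  have htest : IsTestFunction (Metric.ball (0 : E N) R)
      (fun x => cutPow m ε (R ^ 2 - ‖x‖ ^ 2) * g x) := by
    refine IsTestFunction.of_eq_zero (hFq.mul hg)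
      (K := Metric.closedBall 0 (√(max 0 (R ^ 2 - ε / 2)))) (isCompact_closedBall _ _) ?_ ?_
    · refine Metric.closedBall_subset_ball ?_
      rw [Real.sqrt_lt' hR, max_lt_iff]
      constructor <;> [positivity; linarith]
    · intro x hx
      have h1 : √(max 0 (R ^ 2 - ε / 2)) < ‖x‖ := by simpa using hx
      have h2 := Real.lt_sq_of_sqrt_lt h1
      have h3 : R ^ 2 - ‖x‖ ^ 2 ≤ ε / 2 := by linarith [le_max_right 0 (R ^ 2 - ε / 2)]
      have h4 : ε⁻¹ * (R ^ 2 - ‖x‖ ^ 2) ≤ 1 / 2 := by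
        rw [inv_mul_le_iff₀ hε]; linarith
      simp [cutPow, step_eq_zero h4]
  refine ⟨htest, (dirichletEnergy_le_integral htest m).trans ?_⟩
  refine mul_le_mul_of_nonneg_left ?_ (by positivity)
  set w : E N → ℝ := fun x => cutPow m ε (R ^ 2 - ‖x‖ ^ 2) * g x with hw
  have hbound : ∀ x ∈ Metric.ball (0 : E N) R, ‖iteratedFDeriv ℝ m w x‖ ≤ B := by
    intro x hx
    have hxc := Metric.ball_subset_closedBall hx
    refine (norm_iteratedFDeriv_mul_le hFq hg x (natCast_le_infty m)).trans ?_
    refine Finset.sum_le_sum fun i hi => ?_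
    have him : i ≤ m := by simpa [Nat.lt_succ_iff] using hi
    have h1 : ‖iteratedFDeriv ℝ i (fun x : E N => cutPow m ε (R ^ 2 - ‖x‖ ^ 2)) x‖ ≤
        i.factorial * C₁ * D ^ i := by
      refine norm_iteratedFDeriv_comp_le hF hq (natCast_le_infty i) x (fun j hj => ?_)
        fun j hj1 hj => ?_
      · refine hC₁ ε hε hε1 j (hj.trans him) _ ⟨?_, ?_⟩
        · have := mem_closedBall_zero_iff.1 hxc
          exact sub_nonneg.2 (pow_le_pow_left₀ (norm_nonneg _) this 2)
        · linarith [sq_nonneg ‖x‖]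
      · exact (hD j (hj.trans him) x hxc).trans (le_self_pow₀ hD1 (by omega))
    gcongr
    exact hG (m - i) (by omega) x hxc
  have hzero : ∀ x ∉ Metric.ball (0 : E N) R, ‖iteratedFDeriv ℝ m w x‖ ^ 2 = 0 := by
    intro x hx
    have : iteratedFDeriv ℝ m w x = 0 := image_eq_zero_of_notMem_tsupport fun h' =>
      hx (htest.2.2 (tsupport_iteratedFDeriv_subset m h'))
    simp [this]
  rw [← setIntegral_eq_integral_of_forall_compl_eq_zero hzero]
  have hfin : volume (Metric.ball (0 : E N) R) < ⊤ := measure_ball_lt_top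
  calc ∫ x in Metric.ball (0 : E N) R, ‖iteratedFDeriv ℝ m w x‖ ^ 2
      ≤ ∫ _ in Metric.ball (0 : E N) R, B ^ 2 := by
        refine setIntegral_mono_on ?_ (integrableOn_const (hs := hfin.ne)) measurableSet_ball
          fun x hx => pow_le_pow_left₀ (norm_nonneg _) (hbound x hx) 2
        exact ((htest.1.continuous_iteratedFDeriv (natCast_le_infty m)).norm.pow
          2).continuousOn.integrableOn_compact hK |>.mono_set Metric.ball_subset_closedBall
    _ = B ^ 2 * volume.real (Metric.ball (0 : E N) R) := by
        rw [setIntegral_const, smul_eq_mul, mul_comm]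

/-! ### Limits in `L²` -/

section L2

variable {α : Type*} [MeasurableSpace α] {μ : Measure α}

theorem inner_toLp_eq_integral_mul {f g : α → ℝ} (hf : MemLp f 2 μ) (hg : MemLp g 2 μ) :
    inner ℝ (hf.toLp f) (hg.toLp g) = ∫ x, f x * g x ∂μ := by
  rw [L2.inner_def]
  refine integral_congr_ae ?_
  filter_upwards [hf.coeFn_toLp, hg.coeFn_toLp] with x h1 h2
  rw [h1, h2, real_inner_eq_re_inner]
  simp [mul_comm]

theorem norm_toLp_sq {f : α → ℝ} (hf : MemLp f 2 μ) : ‖hf.toLp f‖ ^ 2 = ∫ x, f x ^ 2 ∂μ := by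
  rw [← real_inner_self_eq_norm_sq, inner_toLp_eq_integral_mul]
  simp_rw [sq]

theorem abs_integral_mul_le_norm {f g : α → ℝ} (hf : MemLp f 2 μ) (hg : MemLp g 2 μ) :
    |∫ x, f x * g x ∂μ| ≤ ‖hf.toLp f‖ * ‖hg.toLp g‖ := by
  rw [← inner_toLp_eq_integral_mul hf hg]
  exact abs_real_inner_le_norm _ _

theorem tendsto_integral_mul_of_tendsto {f g : ℕ → α → ℝ} {f' g' : α → ℝ}
    (hf : ∀ k, MemLp (f k) 2 μ) (hg : ∀ k, MemLp (g k) 2 μ) (hf' : MemLp f' 2 μ)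
    (hg' : MemLp g' 2 μ) (hft : Tendsto (fun k => eLpNorm (f k - f') 2 μ) atTop (𝓝 0))
    (hgt : Tendsto (fun k => eLpNorm (g k - g') 2 μ) atTop (𝓝 0)) :
    Tendsto (fun k => ∫ x, f k x * g k x ∂μ) atTop (𝓝 (∫ x, f' x * g' x ∂μ)) := by
  have h1 := (Lp.tendsto_Lp_iff_tendsto_eLpNorm'' f hf f' hf').2 hft
  have h2 := (Lp.tendsto_Lp_iff_tendsto_eLpNorm'' g hg g' hg').2 hgt
  simpa only [inner_toLp_eq_integral_mul] using h1.inner (𝕜 := ℝ) h2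

theorem tendsto_integral_mul_const_of_tendsto {f : ℕ → α → ℝ} {f' g : α → ℝ}
    (hf : ∀ k, MemLp (f k) 2 μ) (hf' : MemLp f' 2 μ) (hg : MemLp g 2 μ)
    (hft : Tendsto (fun k => eLpNorm (f k - f') 2 μ) atTop (𝓝 0)) :
    Tendsto (fun k => ∫ x, f k x * g x ∂μ) atTop (𝓝 (∫ x, f' x * g x ∂μ)) :=
  tendsto_integral_mul_of_tendsto hf (fun _ => hg) hf' hg hft (by simp)

end L2

/-! ### Limits of test functions in the energy norm -/

/-- The distribution `(-Δ)^m u`, tested with `η`. -/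
noncomputable def weakForm (m : ℕ) (Ω : Set (E N)) (u η : E N → ℝ) : ℝ :=
  (-1) ^ m * ∫ x in Ω, u x * iterLaplacian m η x

/-- `u` is the `L²(Ω)`-limit of the test functions `φ k`, which form a Cauchy sequence for the
Dirichlet energy. -/
structure EnergyApprox (m : ℕ) (Ω : Set (E N)) (φ : ℕ → E N → ℝ) (u : E N → ℝ) : Prop where
  test : ∀ k, IsTestFunction Ω (φ k)
  memLp : MemLp u 2 (volume.restrict Ω)
  tendsto : Tendsto (fun k => eLpNorm (φ k - u) 2 (volume.restrict Ω)) atTop (𝓝 0)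
  cauchy : ∃ ε : ℕ → ℝ, Tendsto ε atTop (𝓝 0) ∧ ∀ k l, k ≤ l →
    energyForm m (fun x => φ k x - φ l x) (fun x => φ k x - φ l x) ≤ ε k

section

variable {m : ℕ} {Ω : Set (E N)} {φ : ℕ → E N → ℝ} {u : E N → ℝ}

theorem IsTestFunction.memLp_restrict {η : E N → ℝ} (h : IsTestFunction Ω η) :
    MemLp η 2 (volume.restrict Ω) := (h.memLp 2).restrict Ω

theorem weakForm_eq_energyForm {φ η : E N → ℝ} (hη : IsTestFunction Ω η) :
    weakForm m Ω φ η = energyForm m φ η := by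
  unfold weakForm energyForm
  rw [(hη.iterLaplacian m).setIntegral_mul]

theorem energyForm_sub_left {φ₁ φ₂ η : E N → ℝ} (h₁ : IsTestFunction Ω φ₁)
    (h₂ : IsTestFunction Ω φ₂) (hη : IsTestFunction Ω η) (m : ℕ) :
    energyForm m (fun x => φ₁ x - φ₂ x) η = energyForm m φ₁ η - energyForm m φ₂ η := by
  have : (fun x => φ₁ x - φ₂ x) = fun x => φ₁ x + (-1) * φ₂ x := by funext x; ring
  rw [this, energyForm_add_left hη h₁ (h₂.const_mul _), energyForm_const_mul_left]
  ring

namespace EnergyApprox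

theorem tendsto_energyForm (h : EnergyApprox m Ω φ u) {η : E N → ℝ} (hη : IsTestFunction Ω η) :
    Tendsto (fun k => energyForm m (φ k) η) atTop (𝓝 (weakForm m Ω u η)) := by
  have := (tendsto_integral_mul_const_of_tendsto (fun k => (h.test k).memLp_restrict) h.memLp
    (hη.iterLaplacian m).memLp_restrict h.tendsto).const_mul ((-1) ^ m)
  refine this.congr fun k => ?_
  rw [← weakForm_eq_energyForm hη]
  rfl

/-- Quantitative convergence of the energy form, uniform on sets of bounded energy. -/
theorem exists_rate (h : EnergyApprox m Ω φ u) : ∃ ε : ℕ → ℝ, Tendsto ε atTop (𝓝 0) ∧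
    (∀ k, 0 ≤ ε k) ∧ ∀ k η, IsTestFunction Ω η →
      (energyForm m (φ k) η - weakForm m Ω u η) ^ 2 ≤ ε k * energyForm m η η := by
  obtain ⟨ε, hε, hc⟩ := h.cauchy
  refine ⟨ε, hε, fun k => (energyForm_self_nonneg ((h.test k).sub (h.test k)) m).trans
    (hc k k le_rfl), fun k η hη => ?_⟩
  have h1 := ((tendsto_const_nhds (x := energyForm m (φ k) η)).sub (h.tendsto_energyForm hη)).pow 2
  refine le_of_tendsto h1 ?_
  filter_upwards [eventually_ge_atTop k] with l hl
  rw [← energyForm_sub_left (h.test k) (h.test l) hη]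
  exact (energyForm_sq_le ((h.test k).sub (h.test l)) hη m).trans
    (mul_le_mul_of_nonneg_right (hc k l hl) (energyForm_self_nonneg hη m))

theorem tendsto_integral_mul (h : EnergyApprox m Ω φ u) {f : E N → ℝ}
    (hf : MemLp f 2 (volume.restrict Ω)) :
    Tendsto (fun k => ∫ x in Ω, φ k x * f x) atTop (𝓝 (∫ x in Ω, u x * f x)) :=
  tendsto_integral_mul_const_of_tendsto (fun k => (h.test k).memLp_restrict) h.memLp hf h.tendsto

end EnergyApprox

theorem cutPow_mul_eq {m : ℕ} {ε t : ℝ} (hε : 0 < ε) (h : ε ≤ t) : cutPow m ε t = t ^ m := by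
  have : 1 ≤ ε⁻¹ * t := by rw [← div_eq_inv_mul]; exact (one_le_div hε).2 h
  rw [cutPow, step_eq_one this, mul_one]

theorem abs_cutPow_le {m : ℕ} {ε t : ℝ} : |cutPow m ε t| ≤ |t ^ m| := by
  rw [cutPow, abs_mul, abs_of_nonneg (step_nonneg _)]
  exact mul_le_of_le_one_right (abs_nonneg _) (step_le_one _)

theorem memLp_restrict_of_continuous (hΩ : Bornology.IsBounded Ω) {g : E N → ℝ}
    (hg : Continuous g) : MemLp g 2 (volume.restrict Ω) := by
  obtain ⟨R, hR⟩ := hΩ.subset_closedBall 0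
  obtain ⟨C, hC⟩ := (isCompact_closedBall (0 : E N) R).exists_bound_of_continuousOn hg.continuousOn
  have : IsFiniteMeasure (volume.restrict (Metric.closedBall (0 : E N) R)) :=
    ⟨by simpa using measure_closedBall_lt_top⟩
  have h : MemLp g 2 (volume.restrict (Metric.closedBall (0 : E N) R)) :=
    MemLp.of_bound hg.aestronglyMeasurable C (by
      filter_upwards [ae_restrict_mem measurableSet_closedBall] with x hx using hC x hx)
  exact h.mono_measure (Measure.restrict_mono hR le_rfl)

/-- An energy limit may be tested with smooth functions vanishing to order `m` on the sphere. -/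
theorem EnergyApprox.integral_mul_iterLaplacian_of_ball {R : ℝ} (hR : 0 < R)
    (h : EnergyApprox m (Metric.ball (0 : E N) R) φ u) {f : E N → ℝ}
    (hf : MemLp f 2 (volume.restrict (Metric.ball (0 : E N) R)))
    (heq : ∀ η, IsTestFunction (Metric.ball (0 : E N) R) η →
      weakForm m (Metric.ball (0 : E N) R) u η = ∫ x in Metric.ball (0 : E N) R, f x * η x)
    {g : E N → ℝ} (hg : ContDiff ℝ ∞ g) {w : E N → ℝ}
    (hw : ∀ x, w x = (R ^ 2 - ‖x‖ ^ 2) ^ m * g x) :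
    (-1) ^ m * ∫ x in Metric.ball (0 : E N) R, u x * iterLaplacian m w x =
      ∫ x in Metric.ball (0 : E N) R, f x * w x := by
  set B := Metric.ball (0 : E N) R with hB
  have hws : ContDiff ℝ ∞ w := by
    rw [show w = fun x => (R ^ 2 - ‖x‖ ^ 2) ^ m * g x from funext hw]
    exact ((contDiff_const.sub (contDiff_norm_sq ℝ)).pow m).mul hg
  obtain ⟨C, hC0, hC⟩ := exists_cutoff_energy_bound m hR hg
  set ε : ℕ → ℝ := fun j => 1 / ((j : ℝ) + 1)
  have hε0 : ∀ j, 0 < ε j := fun j => by positivity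
  have hε1 : ∀ j, ε j ≤ 1 := fun j => by
    simp only [ε]; rw [div_le_one (by positivity)]; linarith [Nat.cast_nonneg (α := ℝ) j]
  have hεt : Tendsto ε atTop (𝓝 0) := tendsto_one_div_add_atTop_nhds_zero_nat
  set W : ℕ → E N → ℝ := fun j x => cutPow m (ε j) (R ^ 2 - ‖x‖ ^ 2) * g x
  have hW : ∀ j, IsTestFunction B (W j) := fun j => (hC _ (hε0 j) (hε1 j)).1
  have hWE : ∀ j, energyForm m (W j) (W j) ≤ C := fun j => by
    rw [energyForm_self (hW j)]; exact (hC _ (hε0 j) (hε1 j)).2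
  -- the right-hand sides converge
  have hfW : Tendsto (fun j => ∫ x in B, f x * W j x) atTop (𝓝 (∫ x in B, f x * w x)) := by
    have hwm : MemLp w 2 (volume.restrict B) :=
      memLp_restrict_of_continuous Metric.isBounded_ball hws.continuous
    refine tendsto_integral_of_dominated_convergence (fun x => ‖f x * w x‖) (fun j =>
      hf.1.mul (hW j).memLp_restrict.1) (hf.integrable_mul hwm).norm (fun j => ?_) ?_
    · refine ae_of_all _ fun x => ?_
      rw [norm_mul (f x), norm_mul (f x)]
      refine mul_le_mul_of_nonneg_left ?_ (norm_nonneg (f x))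
      rw [hw, norm_mul, norm_mul]
      exact mul_le_mul_of_nonneg_right abs_cutPow_le (norm_nonneg (g x))
    · filter_upwards [ae_restrict_mem measurableSet_ball] with x hx
      refine tendsto_const_nhds.congr' ?_
      have hx' : 0 < R ^ 2 - ‖x‖ ^ 2 := sub_pos.2
        (pow_lt_pow_left₀ (mem_ball_zero_iff.1 hx) (norm_nonneg _) two_ne_zero)
      filter_upwards [hεt.eventually (gt_mem_nhds hx')] with j hj
      simp only [W]
      rw [hw, cutPow_mul_eq (hε0 j) hj.le]
  obtain ⟨r, hr, hr0, hrate⟩ := h.exists_rate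
  -- for fixed `k`, the cut-off does not matter on the support of `φ k`
  have hk : ∀ k, ∀ᶠ j in atTop, energyForm m (φ k) (W j) =
      (-1) ^ m * ∫ x in B, φ k x * iterLaplacian m w x := by
    intro k
    have hφ := h.test k
    obtain ⟨c, hc0, hc⟩ : ∃ c, 0 < c ∧ ∀ x ∈ tsupport (φ k), c ≤ R ^ 2 - ‖x‖ ^ 2 := by
      have hcont : Continuous fun x : E N => R ^ 2 - ‖x‖ ^ 2 := by fun_prop
      rcases (tsupport (φ k)).eq_empty_or_nonempty with he | hne
      · exact ⟨1, one_pos, by simp [he]⟩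
      · obtain ⟨x₀, hx₀, hmin⟩ := hφ.2.1.isCompact.exists_isMinOn hne hcont.continuousOn
        refine ⟨R ^ 2 - ‖x₀‖ ^ 2, sub_pos.2 (pow_lt_pow_left₀
          (mem_ball_zero_iff.1 (hφ.2.2 hx₀)) (norm_nonneg _) two_ne_zero), fun x hx => hmin hx⟩
    filter_upwards [hεt.eventually (gt_mem_nhds hc0)] with j hj
    rw [energyForm_comm hφ (hW j)]
    unfold energyForm
    congr 1
    calc ∫ x, W j x * iterLaplacian m (φ k) x = ∫ x, iterLaplacian m (φ k) x * w x := by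
          refine integral_congr_ae (ae_of_all _ fun x => ?_)
          by_cases hx : x ∈ tsupport (φ k)
          · simp only [W]
            rw [hw, cutPow_mul_eq (hε0 j) (hj.le.trans (hc x hx)), mul_comm]
          · have h0 : IsTestFunction (tsupport (φ k)) (φ k) := ⟨hφ.1, hφ.2.1, Subset.rfl⟩
            simp [(h0.iterLaplacian m).eq_zero_of_notMem hx]
      _ = ∫ x, φ k x * iterLaplacian m w x := (hφ.integral_mul_iterLaplacian hws m).symm
      _ = ∫ x in B, φ k x * iterLaplacian m w x := by
          have := hφ.setIntegral_mul (iterLaplacian m w)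
          simp_rw [mul_comm (φ k _)]
          exact this.symm
  have hkey : ∀ k, ((-1) ^ m * (∫ x in B, φ k x * iterLaplacian m w x) -
      ∫ x in B, f x * w x) ^ 2 ≤ r k * C := by
    intro k
    refine le_of_tendsto ((tendsto_const_nhds.sub hfW).pow 2) ?_
    filter_upwards [hk k] with j hj
    rw [← hj, ← heq _ (hW j)]
    exact (hrate k _ (hW j)).trans (mul_le_mul_of_nonneg_left (hWE j) (hr0 k))
  have hlim := (((h.tendsto_integral_mul (memLp_restrict_of_continuous Metric.isBounded_ball
    (contDiff_iterLaplacian hws m).continuous)).const_mul ((-1) ^ m)).sub_const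
      (∫ x in B, f x * w x)).pow 2
  have h0 := le_of_tendsto_of_tendsto' hlim (hr.mul_const C) hkey
  rw [zero_mul] at h0
  exact sub_eq_zero.1 (pow_eq_zero_iff two_ne_zero |>.1 (le_antisymm h0 (sq_nonneg _)))

end

/-! ### Approximate identities -/

/-- At almost every point, a locally integrable function is the limit of its convolutions with a
rescaled kernel, which need not have a sign. -/
theorem ae_tendsto_integral_kernel {K : E N → ℝ} (hK : Continuous K)
    (hKs : ∀ z, 1 < ‖z‖ → K z = 0) (hKi : ∫ z, K z ≠ 0) {u : E N → ℝ}
    (hu : LocallyIntegrable u (volume : Measure (E N))) {ε : ℕ → ℝ} (hε : ∀ j, 0 < ε j)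
    (hεt : Tendsto ε atTop (𝓝 0)) :
    ∀ᵐ y, Tendsto (fun j => ∫ x, u x * ((ε j ^ N)⁻¹ * K ((ε j)⁻¹ • (x - y)))) atTop
      (𝓝 (u y * ∫ z, K z)) := by
  have hvol : ∀ r : ℝ, 0 ≤ r → ∀ y : E N, volume.real (Metric.closedBall y r) =
      r ^ N * volume.real (Metric.closedBall (0 : E N) 1) := by
    intro r hr y
    have := Measure.addHaar_real_closedBall' (volume : Measure (E N)) y hr
    simpa using this
  have hv1 : 0 < volume.real (Metric.closedBall (0 : E N) 1) :=
    ENNReal.toReal_pos (Metric.measure_closedBall_pos _ _ one_pos).ne' measure_closedBall_lt_top.ne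
  have hsupp : HasCompactSupport K := by
    refine HasCompactSupport.intro (isCompact_closedBall (0 : E N) 1) fun z hz => hKs z ?_
    simpa using hz
  obtain ⟨C, hC⟩ := hK.bounded_above_of_compact_support hsupp
  set I := ∫ z, K z
  filter_upwards [(Besicovitch.vitaliFamily volume).ae_tendsto_average_norm_sub hu] with y hy
  have hε' : Tendsto ε atTop (𝓝[>] 0) :=
    tendsto_nhdsWithin_iff.2 ⟨hεt, Eventually.of_forall hε⟩
  have h1 := (hy.comp (Besicovitch.tendsto_filterAt volume y)).comp hε'
  have h2 := tendsto_integral_smul_of_tendsto_average_norm_sub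
    (g := fun j x => I⁻¹ * ((ε j ^ N)⁻¹ * K ((ε j)⁻¹ • (x - y))))
    (C * |I⁻¹| * volume.real (Metric.closedBall (0 : E N) 1)) h1
    (Eventually.of_forall fun j => hu.integrableOn_isCompact (isCompact_closedBall _ _)) ?_ ?_ ?_
  · have h3 := h2.const_mul I
    rw [mul_comm] at h3
    refine h3.congr fun j => ?_
    rw [← integral_const_mul]
    congr 1
    funext x
    simp only [smul_eq_mul]
    field_simp
  · refine tendsto_const_nhds.congr fun j => ?_
    rw [integral_const_mul, integral_const_mul,
      integral_sub_right_eq_self (fun x => K ((ε j)⁻¹ • x)) y,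
      Measure.integral_comp_smul volume K]
    simp only [finrank_euclideanSpace, Fintype.card_fin, inv_pow, inv_inv, smul_eq_mul]
    have := hε j
    rw [abs_of_pos (by positivity)]
    change 1 = I⁻¹ * ((ε j ^ N)⁻¹ * (ε j ^ N * I))
    field_simp
  · refine Eventually.of_forall fun j x hx => ?_
    by_contra hx'
    refine hx ?_
    have h4 : ε j < ‖x - y‖ := by simpa [dist_eq_norm] using hx'
    have : 1 < ‖(ε j)⁻¹ • (x - y)‖ := by
      rw [norm_smul, norm_inv, Real.norm_eq_abs, abs_of_pos (hε j), ← div_eq_inv_mul]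
      exact (one_lt_div (hε j)).2 h4
    simp [hKs _ this]
  · refine Eventually.of_forall fun j x => ?_
    have h0 := hε j
    rw [hvol _ h0.le, abs_mul, abs_mul, abs_of_pos (by positivity : 0 < (ε j ^ N)⁻¹)]
    have h5 := hC ((ε j)⁻¹ • (x - y))
    rw [Real.norm_eq_abs] at h5
    calc |I⁻¹| * ((ε j ^ N)⁻¹ * |K ((ε j)⁻¹ • (x - y))|) ≤ |I⁻¹| * ((ε j ^ N)⁻¹ * C) := by gcongr
      _ = _ := by field_simp

/-! ### Boggio's positivity theorem -/

theorem Profile.kernel_eq_zero (p : Profile N 1) (k : ℕ) {z : E N} (hz : 1 < ‖z‖) :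
    p.kernel k z = 0 :=
  (p.isTestFunction_kernel zero_le_one k).eq_zero_of_notMem (by simpa using hz)

/-- **Boggio**: in a ball, `(-Δ)^{k+1} u = f ≥ 0` with homogeneous Dirichlet conditions implies
`u ≥ 0`, and `u > 0` unless `f = 0`. -/
theorem EnergyApprox.nonneg_and_pos_of_ball (hN : 1 ≤ N) {k : ℕ} {R : ℝ} (hR : 0 < R)
    {φ : ℕ → E N → ℝ} {u f : E N → ℝ}
    (h : EnergyApprox (k + 1) (Metric.ball (0 : E N) R) φ u)
    (hf : MemLp f 2 (volume.restrict (Metric.ball (0 : E N) R)))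
    (hf0 : ∀ᵐ x ∂(volume.restrict (Metric.ball (0 : E N) R)), 0 ≤ f x)
    (heq : ∀ η, IsTestFunction (Metric.ball (0 : E N) R) η →
      weakForm (k + 1) (Metric.ball (0 : E N) R) u η = ∫ x in Metric.ball (0 : E N) R, f x * η x) :
    (∀ᵐ x ∂(volume.restrict (Metric.ball (0 : E N) R)), 0 ≤ u x) ∧
    (¬ f =ᵐ[volume.restrict (Metric.ball (0 : E N) R)] 0 →
      ∀ᵐ x ∂(volume.restrict (Metric.ball (0 : E N) R)), 0 < u x) := by
  set B := Metric.ball (0 : E N) R with hB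
  have hBfin : IsFiniteMeasure (volume.restrict B) := ⟨by simpa using measure_ball_lt_top⟩
  set p := stdProfile N
  have hM : 0 < ∫ z : E N, p.kernel k z :=
    p.integral_kernel_pos zero_le_one (stdProfile_integral_pos hN) k
  set M := ∫ z : E N, p.kernel k z
  set ε : ℕ → ℝ := fun j => 1 / ((j : ℝ) + 1)
  have hε0 : ∀ j, 0 < ε j := fun j => by positivity
  have hεt : Tendsto ε atTop (𝓝 0) := tendsto_one_div_add_atTop_nhds_zero_nat
  have hui : Integrable (B.indicator u) volume :=
    (integrable_indicator_iff measurableSet_ball).2 (h.memLp.integrable one_le_two)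
  have hconv := ae_tendsto_integral_kernel (p.contDiff_kernel k).continuous
    (fun z hz => p.kernel_eq_zero k hz) hM.ne' hui.locallyIntegrable hε0 hεt
  -- the representation formula
  have hrep : ∀ y ∈ B, ∀ δ (hδ : 0 < δ), δ < R - ‖y‖ →
      ∫ x, B.indicator u x * ((δ ^ N)⁻¹ * p.kernel k (δ⁻¹ • (x - y))) =
        ∫ x in B, f x * boggio (p.scale hδ).Φ y (1 - ‖y‖ ^ 2 / R ^ 2) R k x := by
    intro y hy δ hδ hδ'
    have hyR : ‖y‖ < R := mem_ball_zero_iff.1 hy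
    have hκ : ‖y‖ ^ 2 = (1 - (1 - ‖y‖ ^ 2 / R ^ 2)) * R ^ 2 := by field_simp; ring
    obtain ⟨g, hg, hbg⟩ := boggio_eq_pow_mul (p.scale hδ).contDiff_Φ y (1 - ‖y‖ ^ 2 / R ^ 2) R k
    rw [← h.integral_mul_iterLaplacian_of_ball hR hf heq hg hbg]
    simp_rw [← p.kernel_scale hδ]
    rw [← integral_const_mul, ← integral_indicator measurableSet_ball]
    congr 1
    funext x
    by_cases hx : x ∈ B
    · rw [indicator_of_mem hx, indicator_of_mem hx,
        ← iterLaplacian_boggio (p.scale hδ) hR hκ hyR.le (by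
          rw [mul_one]; exact pow_lt_pow_left₀ hδ' hδ.le two_ne_zero) k x hx]
      ring
    · rw [indicator_of_notMem hx, zero_mul]
      exact (indicator_of_notMem hx _).symm
  have hκpos : ∀ y ∈ B, 0 < 1 - ‖y‖ ^ 2 / R ^ 2 := by
    intro y hy
    have hyR : ‖y‖ < R := mem_ball_zero_iff.1 hy
    rw [sub_pos, div_lt_one (by positivity)]
    exact pow_lt_pow_left₀ hyR (norm_nonneg _) two_ne_zero
  have hbm : ∀ y δ (hδ : 0 < δ), MemLp (boggio (p.scale hδ).Φ y (1 - ‖y‖ ^ 2 / R ^ 2) R k) 2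
      (volume.restrict B) := fun y δ hδ => memLp_restrict_of_continuous Metric.isBounded_ball
    (contDiff_boggio y _ R k (p.scale hδ).contDiff_Φ).continuous
  -- a lower bound for the limit
  have hlow : ∀ᵐ y ∂(volume.restrict B), ∀ δ (hδ : 0 < δ), δ < R - ‖y‖ →
      ∫ x in B, f x * boggio (p.scale hδ).Φ y (1 - ‖y‖ ^ 2 / R ^ 2) R k x ≤ u y * M := by
    filter_upwards [ae_restrict_of_ae hconv, ae_restrict_mem measurableSet_ball]
      with y hy hyB δ hδ hδ'
    rw [indicator_of_mem hyB] at hy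
    refine ge_of_tendsto hy ?_
    filter_upwards [hεt.eventually (gt_mem_nhds hδ)] with j hj
    rw [hrep y hyB (ε j) (hε0 j) (lt_trans hj hδ')]
    refine integral_mono_ae (hf.integrable_mul (hbm y δ hδ))
      (hf.integrable_mul (hbm y _ (hε0 j))) ?_
    filter_upwards [hf0, ae_restrict_mem measurableSet_ball] with x hx hxB
    exact mul_le_mul_of_nonneg_left (boggio_mono (p.scale hδ).contDiff_Φ.continuous
      (p.scale (hε0 j)).contDiff_Φ.continuous
      (fun s hs => stdProfile_scale_Φ_anti (hε0 j) (le_of_lt hj) hs) (hκpos y hyB).le k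
      (mem_ball_zero_iff.1 hxB).le) hx
  have hhalf : ∀ y ∈ B, 0 < (R - ‖y‖) / 2 ∧ (R - ‖y‖) / 2 < R - ‖y‖ := fun y hy => by
    have := mem_ball_zero_iff.1 hy
    constructor <;> linarith
  refine ⟨?_, fun hne => ?_⟩
  · filter_upwards [hlow, ae_restrict_mem measurableSet_ball] with y hy hyB
    have h1 := hy _ (hhalf y hyB).1 (hhalf y hyB).2
    refine nonneg_of_mul_nonneg_left (le_trans ?_ h1) hM
    refine integral_nonneg_of_ae ?_
    filter_upwards [hf0, ae_restrict_mem measurableSet_ball] with x hx hxB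
    exact mul_nonneg hx (boggio_nonneg (stdProfile_scale_Φ_nonneg _) (hκpos y hyB).le k
      (mem_ball_zero_iff.1 hxB).le)
  · filter_upwards [hlow, ae_restrict_mem measurableSet_ball] with y hy hyB
    have hyR : ‖y‖ < R := mem_ball_zero_iff.1 hyB
    have hδ := (hhalf y hyB).1
    have h1 := hy _ hδ (hhalf y hyB).2
    have hbpos : ∀ x ∈ B, 0 < boggio (p.scale hδ).Φ y (1 - ‖y‖ ^ 2 / R ^ 2) R k x := by
      intro x hx
      refine boggio_pos (p.scale hδ).contDiff_Φ.continuous (stdProfile_scale_Φ_nonneg _)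
        (hκpos y hyB) k (mem_ball_zero_iff.1 hx) (stdProfile_scale_Φ_pos hδ ?_)
      have hκ : ‖y‖ ^ 2 = (1 - (1 - ‖y‖ ^ 2 / R ^ 2)) * R ^ 2 := by field_simp; ring
      have h2 := sq_sub_norm_le_quad hR hκ hyR.le (mem_ball_zero_iff.1 hx).le
      rw [normSq_sub_eq hκ]
      refine (pow_le_pow_left₀ hδ.le (hhalf y hyB).2.le 2).trans (h2.trans (le_of_eq ?_))
      simp only [quad]
      ring
    have hnn : 0 ≤ᵐ[volume.restrict B] fun x =>
        f x * boggio (p.scale hδ).Φ y (1 - ‖y‖ ^ 2 / R ^ 2) R k x := by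
      filter_upwards [hf0, ae_restrict_mem measurableSet_ball] with x hx hxB
      exact mul_nonneg hx (hbpos x hxB).le
    have h3 : 0 < ∫ x in B, f x * boggio (p.scale hδ).Φ y (1 - ‖y‖ ^ 2 / R ^ 2) R k x := by
      refine lt_of_le_of_ne (integral_nonneg_of_ae hnn) fun h0 => hne ?_
      have h4 := (integral_eq_zero_iff_of_nonneg_ae hnn (hf.integrable_mul (hbm y _ hδ))).1 h0.symm
      filter_upwards [h4, ae_restrict_mem measurableSet_ball] with x hx hxB
      exact (mul_eq_zero.1 hx).resolve_right (hbpos x hxB).ne'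
    exact pos_of_mul_pos_left (h3.trans_le h1) hM.le

/-! ### Energy limits: linear structure and existence -/

section

variable {m : ℕ} {Ω : Set (E N)}

theorem energyForm_add_self {a b : E N → ℝ} (ha : IsTestFunction Ω a) (hb : IsTestFunction Ω b)
    (m : ℕ) : energyForm m (fun x => a x + b x) (fun x => a x + b x) =
      energyForm m a a + 2 * energyForm m a b + energyForm m b b := by
  rw [energyForm_add_left (ha.add hb) ha hb, energyForm_add_right ha ha hb,
    energyForm_add_right hb ha hb, energyForm_comm hb ha]
  ring

theorem energyForm_const_mul_self {a : E N → ℝ} (ha : IsTestFunction Ω a) (c : ℝ) (m : ℕ) :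
    energyForm m (fun x => c * a x) (fun x => c * a x) = c ^ 2 * energyForm m a a := by
  rw [energyForm_const_mul_left, energyForm_const_mul_right ha]
  ring

theorem energyForm_add_self_le {a b : E N → ℝ} (ha : IsTestFunction Ω a)
    (hb : IsTestFunction Ω b) (m : ℕ) :
    energyForm m (fun x => a x + b x) (fun x => a x + b x) ≤
      2 * energyForm m a a + 2 * energyForm m b b := by
  have h := energyForm_self_nonneg (ha.add (hb.const_mul (-1))) m
  rw [energyForm_add_self ha (hb.const_mul _), energyForm_const_mul_right hb,
    energyForm_const_mul_self hb] at h
  rw [energyForm_add_self ha hb]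
  linarith

theorem IsTestFunction.setIntegral_sq {φ : E N → ℝ} (h : IsTestFunction Ω φ) :
    ∫ x in Ω, φ x ^ 2 = ∫ x, φ x ^ 2 := by
  have := h.setIntegral_mul φ
  simpa only [sq] using this

namespace EnergyApprox

variable {φ ψ : ℕ → E N → ℝ} {u v : E N → ℝ}

theorem congr (h : EnergyApprox m Ω φ u) (huv : u =ᵐ[volume.restrict Ω] v) :
    EnergyApprox m Ω φ v where
  test := h.test
  memLp := h.memLp.ae_eq huv
  tendsto := h.tendsto.congr fun k => eLpNorm_congr_ae (by
    filter_upwards [huv] with x hx using by simp [hx])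
  cauchy := h.cauchy

theorem add (hu : EnergyApprox m Ω φ u) (hv : EnergyApprox m Ω ψ v) :
    EnergyApprox m Ω (fun k x => φ k x + ψ k x) (fun x => u x + v x) where
  test k := (hu.test k).add (hv.test k)
  memLp := hu.memLp.add hv.memLp
  tendsto := by
    have h := hu.tendsto.add hv.tendsto
    rw [add_zero] at h
    refine tendsto_of_tendsto_of_tendsto_of_le_of_le tendsto_const_nhds h (fun _ => zero_le)
      fun k => ?_
    have := eLpNorm_add_le (((hu.test k).memLp_restrict.sub hu.memLp).1)
      (((hv.test k).memLp_restrict.sub hv.memLp).1) one_le_two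
    refine le_trans (le_of_eq ?_) this
    congr 1
    funext x
    simp only [Pi.sub_apply, Pi.add_apply]
    ring
  cauchy := by
    obtain ⟨ε, hε, h1⟩ := hu.cauchy
    obtain ⟨ε', hε', h2⟩ := hv.cauchy
    refine ⟨fun k => 2 * ε k + 2 * ε' k, by simpa using (hε.const_mul 2).add (hε'.const_mul 2),
      fun k l hkl => ?_⟩
    have h3 := energyForm_add_self_le ((hu.test k).sub (hu.test l))
      ((hv.test k).sub (hv.test l)) m
    have h4 : (fun x => φ k x + ψ k x - (φ l x + ψ l x)) =
        fun x => φ k x - φ l x + (ψ k x - ψ l x) := by funext x; ring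
    rw [h4]
    linarith [h1 k l hkl, h2 k l hkl]

theorem const_mul (hu : EnergyApprox m Ω φ u) (c : ℝ) :
    EnergyApprox m Ω (fun k x => c * φ k x) (fun x => c * u x) where
  test k := (hu.test k).const_mul c
  memLp := hu.memLp.const_mul c
  tendsto := by
    have h := ENNReal.Tendsto.const_mul (a := ‖c‖ₑ) hu.tendsto (Or.inr (by simp))
    rw [mul_zero] at h
    refine h.congr fun k => ?_
    rw [← eLpNorm_const_smul]
    congr 1
    funext x
    simp only [Pi.sub_apply, Pi.smul_apply, smul_eq_mul]
    ring
  cauchy := by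
    obtain ⟨ε, hε, h1⟩ := hu.cauchy
    refine ⟨fun k => c ^ 2 * ε k, by simpa using hε.const_mul (c ^ 2), fun k l hkl => ?_⟩
    have h4 : (fun x => c * φ k x - c * φ l x) = fun x => c * (φ k x - φ l x) := by
      funext x; ring
    rw [h4, energyForm_const_mul_self ((hu.test k).sub (hu.test l))]
    exact mul_le_mul_of_nonneg_left (h1 k l hkl) (sq_nonneg c)

theorem exists_energy_le (hu : EnergyApprox m Ω φ u) :
    ∃ C, ∀ k, energyForm m (φ k) (φ k) ≤ C := by
  obtain ⟨ε, -, h⟩ := hu.cauchy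
  refine ⟨2 * energyForm m (φ 0) (φ 0) + 2 * ε 0, fun k => ?_⟩
  have h1 := energyForm_add_self_le (hu.test 0)
    (((hu.test 0).sub (hu.test k)).const_mul (-1)) m
  have h2 : (fun x => φ 0 x + -1 * (φ 0 x - φ k x)) = φ k := by funext x; ring
  rw [h2, energyForm_const_mul_self ((hu.test 0).sub (hu.test k))] at h1
  linarith [h 0 k (Nat.zero_le _)]

/-- The energies of the approximations of a weak solution of `(-Δ)^m u = f` converge to
`∫ f u`. -/
theorem tendsto_energy (hu : EnergyApprox m Ω φ u) {f : E N → ℝ}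
    (hf : MemLp f 2 (volume.restrict Ω))
    (heq : ∀ η, IsTestFunction Ω η → weakForm m Ω u η = ∫ x in Ω, f x * η x) :
    Tendsto (fun k => energyForm m (φ k) (φ k)) atTop (𝓝 (∫ x in Ω, f x * u x)) := by
  obtain ⟨C, hC⟩ := hu.exists_energy_le
  obtain ⟨ε, hε, hε0, hrate⟩ := hu.exists_rate
  have h1 : Tendsto (fun k => weakForm m Ω u (φ k)) atTop (𝓝 (∫ x in Ω, f x * u x)) := by
    simp_rw [heq _ (hu.test _), mul_comm (f _)]
    exact hu.tendsto_integral_mul hf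
  have h2 : Tendsto (fun k => energyForm m (φ k) (φ k) - weakForm m Ω u (φ k)) atTop (𝓝 0) := by
    have h3 : Tendsto (fun k => √(ε k * C)) atTop (𝓝 0) := by
      simpa using (hε.mul_const C).sqrt
    refine squeeze_zero_norm (fun k => ?_) h3
    exact Real.abs_le_sqrt ((hrate k _ (hu.test k)).trans
      (mul_le_mul_of_nonneg_left (hC k) (hε0 k)))
  simpa using h2.add h1

/-- A Poincaré inequality for test functions passes to weak solutions. -/
theorem mul_integral_sq_le (hu : EnergyApprox m Ω φ u) {f : E N → ℝ}
    (hf : MemLp f 2 (volume.restrict Ω))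
    (heq : ∀ η, IsTestFunction Ω η → weakForm m Ω u η = ∫ x in Ω, f x * η x) {c : ℝ}
    (hc : ∀ η, IsTestFunction Ω η → c * ∫ x, η x ^ 2 ≤ energyForm m η η) :
    c * ∫ x in Ω, u x ^ 2 ≤ ∫ x in Ω, f x * u x := by
  have h1 := (tendsto_integral_mul_of_tendsto (fun k => (hu.test k).memLp_restrict)
    (fun k => (hu.test k).memLp_restrict) hu.memLp hu.memLp hu.tendsto hu.tendsto).const_mul c
  simp only [← sq] at h1
  refine le_of_tendsto_of_tendsto' h1 (hu.tendsto_energy hf heq) fun k => ?_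
  rw [(hu.test k).setIntegral_sq]
  exact hc _ (hu.test k)

end EnergyApprox

/-- Under a Poincaré inequality, `(-Δ)^m u = f` has a weak solution with Dirichlet boundary
conditions: a limit of test functions minimising `φ ↦ ∫ |D̃^m φ|² - 2 ∫ f φ`. -/
theorem exists_energyApprox {c : ℝ} (hc0 : 0 < c)
    (hc : ∀ η, IsTestFunction Ω η → c * ∫ x, η x ^ 2 ≤ energyForm m η η) {f : E N → ℝ}
    (hf : MemLp f 2 (volume.restrict Ω)) :
    ∃ φ u, EnergyApprox m Ω φ u ∧
      ∀ η, IsTestFunction Ω η → weakForm m Ω u η = ∫ x in Ω, f x * η x := by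
  set F : (E N → ℝ) → ℝ := fun φ => energyForm m φ φ - 2 * ∫ x in Ω, f x * φ x with hF
  set S : Set ℝ := {q | ∃ φ, IsTestFunction Ω φ ∧ q = F φ} with hS
  have hSne : S.Nonempty := ⟨_, 0, IsTestFunction.zero, rfl⟩
  have hSb : BddBelow S := by
    refine ⟨-(‖hf.toLp f‖ ^ 2 / c), ?_⟩
    rintro q ⟨φ, hφ, rfl⟩
    have h1 := abs_integral_mul_le_norm hf hφ.memLp_restrict
    have h2 := hc φ hφ
    rw [← hφ.setIntegral_sq, ← norm_toLp_sq hφ.memLp_restrict] at h2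
    have h3 : 2 * (‖hf.toLp f‖ * ‖hφ.memLp_restrict.toLp φ‖) ≤
        ‖hf.toLp f‖ ^ 2 / c + c * ‖hφ.memLp_restrict.toLp φ‖ ^ 2 := by
      have h4 : ‖hf.toLp f‖ ^ 2 / c + c * ‖hφ.memLp_restrict.toLp φ‖ ^ 2 -
          2 * (‖hf.toLp f‖ * ‖hφ.memLp_restrict.toLp φ‖) =
          (‖hf.toLp f‖ - c * ‖hφ.memLp_restrict.toLp φ‖) ^ 2 / c := by field_simp; ring
      have : 0 ≤ (‖hf.toLp f‖ - c * ‖hφ.memLp_restrict.toLp φ‖) ^ 2 / c := by positivity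
      linarith
    have h5 := le_abs_self (∫ x in Ω, f x * φ x)
    simp only [hF]
    linarith
  have hex : ∀ k : ℕ, ∃ φ, IsTestFunction Ω φ ∧ F φ < sInf S + 1 / ((k : ℝ) + 1) := by
    intro k
    obtain ⟨q, ⟨φ, hφ, rfl⟩, h⟩ := exists_lt_of_csInf_lt hSne
      (lt_add_of_pos_right (sInf S) (by positivity : (0 : ℝ) < 1 / ((k : ℝ) + 1)))
    exact ⟨φ, hφ, h⟩
  choose φ hφ hφF using hex
  -- the first variation at `φ k` almost vanishes
  have hvar : ∀ k η, IsTestFunction Ω η → (energyForm m (φ k) η - ∫ x in Ω, f x * η x) ^ 2 ≤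
      energyForm m η η * (1 / ((k : ℝ) + 1)) := by
    intro k η hη
    have h := discrim_le_zero (a := energyForm m η η)
      (b := 2 * (energyForm m (φ k) η - ∫ x in Ω, f x * η x)) (c := 1 / ((k : ℝ) + 1)) fun t => by
      have h1 : sInf S ≤ F (fun x => φ k x + t * η x) :=
        csInf_le hSb ⟨_, (hφ k).add (hη.const_mul t), rfl⟩
      have h2 := hφF k
      have h3 : ∫ x in Ω, f x * (φ k x + t * η x) =
          (∫ x in Ω, f x * φ k x) + t * ∫ x in Ω, f x * η x := by
        simp_rw [mul_add, mul_left_comm _ t]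
        rw [← integral_const_mul]
        exact integral_add (hf.integrable_mul (hφ k).memLp_restrict)
          ((hf.integrable_mul hη.memLp_restrict).const_mul t)
      simp only [hF] at h1 h2
      rw [energyForm_add_self (hφ k) (hη.const_mul t), energyForm_const_mul_right hη,
        energyForm_const_mul_self hη, h3] at h1
      linarith
    rw [discrim] at h
    linarith
  have hcau : ∀ K k l : ℕ, K ≤ k → K ≤ l →
      energyForm m (fun x => φ k x - φ l x) (fun x => φ k x - φ l x) ≤
        4 * (1 / ((K : ℝ) + 1)) := by
    intro K k l hk hl
    have hη := (hφ k).sub (hφ l)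
    have h0 := energyForm_self_nonneg hη m
    have h1 := hvar k _ hη
    have h2 := hvar l _ hη
    have h3 := energyForm_sub_left (hφ k) (hφ l) hη m
    set e := energyForm m (fun x => φ k x - φ l x) (fun x => φ k x - φ l x)
    have h4 : 1 / ((k : ℝ) + 1) ≤ 1 / ((K : ℝ) + 1) :=
      one_div_le_one_div_of_le (by positivity) (by exact_mod_cast Nat.succ_le_succ hk)
    have h5 : 1 / ((l : ℝ) + 1) ≤ 1 / ((K : ℝ) + 1) :=
      one_div_le_one_div_of_le (by positivity) (by exact_mod_cast Nat.succ_le_succ hl)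
    have h6 := mul_le_mul_of_nonneg_left h4 h0
    have h7 := mul_le_mul_of_nonneg_left h5 h0
    set a := energyForm m (φ k) (fun x => φ k x - φ l x)
    set b := energyForm m (φ l) (fun x => φ k x - φ l x)
    set i := ∫ x in Ω, f x * (φ k x - φ l x)
    have h8 : e * e ≤ e * (4 * (1 / ((K : ℝ) + 1))) := by
      have h9 : e = (a - i) - (b - i) := by rw [h3]; ring
      have h10 : e * e = ((a - i) - (b - i)) ^ 2 := by rw [← h9, sq]
      have := sq_nonneg ((a - i) + (b - i))
      linarith
    rcases h0.eq_or_lt with h | h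
    · rw [← h]; positivity
    · exact le_of_mul_le_mul_left h8 h
  have hnorm : ∀ K k l : ℕ, K ≤ k → K ≤ l → dist ((hφ k).memLp_restrict.toLp (φ k))
      ((hφ l).memLp_restrict.toLp (φ l)) ≤ √(4 * (1 / ((K : ℝ) + 1)) / c) := by
    intro K k l hk hl
    refine Real.le_sqrt_of_sq_le ?_
    rw [dist_eq_norm, ← MemLp.toLp_sub, norm_toLp_sq, le_div_iff₀' hc0]
    refine le_trans ?_ (hcau K k l hk hl)
    refine le_trans ?_ (hc _ ((hφ k).sub (hφ l)))
    rw [← ((hφ k).sub (hφ l)).setIntegral_sq]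
    rfl
  have h0 : Tendsto (fun K : ℕ => 1 / ((K : ℝ) + 1)) atTop (𝓝 0) :=
    tendsto_one_div_add_atTop_nhds_zero_nat
  have hseq : CauchySeq fun k => (hφ k).memLp_restrict.toLp (φ k) := by
    refine cauchySeq_of_le_tendsto_0 _ (fun n m N => hnorm N n m) ?_
    simpa using ((h0.const_mul 4).div_const c).sqrt
  obtain ⟨u, hu⟩ := cauchySeq_tendsto_of_complete hseq
  have happ : EnergyApprox m Ω φ u :=
    { test := hφ
      memLp := Lp.memLp u
      tendsto := by
        refine (Lp.tendsto_Lp_iff_tendsto_eLpNorm'' φ (fun k => (hφ k).memLp_restrict) u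
          (Lp.memLp u)).1 ?_
        simpa only [Lp.toLp_coeFn] using hu
      cauchy := ⟨_, by simpa using h0.const_mul 4, fun k l hkl => hcau k k l le_rfl hkl⟩ }
  refine ⟨φ, u, happ, fun η hη => ?_⟩
  have h1 := ((happ.tendsto_energyForm hη).sub_const (∫ x in Ω, f x * η x)).pow 2
  have h2 := le_of_tendsto_of_tendsto' h1 (h0.const_mul (energyForm m η η)) fun k => hvar k η hη
  rw [mul_zero] at h2
  exact sub_eq_zero.1 (pow_eq_zero_iff two_ne_zero |>.1 (le_antisymm h2 (sq_nonneg _)))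

/-! ### The first eigenvalue -/

theorem firstEigenvalue_nonneg (m : ℕ) (Ω : Set (E N)) : 0 ≤ firstEigenvalue m Ω := by
  refine Real.sInf_nonneg ?_
  rintro q ⟨φ, -, -, rfl⟩
  exact div_nonneg (dirichletEnergy_nonneg m φ) (integral_nonneg fun x => sq_nonneg _)

theorem firstEigenvalue_mul_le {η : E N → ℝ} (hη : IsTestFunction Ω η) :
    firstEigenvalue m Ω * ∫ x, η x ^ 2 ≤ energyForm m η η := by
  rw [energyForm_self hη]
  by_cases h0 : η = 0
  · subst h0
    simpa using dirichletEnergy_nonneg m (0 : E N → ℝ)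
  have hpos : 0 < ∫ x, η x ^ 2 := by
    obtain ⟨x, hx⟩ := Function.ne_iff.1 h0
    refine (hη.continuous.pow 2).integral_pos_of_hasCompactSupport_nonneg_nonzero ?_
      (fun x => sq_nonneg _) (x := x) (pow_ne_zero 2 hx)
    exact hη.2.1.comp_left (g := fun t : ℝ => t ^ 2) (by simp)
  rw [← le_div_iff₀ hpos]
  refine csInf_le ⟨0, ?_⟩ ⟨η, hη, h0, rfl⟩
  rintro q ⟨φ, -, -, rfl⟩
  exact div_nonneg (dirichletEnergy_nonneg m φ) (integral_nonneg fun x => sq_nonneg _)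

end

/-! ### Elements of `H^m_0(Ω)` as energy limits -/

section

variable {m : ℕ} {Ω : Set (E N)}

namespace SobolevJet

/-- The function underlying a jet, as an element of `L²`. -/
noncomputable def toLp (N m : ℕ) : SobolevJet N m →L[ℝ] Lp ℝ 2 (volume : Measure (E N)) :=
  ((ContinuousMultilinearMap.apply ℝ (fun _ : Fin ((0 : Fin (m + 1)) : ℕ) => E N) ℝ
    (fun _ => 0)).compLpL 2 volume).comp (ContinuousLinearMap.proj 0)

theorem coeFn_toLp (F : SobolevJet N m) : toLp N m F =ᵐ[volume] F.toFun :=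
  ContinuousLinearMap.coeFn_compLpL _ (F 0)

theorem memLp_toFun (F : SobolevJet N m) : MemLp F.toFun 2 (volume : Measure (E N)) :=
  (Lp.memLp (toLp N m F)).ae_eq F.coeFn_toLp

/-- Integration against a fixed function in `L²(Ω)` is a continuous functional on jets. -/
theorem exists_clm_integral_mul (hΩ : MeasurableSet Ω) {g : E N → ℝ}
    (hg : MemLp g 2 (volume.restrict Ω)) :
    ∃ L : SobolevJet N m →L[ℝ] ℝ, ∀ F, L F = ∫ x in Ω, F.toFun x * g x := by
  have hg' : MemLp (Ω.indicator g) 2 (volume : Measure (E N)) :=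
    (memLp_indicator_iff_restrict hΩ).2 hg
  refine ⟨(innerSL ℝ (hg'.toLp _)).comp (toLp N m), fun F => ?_⟩
  rw [ContinuousLinearMap.comp_apply, innerSL_apply_apply, L2.inner_def,
    ← integral_indicator hΩ]
  refine integral_congr_ae ?_
  filter_upwards [hg'.coeFn_toLp, F.coeFn_toLp] with x h1 h2
  rw [h1, h2, real_inner_eq_re_inner]
  by_cases hx : x ∈ Ω <;> simp [hx]

variable {φ : E N → ℝ} {F : SobolevJet N m}

theorem toFun_ae_eq (hF : F 0 =ᵐ[volume] iteratedFDeriv ℝ ((0 : Fin (m + 1)) : ℕ) φ) :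
    F.toFun =ᵐ[volume] φ := by
  filter_upwards [hF] with x hx
  rw [toFun, hx]
  rfl

theorem energyForm_self_le (hφ : IsTestFunction Ω φ)
    (hF : F (Fin.last m) =ᵐ[volume] iteratedFDeriv ℝ ((Fin.last m : Fin (m + 1)) : ℕ) φ) :
    energyForm m φ φ ≤ ((N : ℝ) ^ (m / 2)) ^ 2 * ‖F‖ ^ 2 := by
  rw [energyForm_self hφ]
  refine (dirichletEnergy_le_integral hφ m).trans ?_
  refine mul_le_mul_of_nonneg_left ?_ (by positivity)
  have h1 : ‖F (Fin.last m)‖ ^ 2 = ∫ x, ‖iteratedFDeriv ℝ m φ x‖ ^ 2 := by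
    rw [Lp.norm_def, (Lp.memLp _).eLpNorm_eq_integral_rpow_norm two_ne_zero ENNReal.ofNat_ne_top,
      ENNReal.toReal_ofReal (by positivity)]
    have h2 : ∫ x, ‖F (Fin.last m) x‖ ^ (2 : ENNReal).toReal =
        ∫ x, ‖iteratedFDeriv ℝ m φ x‖ ^ 2 := by
      refine integral_congr_ae ?_
      filter_upwards [hF] with x hx
      rw [hx]
      simp
    rw [h2, ← Real.rpow_natCast, ← Real.rpow_mul (integral_nonneg fun x => by positivity)]
    norm_num
  rw [← h1]
  exact pow_le_pow_left₀ (norm_nonneg _) (norm_le_pi_norm F _) 2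

end SobolevJet

theorem MemH0.exists_energyApprox {u : E N → ℝ} (hu : MemH0 m Ω u) :
    ∃ φ, EnergyApprox m Ω φ u := by
  obtain ⟨F, hF, hFu⟩ := hu
  obtain ⟨G, hG, hGF⟩ := mem_closure_iff_seq_limit.1 hF
  choose φ hφ hjet using hG
  refine ⟨φ, EnergyApprox.congr (u := F.toFun) ?_ hFu⟩
  refine ⟨hφ, F.memLp_toFun.restrict Ω, ?_, ?_⟩
  · have h1 := ((SobolevJet.toLp N m).continuous.tendsto F).comp hGF
    have h2 := (Lp.tendsto_Lp_iff_tendsto_eLpNorm' _ _).1 h1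
    refine tendsto_of_tendsto_of_tendsto_of_le_of_le tendsto_const_nhds h2 (fun _ => zero_le)
      fun k => ?_
    refine (eLpNorm_mono_measure _ Measure.restrict_le_self).trans (le_of_eq ?_)
    refine eLpNorm_congr_ae ?_
    filter_upwards [(G k).coeFn_toLp, F.coeFn_toLp, SobolevJet.toFun_ae_eq (hjet k 0)] with x a b c
    simp only [Pi.sub_apply, Function.comp]
    rw [a, b, c]
  · obtain ⟨b, hb0, hb, hbt⟩ := cauchySeq_iff_le_tendsto_0.1 hGF.cauchySeq
    refine ⟨fun k => ((N : ℝ) ^ (m / 2)) ^ 2 * b k ^ 2, by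
      simpa using (hbt.pow 2).const_mul (((N : ℝ) ^ (m / 2)) ^ 2), fun k l hkl => ?_⟩
    have hsub : (G k - G l) (Fin.last m) =ᵐ[volume]
        iteratedFDeriv ℝ ((Fin.last m : Fin (m + 1)) : ℕ) (fun x => φ k x - φ l x) := by
      rw [Pi.sub_apply]
      filter_upwards [Lp.coeFn_sub (G k (Fin.last m)) (G l (Fin.last m)), hjet k (Fin.last m),
        hjet l (Fin.last m)] with x a b c
      rw [a, Pi.sub_apply, b, c]
      exact (iteratedFDeriv_sub_apply
        ((hφ k).1.of_le (natCast_le_infty _)).contDiffAt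
        ((hφ l).1.of_le (natCast_le_infty _)).contDiffAt).symm
    refine (SobolevJet.energyForm_self_le ((hφ k).sub (hφ l)) hsub).trans ?_
    refine mul_le_mul_of_nonneg_left (pow_le_pow_left₀ (norm_nonneg _) ?_ 2) (by positivity)
    rw [← dist_eq_norm]
    exact hb k l k le_rfl hkl

/-- Weak solutions may be tested with elements of `H^m_0(Ω)`, with a rate of convergence which is
uniform on bounded sets. -/
theorem EnergyApprox.exists_jet_rate (hΩ : MeasurableSet Ω) {φ : ℕ → E N → ℝ} {u f : E N → ℝ}
    (hu : EnergyApprox m Ω φ u) (hf : MemLp f 2 (volume.restrict Ω))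
    (heq : ∀ η, IsTestFunction Ω η → weakForm m Ω u η = ∫ x in Ω, f x * η x) :
    ∃ ε : ℕ → ℝ, Tendsto ε atTop (𝓝 0) ∧ ∀ k, ∀ F ∈ sobolevH0 m Ω,
      |weakForm m Ω F.toFun (φ k) - ∫ x in Ω, F.toFun x * f x| ≤ ε k * ‖F‖ := by
  obtain ⟨ε, hε, hε0, hrate⟩ := hu.exists_rate
  refine ⟨fun k => √(ε k * ((N : ℝ) ^ (m / 2)) ^ 2), by
    simpa using (hε.mul_const (((N : ℝ) ^ (m / 2)) ^ 2)).sqrt, fun k F hF => ?_⟩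
  obtain ⟨L₁, hL₁⟩ := SobolevJet.exists_clm_integral_mul (m := m) hΩ
    ((hu.test k).iterLaplacian m).memLp_restrict
  obtain ⟨L₂, hL₂⟩ := SobolevJet.exists_clm_integral_mul (m := m) hΩ hf
  rw [← hL₂, weakForm, ← hL₁]
  have hcl : IsClosed {F : SobolevJet N m |
      |(-1) ^ m * L₁ F - L₂ F| ≤ √(ε k * ((N : ℝ) ^ (m / 2)) ^ 2) * ‖F‖} :=
    isClosed_le (by fun_prop) (by fun_prop)
  refine closure_minimal ?_ hcl hF
  rintro G ⟨η, hη, hjet⟩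
  have hG : G.toFun =ᵐ[volume.restrict Ω] η :=
    ae_restrict_of_ae (SobolevJet.toFun_ae_eq (hjet 0))
  have h1 : (-1) ^ m * L₁ G = energyForm m (φ k) η := by
    rw [energyForm_comm (hu.test k) hη, ← weakForm_eq_energyForm (hu.test k), weakForm, hL₁]
    congr 1
    exact integral_congr_ae (by filter_upwards [hG] with x hx using by rw [hx])
  have h2 : L₂ G = weakForm m Ω u η := by
    rw [hL₂, heq η hη]
    exact integral_congr_ae (by filter_upwards [hG] with x hx using by rw [hx, mul_comm])
  rw [mem_ofPred_eq, h1, h2]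
  refine abs_le_of_sq_le_sq ?_ (by positivity)
  rw [mul_pow, Real.sq_sqrt (mul_nonneg (hε0 k) (by positivity)), mul_assoc]
  exact (hrate k η hη).trans
    (mul_le_mul_of_nonneg_left (SobolevJet.energyForm_self_le hη (hjet _)) (hε0 k))

end

/-! ### First eigenfunctions in balls -/

section

variable {m : ℕ} {Ω : Set (E N)}

theorem weakForm_const_mul (u : E N → ℝ) (c : ℝ) (η : E N → ℝ) :
    weakForm m Ω (fun x => c * u x) η = c * weakForm m Ω u η := by
  simp only [weakForm, mul_assoc, integral_const_mul]
  ring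

theorem weakForm_add {u v η : E N → ℝ} (hu : MemLp u 2 (volume.restrict Ω))
    (hv : MemLp v 2 (volume.restrict Ω)) (hη : IsTestFunction Ω η) :
    weakForm m Ω (fun x => u x + v x) η = weakForm m Ω u η + weakForm m Ω v η := by
  have h := (hη.iterLaplacian m).memLp_restrict
  simp only [weakForm, add_mul]
  rw [← mul_add]
  congr 1
  exact integral_add (hu.integrable_mul h) (hv.integrable_mul h)

theorem integral_add_mul {u v η : E N → ℝ} (hu : MemLp u 2 (volume.restrict Ω))
    (hv : MemLp v 2 (volume.restrict Ω)) (hη : MemLp η 2 (volume.restrict Ω)) :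
    ∫ x in Ω, (u x + v x) * η x = (∫ x in Ω, u x * η x) + ∫ x in Ω, v x * η x := by
  simp only [add_mul]
  exact integral_add (hu.integrable_mul hη) (hv.integrable_mul hη)

theorem IsFirstEigenfunction.weakForm_eq {e : E N → ℝ} (he : IsFirstEigenfunction m Ω e)
    {η : E N → ℝ} (hη : IsTestFunction Ω η) :
    weakForm m Ω e η = ∫ x in Ω, firstEigenvalue m Ω * e x * η x := by
  simp only [weakForm, mul_assoc, integral_const_mul]
  exact he.eigen η hη

theorem IsFirstEigenfunction.memLp {e : E N → ℝ} (he : IsFirstEigenfunction m Ω e) :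
    MemLp e 2 (volume.restrict Ω) :=
  he.memH0.exists_energyApprox.choose_spec.memLp

end

/-- First eigenfunctions of a ball have a sign: by Boggio's theorem the solution `g` of
`(-Δ)^m g = λ₁|e|` satisfies `g ≥ |e|`, and the Rayleigh quotient forces `g = |e|`, so that
Boggio's theorem applies to `|e| + e` and to `|e| - e`. -/
theorem IsFirstEigenfunction.ae_pos_or_ae_neg_of_ball (hN : 1 ≤ N) {m : ℕ} (hm : 1 ≤ m) {R : ℝ}
    (hR : 0 < R) {e : E N → ℝ} (he : IsFirstEigenfunction m (Metric.ball (0 : E N) R) e) :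
    (∀ᵐ x ∂(volume.restrict (Metric.ball (0 : E N) R)), 0 < e x) ∨
    (∀ᵐ x ∂(volume.restrict (Metric.ball (0 : E N) R)), e x < 0) := by
  obtain ⟨k, rfl⟩ : ∃ k, m = k + 1 := ⟨m - 1, by omega⟩
  obtain ⟨φ, happ⟩ := he.memH0.exists_energyApprox
  have heq := fun η (hη : IsTestFunction (Metric.ball (0 : E N) R) η) => he.weakForm_eq hη
  set B := Metric.ball (0 : E N) R with hB
  set lam := firstEigenvalue (k + 1) B with hlam
  have hem := happ.memLp
  -- `λ₁ ≠ 0`, since otherwise both `e` and `-e` are nonnegative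
  have hpos : 0 < lam := by
    refine lt_of_le_of_ne (firstEigenvalue_nonneg _ _) fun h0 => he.ne_zero ?_
    have h1 := (happ.nonneg_and_pos_of_ball hN hR (f := fun _ => 0) MemLp.zero
      (ae_of_all _ fun _ => le_rfl) fun η hη => by rw [heq η hη, ← h0]; simp).1
    have h2 := ((happ.const_mul (-1)).nonneg_and_pos_of_ball hN hR (f := fun _ => 0) MemLp.zero
      (ae_of_all _ fun _ => le_rfl) fun η hη => by
        rw [weakForm_const_mul, heq η hη, ← h0]; simp).1
    filter_upwards [h1, h2] with x h1 h2
    change e x = 0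
    linarith
  have hfm : MemLp (fun x => lam * |e x|) 2 (volume.restrict B) := hem.abs.const_mul lam
  obtain ⟨ψ, g, hg, hgeq⟩ := exists_energyApprox hpos
    (fun η hη => firstEigenvalue_mul_le hη) hfm
  have key : ∀ s : ℝ, |s| = 1 → (∀ᵐ x ∂(volume.restrict B), 0 ≤ g x + s * e x) ∧
      (¬ (fun x => lam * |e x| + s * (lam * e x)) =ᵐ[volume.restrict B] 0 →
        ∀ᵐ x ∂(volume.restrict B), 0 < g x + s * e x) := by
    intro s hs
    refine (hg.add (happ.const_mul s)).nonneg_and_pos_of_ball hN hR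
      (hfm.add ((hem.const_mul lam).const_mul s)) (ae_of_all _ fun x => ?_) fun η hη => ?_
    · have h1 := neg_abs_le (s * e x)
      rw [abs_mul, hs, one_mul] at h1
      have h2 : lam * |e x| + s * (lam * e x) = lam * (|e x| + s * e x) := by ring
      rw [h2]
      exact mul_nonneg hpos.le (by linarith)
    · rw [weakForm_add hg.memLp (hem.const_mul s) hη, weakForm_const_mul, hgeq η hη, heq η hη]
      rw [integral_add_mul hfm ((hem.const_mul lam).const_mul s) hη.memLp_restrict]
      simp only [mul_assoc, integral_const_mul]
  obtain ⟨hp0, hp⟩ := key 1 (by simp)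
  obtain ⟨hn0, hn⟩ := key (-1) (by simp)
  have hge : ∀ᵐ x ∂(volume.restrict B), |e x| ≤ g x := by
    filter_upwards [hp0, hn0] with x h1 h2
    exact abs_le.2 ⟨by linarith, by linarith⟩
  have hgabs : ∀ᵐ x ∂(volume.restrict B), g x = |e x| := by
    have h1 := hg.mul_integral_sq_le hfm hgeq (fun η hη => firstEigenvalue_mul_le hη)
    simp only [mul_assoc, integral_const_mul] at h1
    have h2 := le_of_mul_le_mul_left h1 hpos
    have i1 : Integrable (fun x => g x ^ 2) (volume.restrict B) := hg.memLp.integrable_sq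
    have i2 : Integrable (fun x => |e x| * g x) (volume.restrict B) :=
      hem.abs.integrable_mul hg.memLp
    have hnn : 0 ≤ᵐ[volume.restrict B] fun x => g x ^ 2 - |e x| * g x := by
      filter_upwards [hge] with x hx
      have h3 : g x ^ 2 - |e x| * g x = g x * (g x - |e x|) := by ring
      simp only [Pi.zero_apply]
      rw [h3]
      exact mul_nonneg ((abs_nonneg _).trans hx) (sub_nonneg.2 hx)
    have h4 : ∫ x in B, (g x ^ 2 - |e x| * g x) = 0 := by
      refine le_antisymm ?_ (integral_nonneg_of_ae hnn)
      rw [integral_sub i1 i2]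
      linarith
    filter_upwards [(integral_eq_zero_iff_of_nonneg_ae hnn (i1.sub i2)).1 h4, hge] with x h5 h6
    have h7 : g x * (g x - |e x|) = 0 := by
      have : g x ^ 2 - |e x| * g x = 0 := h5
      rw [← this]; ring
    rcases mul_eq_zero.1 h7 with h8 | h8
    · exact le_antisymm (h8.le.trans (abs_nonneg _)) h6
    · linarith
  by_cases hP : (fun x => lam * |e x| + 1 * (lam * e x)) =ᵐ[volume.restrict B] 0
  · right
    have hN' : ¬ (fun x => lam * |e x| + -1 * (lam * e x)) =ᵐ[volume.restrict B] 0 := by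
      intro hQ
      refine he.ne_zero ?_
      filter_upwards [hP, hQ] with x h1 h2
      simp only [Pi.zero_apply] at h1 h2 ⊢
      have : lam * e x = 0 := by linarith
      exact (mul_eq_zero.1 this).resolve_left hpos.ne'
    filter_upwards [hn hN', hgabs] with x h1 h2
    rw [h2] at h1
    by_contra h3
    rw [abs_of_nonneg (not_lt.1 h3)] at h1
    linarith
  · left
    filter_upwards [hp hP, hgabs] with x h1 h2
    rw [h2] at h1
    by_contra h3
    rw [abs_of_nonpos (not_lt.1 h3)] at h1
    linarith

/-! ### The strong maximum principle for weakly superharmonic functions -/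

theorem quad_one_eq (y x : E N) : quad 1 y (‖y‖ ^ 2) x = ‖x - y‖ ^ 2 := by
  rw [quad, norm_sub_sq_real]
  ring

theorem lap_comp_norm_sub_sq {V : ℝ → ℝ} (hV : ContDiff ℝ ∞ V) (y x : E N) :
    lap (fun x => V (‖x - y‖ ^ 2)) x =
      4 * ‖x - y‖ ^ 2 * deriv (deriv V) (‖x - y‖ ^ 2) + 2 * N * deriv V (‖x - y‖ ^ 2) := by
  simp_rw [← quad_one_eq y]
  rw [congrFun (lap_comp hV (contDiff_quad 1 y (‖y‖ ^ 2))) x, sum_pd_quad, lap_quad, quad,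
    real_inner_self_eq_norm_sq]
  ring

/-- The potential whose negative Laplacian is the difference of two rescaled kernels. -/
theorem exists_potential {ε δ : ℝ} (hε : 0 < ε) (hδ : 0 < δ) (hεδ : ε ≤ δ) (y : E N) :
    ∃ η : E N → ℝ, IsTestFunction (Metric.closedBall y δ) η ∧ (∀ x, 0 ≤ η x) ∧ ∀ x, lap η x =
      ((stdProfile N).scale hδ).b 0 (‖x - y‖ ^ 2) -
        ((stdProfile N).scale hε).b 0 (‖x - y‖ ^ 2) := by
  set p := (stdProfile N).scale hε
  set q := (stdProfile N).scale hδ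
  set g : ℝ → ℝ := fun s => p.Φ s - q.Φ s with hg
  have hgs : ContDiff ℝ ∞ g := p.contDiff_Φ.sub q.contDiff_Φ
  have hg0 : ∀ s, 0 ≤ s → 0 ≤ g s := fun s hs => sub_nonneg.2 (stdProfile_scale_Φ_anti hε hεδ hs)
  have hgz : ∀ s, δ ^ 2 ≤ s → g s = 0 := fun s hs => by
    have hs0 : 0 ≤ s := (sq_nonneg δ).trans hs
    have h1 : ε ^ 2 ≤ s := (pow_le_pow_left₀ hε.le hεδ 2).trans hs
    simp only [hg, p, q]
    rw [stdProfile_scale_Φ hε hs0, stdProfile_scale_Φ hδ hs0,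
      step_eq_one ((one_le_div (by positivity)).2 hs),
      step_eq_one ((one_le_div (by positivity)).2 h1), sub_self]
  set V : ℝ → ℝ := fun s => ∫ t in s..δ ^ 2, g t with hVdef
  have hVd : ∀ s, HasDerivAt V (-g s) s := fun s =>
    intervalIntegral.integral_hasDerivAt_left (hgs.continuous.intervalIntegrable _ _)
      (hgs.continuous.stronglyMeasurableAtFilter _ _) hgs.continuous.continuousAt
  have hVd' : deriv V = fun s => -g s := funext fun s => (hVd s).deriv
  have hV : ContDiff ℝ ∞ V :=
    contDiff_infty_iff_deriv.2 ⟨fun s => (hVd s).differentiableAt, by rw [hVd']; exact hgs.neg⟩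
  have hVz : ∀ s, δ ^ 2 ≤ s → V s = 0 := fun s hs =>
    intervalIntegral.integral_zero_ae (ae_of_all _ fun t ht => hgz t (by
      rw [uIoc_of_ge hs] at ht; exact ht.1.le))
  have hV0 : ∀ s, 0 ≤ s → 0 ≤ V s := fun s hs => by
    rcases le_total s (δ ^ 2) with h | h
    · exact intervalIntegral.integral_nonneg h fun t ht => hg0 t (hs.trans ht.1)
    · exact (hVz s h).ge
  refine ⟨fun x => V (‖x - y‖ ^ 2), ?_, fun x => hV0 _ (sq_nonneg _), fun x => ?_⟩
  · have h : tsupport (fun x => V (‖x - y‖ ^ 2)) ⊆ Metric.closedBall y δ := by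
      refine closure_minimal (fun x hx => ?_) Metric.isClosed_closedBall
      by_contra hx'
      refine hx (hVz _ ?_)
      have h1 : δ < ‖x - y‖ := by simpa [dist_eq_norm] using hx'
      exact pow_le_pow_left₀ hδ.le h1.le 2
    exact ⟨hV.comp ((contDiff_norm_sq ℝ).comp (contDiff_id.sub contDiff_const)),
      (isCompact_closedBall _ _).of_isClosed_subset (isClosed_tsupport _) h, h⟩
  · have h1 : deriv (deriv V) (‖x - y‖ ^ 2) =
        -(deriv p.Φ (‖x - y‖ ^ 2) - deriv q.Φ (‖x - y‖ ^ 2)) := by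
      rw [hVd', deriv.fun_neg, deriv_fun_sub (p.contDiff_Φ.differentiable (by simp) _)
        (q.contDiff_Φ.differentiable (by simp) _)]
    rw [lap_comp_norm_sub_sq hV, h1, hVd', ← p.defect, ← q.defect]
    ring

section

variable {Ω : Set (E N)} {w : E N → ℝ}

/-- Weighted means of a weakly superharmonic function increase as the radius decreases. -/
theorem integral_mul_scale_le (hw : MemLp w 2 (volume.restrict Ω))
    (hsup : ∀ η, IsTestFunction Ω η → (∀ x, 0 ≤ η x) → 0 ≤ weakForm 1 Ω w η) {y : E N} {ε δ : ℝ}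
    (hε : 0 < ε) (hδ : 0 < δ) (hεδ : ε ≤ δ) (hy : Metric.closedBall y δ ⊆ Ω) :
    ∫ x in Ω, w x * ((stdProfile N).scale hδ).b 0 (‖x - y‖ ^ 2) ≤
      ∫ x in Ω, w x * ((stdProfile N).scale hε).b 0 (‖x - y‖ ^ 2) := by
  obtain ⟨η, hη, hη0, hlap⟩ := exists_potential hε hδ hεδ y
  have h := hsup η (hη.mono hy) hη0
  have hm : ∀ {r : ℝ} (hr : 0 < r), MemLp (fun x : E N =>
      ((stdProfile N).scale hr).b 0 (‖x - y‖ ^ 2)) 2 (volume.restrict Ω) := fun hr => by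
    have hrad := (((stdProfile N).scale hr).isTestFunction_radial
      (by positivity) 0).memLp 2
    exact (hrad.comp_measurePreserving (measurePreserving_sub_right volume y)).restrict Ω
  have h1 : weakForm 1 Ω w η = (∫ x in Ω, w x * ((stdProfile N).scale hε).b 0 (‖x - y‖ ^ 2)) -
      ∫ x in Ω, w x * ((stdProfile N).scale hδ).b 0 (‖x - y‖ ^ 2) := by
    refine Eq.trans ?_ (integral_sub (hw.integrable_mul (hm hε)) (hw.integrable_mul (hm hδ)))
    rw [weakForm, pow_one, neg_one_mul, ← integral_neg]
    congr 1
    funext x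
    change -(w x * lap η x) = _
    rw [hlap]
    ring
  linarith

theorem exists_stdProfile_b_zero_pos (hN : 1 ≤ N) :
    ∃ c : ℝ, 0 < c ∧ c ≤ 1 ∧ 0 < (stdProfile N).b 0 (c ^ 2) := by
  obtain ⟨z, hz⟩ : ∃ z : E N, (stdProfile N).b 0 (‖z‖ ^ 2) ≠ 0 := by
    by_contra! h
    have := stdProfile_integral_pos hN
    simp [h] at this
  refine ⟨‖z‖, ?_, ?_, lt_of_le_of_ne (stdProfile_b_zero_nonneg _) hz.symm⟩
  · refine lt_of_le_of_ne (norm_nonneg z) fun h => hz ?_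
    rw [← h, ← (stdProfile N).defect]
    change 4 * 0 ^ 2 * _ + 2 * N * stdΦ N (0 ^ 2) = 0
    simp [stdΦ, step_eq_zero]
  · by_contra! h
    exact hz ((stdProfile N).b_eq_zero 0 _ (one_le_pow₀ h.le))

/-- A nonnegative weakly superharmonic function vanishing at a (Lebesgue) point vanishes near that
point. -/
theorem ae_forall_ball_eq_zero (hN : 1 ≤ N) (hΩ : IsOpen Ω) (hΩb : Bornology.IsBounded Ω)
    (hw : MemLp w 2 (volume.restrict Ω)) (hw0 : ∀ᵐ x ∂(volume.restrict Ω), 0 ≤ w x)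
    (hsup : ∀ η, IsTestFunction Ω η → (∀ x, 0 ≤ η x) → 0 ≤ weakForm 1 Ω w η) {c : ℝ} (hc : 0 < c)
    (hc1 : c ≤ 1) (hcb : 0 < (stdProfile N).b 0 (c ^ 2)) :
    ∀ᵐ y, y ∈ Ω → w y = 0 → ∀ ρ, Metric.ball y ρ ⊆ Ω →
      ∀ᵐ x, x ∈ Metric.ball y (c * ρ) → w x = 0 := by
  set p := stdProfile N
  have hM : 0 < ∫ z : E N, p.kernel 0 z := stdProfile_integral_pos hN
  set ε : ℕ → ℝ := fun j => 1 / ((j : ℝ) + 1)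
  have hε0 : ∀ j, 0 < ε j := fun j => by positivity
  have hεt : Tendsto ε atTop (𝓝 0) := tendsto_one_div_add_atTop_nhds_zero_nat
  have hfin : IsFiniteMeasure (volume.restrict Ω) := ⟨by simpa using hΩb.measure_lt_top⟩
  have hui : Integrable (Ω.indicator w) volume :=
    (integrable_indicator_iff hΩ.measurableSet).2 (hw.integrable one_le_two)
  have hconv := ae_tendsto_integral_kernel (p.contDiff_kernel 0).continuous
    (fun z hz => p.kernel_eq_zero 0 hz) hM.ne' hui.locallyIntegrable hε0 hεt
  have hb0 : ∀ {r : ℝ} (hr : 0 < r) s, 0 ≤ (p.scale hr).b 0 s := fun hr s =>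
    mul_nonneg (by positivity) (mul_nonneg (by positivity) (stdProfile_b_zero_nonneg _))
  filter_upwards [hconv] with y hy hyΩ hwy ρ hρ
  rw [indicator_of_mem hyΩ, hwy, zero_mul] at hy
  have hle : ∀ δ (hδ : 0 < δ), Metric.closedBall y δ ⊆ Ω →
      ∫ x in Ω, w x * (p.scale hδ).b 0 (‖x - y‖ ^ 2) ≤ 0 := by
    intro δ hδ hyδ
    refine ge_of_tendsto hy ?_
    filter_upwards [hεt.eventually (gt_mem_nhds hδ)] with j hj
    refine (integral_mul_scale_le hw hsup (hε0 j) hδ (le_of_lt hj) hyδ).trans (le_of_eq ?_)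
    rw [← integral_indicator hΩ.measurableSet]
    congr 1
    funext x
    rw [← p.kernel_scale (hε0 j)]
    by_cases hx : x ∈ Ω
    · rw [indicator_of_mem hx, indicator_of_mem hx]
      rfl
    · rw [indicator_of_notMem hx, indicator_of_notMem hx, zero_mul]
  have hzero : ∀ᵐ x, ∀ q : ℚ, (0 : ℝ) < q → (q : ℝ) < ρ → x ∈ Ω →
      w x * p.b 0 (‖x - y‖ ^ 2 / (q : ℝ) ^ 2) = 0 := by
    refine ae_all_iff.2 fun q => ?_
    by_cases hq : (0 : ℝ) < q ∧ (q : ℝ) < ρ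
    · have hsub : Metric.closedBall y q ⊆ Ω := (Metric.closedBall_subset_ball hq.2).trans hρ
      have hnn : 0 ≤ᵐ[volume.restrict Ω] fun x => w x * (p.scale hq.1).b 0 (‖x - y‖ ^ 2) := by
        filter_upwards [hw0] with x hx using mul_nonneg hx (hb0 hq.1 _)
      have hint : Integrable (fun x => w x * (p.scale hq.1).b 0 (‖x - y‖ ^ 2))
          (volume.restrict Ω) := hw.integrable_mul (memLp_restrict_of_continuous hΩb
            (((p.scale hq.1).contDiff_b 0).continuous.comp (by fun_prop)))
      have h0 := (integral_eq_zero_iff_of_nonneg_ae hnn hint).1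
        (le_antisymm (hle _ hq.1 hsub) (integral_nonneg_of_ae hnn))
      filter_upwards [(ae_restrict_iff' hΩ.measurableSet).1 h0] with x hx h1 h2 hxΩ
      have h3 : w x * (((q : ℝ) ^ N)⁻¹ * ((q : ℝ) ^ (2 * 0) * p.b 0 (‖x - y‖ ^ 2 / (q : ℝ) ^ 2))) =
        0 := hx hxΩ
      rw [mul_zero, pow_zero, one_mul, mul_left_comm] at h3
      exact (mul_eq_zero.1 h3).resolve_left (by positivity)
    · exact ae_of_all _ fun x h1 h2 => absurd ⟨h1, h2⟩ hq
  filter_upwards [hzero] with x hx hxb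
  rcases eq_or_ne x y with rfl | hxy
  · exact hwy
  have hr : 0 < ‖x - y‖ := norm_pos_iff.2 (sub_ne_zero.2 hxy)
  have hr' : ‖x - y‖ / c < ρ := (div_lt_iff₀' hc).2 (by simpa [dist_eq_norm] using hxb)
  have hq0 : 0 < ‖x - y‖ / c := by positivity
  -- a rational radius whose kernel charges the point `x`
  have hcont : ContinuousAt (fun q : ℝ => p.b 0 (‖x - y‖ ^ 2 / q ^ 2)) (‖x - y‖ / c) :=
    (p.contDiff_b 0).continuous.continuousAt.comp
      (continuousAt_const.div (by fun_prop) (by positivity))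
  have hval : ‖x - y‖ ^ 2 / (‖x - y‖ / c) ^ 2 = c ^ 2 := by field_simp
  have hev : ∀ᶠ q : ℝ in 𝓝 (‖x - y‖ / c), 0 < p.b 0 (‖x - y‖ ^ 2 / q ^ 2) :=
    hcont.eventually (lt_mem_nhds (by rw [← hval] at hcb; exact hcb))
  obtain ⟨q, ⟨hq1, hq2⟩, hq3⟩ := Rat.denseRange_cast.mem_nhds
    (((gt_mem_nhds hr').and (lt_mem_nhds hq0)).and hev)
  have hρ0 : 0 < ρ := hq0.trans hr'
  refine (mul_eq_zero.1 (hx q hq2 hq1 (hρ (Metric.ball_subset_ball ?_ hxb)))).resolve_right hq3.ne'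
  exact mul_le_of_le_one_left hρ0.le hc1

theorem ae_of_forall_exists_ball {P : E N → Prop}
    (h : ∀ y ∈ Ω, ∃ r > 0, ∀ᵐ x, x ∈ Metric.ball y r → P x) : ∀ᵐ x, x ∈ Ω → P x := by
  refine measure_null_of_locally_null _ fun y hy => ?_
  have hyΩ : y ∈ Ω := by
    by_contra h'
    exact hy fun h'' => absurd h'' h'
  obtain ⟨r, hr, hae⟩ := h y hyΩ
  refine ⟨_, inter_mem_nhdsWithin _ (Metric.ball_mem_nhds y hr), ?_⟩
  refine measure_mono_null ?_ hae
  rintro x ⟨hx, hxb⟩ hx'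
  exact hx fun _ => hx' hxb

/-- On a connected open set, two incompatible properties, one of which holds almost everywhere in
a neighbourhood of each point, cannot both occur. -/
theorem ae_or_ae_of_isConnected (hc : IsPreconnected Ω) {P Q : E N → Prop}
    (hPQ : ∀ x, P x → ¬ Q x) (hloc : ∀ y ∈ Ω, ∃ r > 0,
      (∀ᵐ x, x ∈ Metric.ball y r → P x) ∨ (∀ᵐ x, x ∈ Metric.ball y r → Q x)) :
    (∀ᵐ x, x ∈ Ω → P x) ∨ (∀ᵐ x, x ∈ Ω → Q x) := by
  set G : (E N → Prop) → Set (E N) := fun P => {y | ∃ r > 0, ∀ᵐ x, x ∈ Metric.ball y r → P x}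
  have hG : ∀ P, IsOpen (G P) := by
    refine fun P => Metric.isOpen_iff.2 fun y ⟨r, hr, h⟩ => ⟨r, hr, fun z hz => ?_⟩
    refine ⟨r - dist z y, sub_pos.2 hz, ?_⟩
    filter_upwards [h] with x hx hxz
    exact hx (Metric.ball_subset_ball' (by linarith) hxz)
  have hdisj : Disjoint (G P) (G Q) := by
    refine Set.disjoint_left.2 ?_
    rintro y ⟨r, hr, h⟩ ⟨s, hs, h'⟩
    have h0 : volume (Metric.ball y (min r s)) = 0 := by
      refine measure_mono_null ?_ (h.and h')
      intro x hx hx'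
      exact hPQ x (hx'.1 (Metric.ball_subset_ball (min_le_left _ _) hx))
        (hx'.2 (Metric.ball_subset_ball (min_le_right _ _) hx))
    exact (Metric.measure_ball_pos volume y (lt_min hr hs)).ne' h0
  have hcov : Ω ⊆ G P ∪ G Q := by
    intro y hy
    obtain ⟨r, hr, h | h⟩ := hloc y hy
    · exact Or.inl ⟨r, hr, h⟩
    · exact Or.inr ⟨r, hr, h⟩
  rcases hc.subset_or_subset (hG P) (hG Q) hdisj hcov with h | h
  · exact Or.inl (ae_of_forall_exists_ball h)
  · exact Or.inr (ae_of_forall_exists_ball h)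

/-- **Strong maximum principle**. -/
theorem ae_eq_zero_or_ae_pos (hN : 1 ≤ N) (hΩ : IsOpen Ω) (hΩc : IsPreconnected Ω)
    (hΩb : Bornology.IsBounded Ω)
    (hw : MemLp w 2 (volume.restrict Ω)) (hw0 : ∀ᵐ x ∂(volume.restrict Ω), 0 ≤ w x)
    (hsup : ∀ η, IsTestFunction Ω η → (∀ x, 0 ≤ η x) → 0 ≤ weakForm 1 Ω w η) :
    (∀ᵐ x ∂(volume.restrict Ω), w x = 0) ∨ (∀ᵐ x ∂(volume.restrict Ω), 0 < w x) := by
  rw [ae_restrict_iff' hΩ.measurableSet] at hw0 ⊢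
  rw [ae_restrict_iff' hΩ.measurableSet]
  obtain ⟨c, hc, hc1, hcb⟩ := exists_stdProfile_b_zero_pos hN
  have hgood := ae_forall_ball_eq_zero hN hΩ hΩb hw
    ((ae_restrict_iff' hΩ.measurableSet).2 hw0) hsup hc hc1 hcb
  refine ae_or_ae_of_isConnected hΩc (fun x h => by rw [h]; exact lt_irrefl 0) fun y hy => ?_
  obtain ⟨r, hr, hrΩ⟩ := Metric.isOpen_iff.1 hΩ y hy
  set ρ := r / 3 with hρ
  have hρ0 : 0 < ρ := by positivity
  refine ⟨c * ρ, by positivity, ?_⟩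
  by_cases hz : ∀ᵐ x, x ∈ Metric.ball y (c * ρ) → 0 < w x
  · exact Or.inr hz
  left
  obtain ⟨z, hz1, hz2, hz3⟩ := ((not_eventually.1 hz).and_eventually (hgood.and hw0)).exists
  rw [Classical.not_imp, not_lt] at hz1
  have hcρ : c * ρ ≤ ρ := mul_le_of_le_one_left hρ0.le hc1
  have hzy : dist z y < c * ρ := hz1.1
  have hsub : Metric.ball z (2 * ρ) ⊆ Ω :=
    (Metric.ball_subset_ball' (by linarith)).trans hrΩ
  have hzΩ : z ∈ Ω := hsub (Metric.mem_ball_self (by positivity))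
  filter_upwards [hz2 hzΩ (le_antisymm hz1.2 (hz3 hzΩ)) _ hsub] with x hx hxy
  exact hx (Metric.ball_subset_ball' (by rw [dist_comm]; linarith) hxy)

end

/-! ### First eigenfunctions of the Laplacian -/

/-- A smooth regularisation of the absolute value. -/
noncomputable def smoothAbs (ε t : ℝ) : ℝ := √(t ^ 2 + ε ^ 2) - ε

section

variable {ε : ℝ}

theorem contDiff_smoothAbs (hε : 0 < ε) : ContDiff ℝ ∞ (smoothAbs ε) :=
  ((contDiff_id.pow 2).add contDiff_const |>.sqrt fun t => by positivity).sub contDiff_const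

theorem smoothAbs_zero (hε : 0 < ε) : smoothAbs ε 0 = 0 := by
  simp [smoothAbs, Real.sqrt_sq hε.le]

theorem abs_deriv_smoothAbs_le (hε : 0 < ε) (t : ℝ) : |deriv (smoothAbs ε) t| ≤ 1 := by
  have h1 : HasDerivAt (fun t : ℝ => t ^ 2 + ε ^ 2) (2 * t) t := by
    simpa using (hasDerivAt_pow 2 t).add_const (ε ^ 2)
  have h2 : HasDerivAt (smoothAbs ε) (2 * t / (2 * √(t ^ 2 + ε ^ 2))) t :=
    (h1.sqrt (by positivity)).sub_const ε
  rw [h2.deriv, mul_div_mul_left _ _ two_ne_zero, abs_div, abs_of_nonneg (Real.sqrt_nonneg _)]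
  refine div_le_one_of_le₀ (Real.abs_le_sqrt ?_) (Real.sqrt_nonneg _)
  linarith [sq_nonneg ε]

theorem abs_smoothAbs_sub_abs_le (hε : 0 < ε) (t : ℝ) : abs (smoothAbs ε t - |t|) ≤ ε := by
  have h1 : |t| ≤ √(t ^ 2 + ε ^ 2) := Real.abs_le_sqrt (by linarith [sq_nonneg ε])
  have h2 : √(t ^ 2 + ε ^ 2) ≤ |t| + ε := by
    rw [Real.sqrt_le_left (by positivity)]
    have := mul_nonneg (abs_nonneg t) hε.le
    linarith [sq_abs t, add_sq |t| ε]
  rw [smoothAbs, abs_le]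
  constructor <;> linarith

end

section

variable {Ω : Set (E N)} {φ : E N → ℝ}

theorem IsTestFunction.smoothAbs (h : IsTestFunction Ω φ) {ε : ℝ} (hε : 0 < ε) :
    IsTestFunction Ω (fun x => smoothAbs ε (φ x)) := by
  refine ⟨(contDiff_smoothAbs hε).comp h.1, h.2.1.comp_left (smoothAbs_zero hε), ?_⟩
  refine (closure_mono (Function.support_subset_iff'.2 fun x hx => ?_)).trans h.2.2
  rw [Function.notMem_support.1 hx, smoothAbs_zero hε]

theorem energyForm_one_self (h : IsTestFunction Ω φ) :
    energyForm 1 φ φ = ∫ x, ∑ i, pd i φ x * pd i φ x := by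
  rw [energyForm_self h, dirichletEnergy, if_neg (by decide)]
  simp_rw [norm_gradient_sq]
  rfl

theorem energyForm_smoothAbs_le (h : IsTestFunction Ω φ) {ε : ℝ} (hε : 0 < ε) :
    energyForm 1 (fun x => smoothAbs ε (φ x)) (fun x => smoothAbs ε (φ x)) ≤
      energyForm 1 φ φ := by
  have hint : ∀ {η : E N → ℝ}, IsTestFunction Ω η →
      Integrable (fun x => ∑ i, pd i η x * pd i η x) volume := fun hη =>
    integrable_finsetSum _ fun i _ => (hη.pd i).integrable_mul (hη.pd i).continuous
  rw [energyForm_one_self h, energyForm_one_self (h.smoothAbs hε)]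
  refine integral_mono (hint (h.smoothAbs hε)) (hint h) fun x => Finset.sum_le_sum fun i _ => ?_
  rw [congrFun (pd_comp (contDiff_smoothAbs hε) h.1 i) x, ← sq, ← sq, mul_pow]
  refine mul_le_of_le_one_left (sq_nonneg _) ?_
  rw [← sq_abs]
  exact pow_le_one₀ (abs_nonneg _) (abs_deriv_smoothAbs_le hε _)

/-- Test functions whose Rayleigh quotient is almost minimal almost satisfy the eigenvalue
equation. -/
theorem energyForm_sub_sq_le {m : ℕ} {c : ℝ}
    (hc : ∀ η, IsTestFunction Ω η → c * ∫ x, η x ^ 2 ≤ energyForm m η η) {η : E N → ℝ}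
    (hφ : IsTestFunction Ω φ) (hη : IsTestFunction Ω η) :
    (energyForm m φ η - c * ∫ x, φ x * η x) ^ 2 ≤
      (energyForm m η η - c * ∫ x, η x ^ 2) * (energyForm m φ φ - c * ∫ x, φ x ^ 2) := by
  have h := discrim_le_zero (a := energyForm m η η - c * ∫ x, η x ^ 2)
    (b := 2 * (energyForm m φ η - c * ∫ x, φ x * η x))
    (c := energyForm m φ φ - c * ∫ x, φ x ^ 2) fun t => by
    have h1 := hc _ (hφ.add (hη.const_mul t))
    have i1 : Integrable (fun x => φ x ^ 2) volume := by
      simpa only [sq] using hφ.integrable_mul hφ.continuous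
    have i2 : Integrable (fun x => η x ^ 2) volume := by
      simpa only [sq] using hη.integrable_mul hη.continuous
    have h2 : ∫ x, (φ x + t * η x) ^ 2 =
        (∫ x, φ x ^ 2) + 2 * t * (∫ x, φ x * η x) + t ^ 2 * ∫ x, η x ^ 2 := by
      rw [← integral_const_mul, ← integral_const_mul, ← integral_add i1
        ((hφ.integrable_mul hη.continuous).const_mul _)]
      refine Eq.trans ?_ (integral_add (i1.add
        ((hφ.integrable_mul hη.continuous).const_mul _)) (i2.const_mul _))
      congr 1
      funext x
      ring
    rw [energyForm_add_self hφ (hη.const_mul t), energyForm_const_mul_right hη,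
      energyForm_const_mul_self hη, h2] at h1
    linarith
  rw [discrim] at h
  linarith

/-- The modulus of a first eigenfunction of the Laplacian satisfies the same equation, since it
minimises the Rayleigh quotient. -/
theorem IsFirstEigenfunction.weakForm_abs_eq (hΩb : Bornology.IsBounded Ω) {e : E N → ℝ}
    (he : IsFirstEigenfunction 1 Ω e) {η : E N → ℝ} (hη : IsTestFunction Ω η) :
    weakForm 1 Ω (fun x => |e x|) η = firstEigenvalue 1 Ω * ∫ x in Ω, |e x| * η x := by
  obtain ⟨φ, happ⟩ := he.memH0.exists_energyApprox
  set lam := firstEigenvalue 1 Ω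
  have hem := happ.memLp
  have hea : MemLp (fun x => |e x|) 2 (volume.restrict Ω) := hem.abs
  have hfin : IsFiniteMeasure (volume.restrict Ω) := ⟨by simpa using hΩb.measure_lt_top⟩
  set ε : ℕ → ℝ := fun j => 1 / ((j : ℝ) + 1)
  have hε0 : ∀ j, 0 < ε j := fun j => by positivity
  have hεt : Tendsto ε atTop (𝓝 0) := tendsto_one_div_add_atTop_nhds_zero_nat
  set ψ : ℕ → E N → ℝ := fun k x => smoothAbs (ε k) (φ k x)
  have hψ : ∀ k, IsTestFunction Ω (ψ k) := fun k => (happ.test k).smoothAbs (hε0 k)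
  have hψt : Tendsto (fun k => eLpNorm (ψ k - fun x => |e x|) 2 (volume.restrict Ω)) atTop
      (𝓝 0) := by
    have hconst : Tendsto (fun k => eLpNorm (fun _ : E N => ε k) 2 (volume.restrict Ω)) atTop
        (𝓝 0) := by
      have h1 : ∀ k, eLpNorm (fun _ : E N => ε k) 2 (volume.restrict Ω) =
          ENNReal.ofReal (ε k) * volume.restrict Ω univ ^ (1 / (2 : ENNReal).toReal) := fun k => by
        rw [eLpNorm_const' _ two_ne_zero ENNReal.ofNat_ne_top, Real.enorm_of_nonneg (hε0 k).le]
      simp_rw [h1]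
      have h2 := ENNReal.Tendsto.mul_const
        (b := volume.restrict Ω univ ^ (1 / (2 : ENNReal).toReal))
        (ENNReal.tendsto_ofReal hεt) (Or.inr (ENNReal.rpow_ne_top_of_nonneg (by simp)
          (measure_ne_top _ _)))
      simpa using h2
    have h3 := hconst.add happ.tendsto
    rw [add_zero] at h3
    refine tendsto_of_tendsto_of_tendsto_of_le_of_le tendsto_const_nhds h3 (fun _ => zero_le)
      fun k => ?_
    have h4 := eLpNorm_add_le (μ := volume.restrict Ω) (f := ψ k - fun x => |φ k x|)
      (g := (fun x => |φ k x|) - fun x => |e x|)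
      ((hψ k).memLp_restrict.sub (happ.test k).memLp_restrict.abs).1
      ((happ.test k).memLp_restrict.abs.sub hea).1 one_le_two
    rw [sub_add_sub_cancel] at h4
    refine h4.trans (add_le_add (eLpNorm_mono_real fun x => ?_) (eLpNorm_mono fun x => ?_))
    · exact abs_smoothAbs_sub_abs_le (hε0 k) _
    · exact abs_abs_sub_abs_le _ _
  -- the Rayleigh quotients of `ψ k` are asymptotically minimal
  have hq : Tendsto (fun k => energyForm 1 (ψ k) (ψ k) - lam * ∫ x, ψ k x ^ 2) atTop (𝓝 0) := by
    have h1 := happ.tendsto_energy (hem.const_mul lam) fun η hη => he.weakForm_eq hη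
    have h2 := (tendsto_integral_mul_of_tendsto (fun k => (hψ k).memLp_restrict)
      (fun k => (hψ k).memLp_restrict) hea hea hψt hψt).const_mul lam
    have h3 := h1.sub h2
    have h4 : (∫ x in Ω, lam * e x * e x) - lam * ∫ x in Ω, |e x| * |e x| = 0 := by
      simp only [abs_mul_abs_self, mul_assoc, integral_const_mul, sub_self]
    rw [h4] at h3
    refine tendsto_of_tendsto_of_tendsto_of_le_of_le tendsto_const_nhds h3
      (fun k => sub_nonneg.2 (firstEigenvalue_mul_le (hψ k))) fun k => ?_
    have h5 := (hψ k).setIntegral_sq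
    simp only [sq] at h5 ⊢
    rw [h5]
    exact sub_le_sub_right (energyForm_smoothAbs_le (happ.test k) (hε0 k)) _
  have h1 : Tendsto (fun k => energyForm 1 (ψ k) η - lam * ∫ x, ψ k x * η x) atTop
      (𝓝 (weakForm 1 Ω (fun x => |e x|) η - lam * ∫ x in Ω, |e x| * η x)) := by
    refine Tendsto.sub ?_ (Tendsto.const_mul lam ?_)
    · have := (tendsto_integral_mul_const_of_tendsto (fun k => (hψ k).memLp_restrict) hea
        (hη.iterLaplacian 1).memLp_restrict hψt).const_mul ((-1) ^ 1)
      refine this.congr fun k => ?_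
      rw [← weakForm_eq_energyForm hη]
      rfl
    · refine (tendsto_integral_mul_const_of_tendsto (fun k => (hψ k).memLp_restrict) hea
        hη.memLp_restrict hψt).congr fun k => hη.setIntegral_mul (ψ k)
  have h2 := le_of_tendsto_of_tendsto' (h1.pow 2)
    (hq.const_mul (energyForm 1 η η - lam * ∫ x, η x ^ 2))
    fun k => energyForm_sub_sq_le (fun η hη => firstEigenvalue_mul_le hη) (hψ k) hη
  rw [mul_zero] at h2
  exact sub_eq_zero.1 (pow_eq_zero_iff two_ne_zero |>.1 (le_antisymm h2 (sq_nonneg _)))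

/-- First eigenfunctions of the Laplacian in a connected domain have a sign: `|e| + e` and `|e| - e`
are superharmonic, so each of them is positive or zero. -/
theorem IsFirstEigenfunction.ae_pos_or_ae_neg (hN : 1 ≤ N) (hΩ : IsOpen Ω) (hΩc : IsConnected Ω)
    (hΩb : Bornology.IsBounded Ω) {e : E N → ℝ} (he : IsFirstEigenfunction 1 Ω e) :
    (∀ᵐ x ∂(volume.restrict Ω), 0 < e x) ∨ (∀ᵐ x ∂(volume.restrict Ω), e x < 0) := by
  have hem := he.memLp
  have hea : MemLp (fun x => |e x|) 2 (volume.restrict Ω) := hem.abs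
  have key : ∀ s : ℝ, |s| = 1 → (∀ᵐ x ∂(volume.restrict Ω), |e x| + s * e x = 0) ∨
      (∀ᵐ x ∂(volume.restrict Ω), 0 < |e x| + s * e x) := by
    intro s hs
    have hnn : ∀ x, 0 ≤ |e x| + s * e x := fun x => by
      have h1 := neg_abs_le (s * e x)
      rw [abs_mul, hs, one_mul] at h1
      linarith
    refine ae_eq_zero_or_ae_pos hN hΩ hΩc.isPreconnected hΩb (hea.add (hem.const_mul s))
      (ae_of_all _ hnn) fun η hη hη0 => ?_
    have h1 : weakForm 1 Ω (fun x => |e x| + s * e x) η =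
        firstEigenvalue 1 Ω * ∫ x in Ω, (|e x| + s * e x) * η x := by
      rw [weakForm_add hea (hem.const_mul s) hη, weakForm_const_mul, he.weakForm_abs_eq hΩb hη,
        he.weakForm_eq hη, integral_add_mul hea (hem.const_mul s) hη.memLp_restrict]
      simp only [mul_assoc, integral_const_mul]
      ring
    rw [h1]
    exact mul_nonneg (firstEigenvalue_nonneg _ _)
      (integral_nonneg fun x => mul_nonneg (hnn x) (hη0 x))
  rcases key 1 (by simp) with hp | hp
  · right
    rcases key (-1) (by simp) with hn | hn
    · refine absurd ?_ he.ne_zero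
      filter_upwards [hp, hn] with x h1 h2
      change e x = 0
      linarith
    · filter_upwards [hp, hn] with x h1 h2
      linarith
  · left
    filter_upwards [hp] with x h1
    by_contra h2
    rw [abs_of_nonpos (not_lt.1 h2)] at h1
    linarith

end

/-! ### Testing the parabolic equation with the first eigenfunction -/

section

variable {m : ℕ} {Ω : Set (E N)}

theorem SobolevJet.exists_continuous_integral_abs_mul (hΩ : MeasurableSet Ω) {g : E N → ℝ}
    (hg : MemLp g 2 (volume.restrict Ω)) :
    ∃ A : SobolevJet N m → ℝ, Continuous A ∧ (∀ F, A F = ∫ x in Ω, |F.toFun x| * g x) ∧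
      ∀ F, |A F| ≤ (eLpNorm g 2 (volume.restrict Ω)).toReal * ‖toLp N m‖ * ‖F‖ := by
  have hg' : MemLp (Ω.indicator g) 2 (volume : Measure (E N)) :=
    (memLp_indicator_iff_restrict hΩ).2 hg
  have hcont : Continuous fun F : SobolevJet N m => |toLp N m F| :=
    (toLp N m).continuous.sup (toLp N m).continuous.neg
  refine ⟨fun F => inner ℝ (|toLp N m F|) (hg'.toLp _), hcont.inner continuous_const,
    fun F => ?_, fun F => ?_⟩
  · beta_reduce
    rw [L2.inner_def, ← integral_indicator hΩ]
    refine integral_congr_ae ?_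
    filter_upwards [hg'.coeFn_toLp, F.coeFn_toLp, Lp.coeFn_abs (toLp N m F)] with x h1 h2 h3
    rw [h1, h3, h2, real_inner_eq_re_inner]
    by_cases hx : x ∈ Ω <;> simp [hx, mul_comm]
  · refine (abs_real_inner_le_norm _ _).trans ?_
    rw [norm_abs_eq_norm, Lp.norm_toLp, eLpNorm_indicator_eq_eLpNorm_restrict hΩ, mul_comm,
      mul_assoc]
    exact mul_le_mul_of_nonneg_left ((toLp N m).le_opNorm F) ENNReal.toReal_nonneg

/-- A continuous functional of linear growth of an integrable curve is integrable. -/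
theorem integrableOn_comp_of_abs_le {X : Type*} [NormedAddCommGroup X] {A : X → ℝ}
    (hA : Continuous A) {C : ℝ} (hC : ∀ F, |A F| ≤ C * ‖F‖) {V : ℝ → X} {s : Set ℝ}
    (hV : IntegrableOn V s) : IntegrableOn (fun r => A (V r)) s :=
  (hV.norm.const_mul C).mono' (hA.comp_aestronglyMeasurable hV.1) (ae_of_all _ fun r => hC (V r))

/-- The first Fourier coefficient of a weak solution is absolutely continuous, with the derivative
expected from a formal integration by parts. -/
theorem IsWeakSolution.exists_fourierJ_eq (hΩ : MeasurableSet Ω) {n : ℝ} {f : ℝ → ℝ} {τ : EReal}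
    {v : ℝ → E N → ℝ} (hv : IsWeakSolution m n Ω f τ v)
    (hf : ∀ t : ℝ, 0 ≤ t → (t : EReal) < τ →
      ∀ᵐ x ∂(volume.restrict Ω), f (v t x) = |v t x|) {e : E N → ℝ}
    (he : IsFirstEigenfunction m Ω e) :
    ∃ h : ℝ → ℝ, (∀ t : ℝ, 0 ≤ t → (t : EReal) < τ → IntegrableOn h (Ioc 0 t) ∧
        fourierJ n Ω e (v t) = fourierJ n Ω e (v 0) + ∫ r in (0 : ℝ)..t, h r) ∧
      ∀ᵐ r : ℝ, 0 < r → (r : EReal) < τ → MemLp (v r) 2 (volume.restrict Ω) ∧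
        h r = -(firstEigenvalue m Ω * ∫ x in Ω, v r x * e x) + ∫ x in Ω, |v r x| * e x := by
  obtain ⟨φ, happ⟩ := he.memH0.exists_energyApprox
  have hem := happ.memLp
  obtain ⟨ε, hε, hrate⟩ := happ.exists_jet_rate hΩ
    (hem.const_mul (firstEigenvalue m Ω)) fun η hη => he.weakForm_eq hη
  obtain ⟨V, hVint, hVae⟩ := hv.sobolev
  obtain ⟨L, hL⟩ := SobolevJet.exists_clm_integral_mul (m := m) hΩ
    (hem.const_mul (firstEigenvalue m Ω))
  obtain ⟨A, hAc, hA, hAb⟩ := SobolevJet.exists_continuous_integral_abs_mul (m := m) hΩ hem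
  choose L' hL' using fun k => SobolevJet.exists_clm_integral_mul (m := m) hΩ
    ((happ.test k).iterLaplacian m).memLp_restrict
  choose A' hAc' hA' hAb' using fun k =>
    SobolevJet.exists_continuous_integral_abs_mul (m := m) hΩ (happ.test k).memLp_restrict
  have hInt : ∀ t : ℝ, 0 ≤ t → (t : EReal) < τ →
      IntegrableOn (fun r => -L (V r) + A (V r)) (Ioc 0 t) := fun t ht htτ =>
    (integrableOn_comp_of_abs_le L.continuous (fun F => L.le_opNorm F) (hVint t ht htτ)).neg.add
      (integrableOn_comp_of_abs_le hAc hAb (hVint t ht htτ))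
  have hInt' : ∀ k, ∀ t : ℝ, 0 ≤ t → (t : EReal) < τ →
      IntegrableOn (fun r => (-1) ^ (m + 1) * L' k (V r) + A' k (V r)) (Ioc 0 t) :=
    fun k t ht htτ => ((integrableOn_comp_of_abs_le (L' k).continuous
      (fun F => (L' k).le_opNorm F) (hVint t ht htτ)).const_mul _).add
      (integrableOn_comp_of_abs_le (hAc' k) (hAb' k) (hVint t ht htτ))
  set ρ : ℕ → ℝ := fun k =>
    ε k + (eLpNorm (φ k - e) 2 (volume.restrict Ω)).toReal * ‖SobolevJet.toLp N m‖
  have hρ : Tendsto ρ atTop (𝓝 0) := by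
    have h1 := (ENNReal.tendsto_toReal ENNReal.zero_ne_top).comp happ.tendsto
    simpa using hε.add (h1.mul_const ‖SobolevJet.toLp N m‖)
  -- the functionals with the approximations of `e` converge, uniformly on bounded sets
  have hdiff : ∀ k, ∀ F ∈ sobolevH0 m Ω,
      |((-1) ^ (m + 1) * L' k F + A' k F) - (-L F + A F)| ≤ ρ k * ‖F‖ := by
    intro k F hF
    obtain ⟨A₀, -, hA₀, hAb₀⟩ := SobolevJet.exists_continuous_integral_abs_mul (m := m) hΩ
      ((happ.test k).memLp_restrict.sub hem)
    have h1 := hrate k F hF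
    have h2 : ∫ x in Ω, F.toFun x * (firstEigenvalue m Ω * e x) = L F := (hL F).symm
    rw [weakForm, ← hL', h2] at h1
    have h3 : A' k F - A F = A₀ F := by
      have hFm : MemLp (fun x => |F.toFun x|) 2 (volume.restrict Ω) :=
        (F.memLp_toFun.restrict Ω).abs
      rw [hA', hA, hA₀]
      refine (integral_sub (hFm.integrable_mul (happ.test k).memLp_restrict)
        (hFm.integrable_mul hem)).symm.trans ?_
      congr 1
      funext x
      simp only [Pi.sub_apply, Pi.mul_apply]
      ring
    have h4 : ((-1) ^ (m + 1) * L' k F + A' k F) - (-L F + A F) =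
        -((-1) ^ m * L' k F - L F) + A₀ F := by rw [← h3]; ring
    rw [h4]
    refine (abs_add_le _ _).trans ?_
    rw [abs_neg, add_mul]
    exact add_le_add h1 (hAb₀ F)
  refine ⟨fun r => -L (V r) + A (V r), fun t ht htτ => ⟨hInt t ht htτ, ?_⟩, ?_⟩
  · have hJ : ∀ s : ℝ, 0 ≤ s → (s : EReal) < τ → Tendsto (fun k =>
        ∫ x in Ω, psi n (v s x) * φ k x) atTop (𝓝 (fourierJ n Ω e (v s))) := by
      intro s hs hsτ
      have h1 := happ.tendsto_integral_mul (hv.memLp s hs hsτ)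
      simp only [mul_comm (φ _ _), mul_comm (e _)] at h1
      exact h1
    have heqk : ∀ k, ∫ x in Ω, psi n (v t x) * φ k x = (∫ x in Ω, psi n (v 0 x) * φ k x) +
        ∫ r in (0 : ℝ)..t, ((-1) ^ (m + 1) * L' k (V r) + A' k (V r)) := by
      intro k
      rw [hv.equation t ht htτ _ (happ.test k)]
      congr 1
      refine intervalIntegral.integral_congr_ae ?_
      filter_upwards [hVae] with r hr hrt
      rw [uIoc_of_le ht] at hrt
      have hrτ : (r : EReal) < τ := lt_of_le_of_lt (EReal.coe_le_coe_iff.2 hrt.2) htτ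
      obtain ⟨-, hVr⟩ := hr hrt.1 hrτ
      rw [hL', hA']
      congr 1
      · congr 1
        refine integral_congr_ae ?_
        filter_upwards [hVr] with x hx
        rw [hx]
      · refine integral_congr_ae ?_
        filter_upwards [hVr, hf r hrt.1.le hrτ] with x hx hfx
        rw [hx, hfx]
    have hlim : Tendsto (fun k => ∫ r in (0 : ℝ)..t, ((-1) ^ (m + 1) * L' k (V r) + A' k (V r)))
        atTop (𝓝 (∫ r in (0 : ℝ)..t, (-L (V r) + A (V r)))) := by
      have h1 : Tendsto (fun k => ρ k * ∫ r in Ioc 0 t, ‖V r‖) atTop (𝓝 0) := by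
        simpa using hρ.mul_const (∫ r in Ioc 0 t, ‖V r‖)
      refine tendsto_iff_norm_sub_tendsto_zero.2
        (squeeze_zero (fun k => norm_nonneg _) (fun k => ?_) h1)
      rw [intervalIntegral.integral_of_le ht, intervalIntegral.integral_of_le ht,
        ← integral_sub (hInt' k t ht htτ) (hInt t ht htτ), ← integral_const_mul]
      refine norm_integral_le_of_norm_le ((hVint t ht htτ).norm.const_mul _) ?_
      filter_upwards [ae_restrict_of_ae hVae, ae_restrict_mem measurableSet_Ioc] with r hr hrt
      exact hdiff k _ (hr hrt.1 (lt_of_le_of_lt (EReal.coe_le_coe_iff.2 hrt.2) htτ)).1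
    have h0 : ((0 : ℝ) : EReal) < τ := hv.pos
    exact tendsto_nhds_unique ((hJ t ht htτ).congr heqk) ((hJ 0 le_rfl h0).add hlim)
  · filter_upwards [hVae] with r hr hr0 hrτ
    obtain ⟨-, hVr⟩ := hr hr0 hrτ
    refine ⟨((V r).memLp_toFun.restrict Ω).ae_eq hVr, ?_⟩
    rw [hL, hA, ← integral_const_mul]
    congr 1
    · congr 1
      refine integral_congr_ae ?_
      filter_upwards [hVr] with x hx
      rw [hx]
      ring
    · refine integral_congr_ae ?_
      filter_upwards [hVr] with x hx
      rw [hx]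

end

/-! ### The differential inequality and blow-up -/

theorem abs_psi {n : ℝ} (hn : 0 < n) (s : ℝ) : |psi n s| = |s| ^ (1 / (n + 1)) := by
  rcases eq_or_ne s 0 with rfl | hs
  · rw [psi, mul_zero, abs_zero, Real.zero_rpow (by positivity)]
  · have h : 0 < |s| := abs_pos.2 hs
    rw [psi, abs_mul, abs_of_nonneg (Real.rpow_nonneg h.le _),
      ← Real.rpow_add_one h.ne']
    congr 1
    field_simp
    ring

theorem psi_nonneg {n s : ℝ} (hs : 0 ≤ s) : 0 ≤ psi n s :=
  mul_nonneg (Real.rpow_nonneg (abs_nonneg s) _) hs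

theorem psi_eq_zero {n s : ℝ} (hn : 0 < n) (h : psi n s = 0) : s = 0 := by
  rw [← abs_eq_zero, abs_psi hn, Real.rpow_eq_zero (abs_nonneg s) (by positivity)] at h
  exact abs_eq_zero.1 h

/-- Hölder's inequality for the first Fourier coefficient. -/
theorem c2_mul_abs_fourierJ_rpow_le {n : ℝ} (hn : 0 < n) {Ω : Set (E N)} {e w : E N → ℝ}
    (he : Integrable e (volume.restrict Ω)) (he0 : ∀ᵐ x ∂(volume.restrict Ω), 0 < e x)
    (hpos : 0 < ∫ x in Ω, e x)
    (hw : Integrable (fun x => |w x| * e x) (volume.restrict Ω)) :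
    c2 n Ω e * |fourierJ n Ω e w| ^ (n + 1) ≤ ∫ x in Ω, |w x| * e x := by
  have hn1 : 0 < n + 1 := by positivity
  set p := n + 1 with hp
  set q := (n + 1) / n with hq
  have hq0 : 0 < q := by positivity
  have hpq : p.HolderConjugate q := by
    rw [Real.holderConjugate_iff]
    refine ⟨by linarith, ?_⟩
    rw [hp, hq]
    field_simp
    ring
  have hwe : ∀ᵐ x ∂(volume.restrict Ω), 0 ≤ |w x| * e x := by
    filter_upwards [he0] with x hx using mul_nonneg (abs_nonneg _) hx.le
  have he' : ∀ᵐ x ∂(volume.restrict Ω), 0 ≤ e x := he0.mono fun x hx => hx.le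
  have key : ∀ {g : E N → ℝ} {r : ℝ}, 0 < r → Integrable g (volume.restrict Ω) →
      (∀ᵐ x ∂(volume.restrict Ω), 0 ≤ g x) →
      MemLp (fun x => g x ^ (1 / r)) (ENNReal.ofReal r) (volume.restrict Ω) := by
    intro g r hr hg hg0
    have hm : AEStronglyMeasurable (fun x => g x ^ (1 / r)) (volume.restrict Ω) :=
      (hg.1.aemeasurable.pow_const _).aestronglyMeasurable
    rw [← integrable_norm_rpow_iff hm (by simpa using hr) ENNReal.ofReal_ne_top]
    refine hg.congr ?_
    filter_upwards [hg0] with x hx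
    rw [ENNReal.toReal_ofReal hr.le, Real.norm_of_nonneg (Real.rpow_nonneg hx _),
      ← Real.rpow_mul hx, one_div_mul_cancel hr.ne', Real.rpow_one]
  have hrpow : ∀ {g : E N → ℝ} {r : ℝ}, 0 < r → (∀ᵐ x ∂(volume.restrict Ω), 0 ≤ g x) →
      ∫ x in Ω, (g x ^ (1 / r)) ^ r = ∫ x in Ω, g x := by
    intro g r hr hg0
    refine integral_congr_ae ?_
    filter_upwards [hg0] with x hx
    rw [← Real.rpow_mul hx, one_div_mul_cancel hr.ne', Real.rpow_one]
  have hH := integral_mul_le_Lp_mul_Lq_of_nonneg hpq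
    (hwe.mono fun x hx => Real.rpow_nonneg hx (1 / p))
    (he'.mono fun x hx => Real.rpow_nonneg hx (1 / q)) (key hn1 hw hwe) (key hq0 he he')
  rw [hrpow hn1 hwe, hrpow hq0 he'] at hH
  set I := ∫ x in Ω, |w x| * e x
  set S := ∫ x in Ω, e x
  have hI : 0 ≤ I := integral_nonneg_of_ae hwe
  have hJ : |fourierJ n Ω e w| ≤ I ^ (1 / p) * S ^ (1 / q) := by
    refine le_trans ?_ hH
    refine (abs_integral_le_integral_abs).trans (le_of_eq (integral_congr_ae ?_))
    filter_upwards [he0] with x hx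
    rw [abs_mul, abs_psi hn, abs_of_pos hx, Real.mul_rpow (abs_nonneg _) hx.le, mul_assoc,
      ← Real.rpow_add hx, one_div, one_div, hpq.inv_add_inv_eq_one, Real.rpow_one]
  have h1 : |fourierJ n Ω e w| ^ p ≤ I * S ^ n := by
    refine (Real.rpow_le_rpow (abs_nonneg _) hJ hn1.le).trans (le_of_eq ?_)
    rw [Real.mul_rpow (Real.rpow_nonneg hI _) (Real.rpow_nonneg hpos.le _), ← Real.rpow_mul hI,
      ← Real.rpow_mul hpos.le, one_div_mul_cancel hn1.ne', Real.rpow_one]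
    congr 2
    rw [hp, hq]
    field_simp
  calc c2 n Ω e * |fourierJ n Ω e w| ^ p ≤ S ^ (-n) * (I * S ^ n) :=
        mul_le_mul_of_nonneg_left h1 (Real.rpow_nonneg hpos.le _)
    _ = I := by
        rw [mul_left_comm, ← Real.rpow_add hpos, neg_add_cancel, Real.rpow_zero, mul_one]

/-- Comparison with the solution of `y' = K y^{n+1}`. -/
theorem blowup_of_integral_inequality {n K J₀ t : ℝ} (hn : 0 < n) (hK : 0 < K) (hJ₀ : 0 < J₀)
    (ht : 0 ≤ t) {J h : ℝ → ℝ} (hint : IntegrableOn h (Ioc 0 t))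
    (hJ : ∀ s ∈ Icc 0 t, J s = J₀ + ∫ r in (0 : ℝ)..s, h r)
    (hh : ∀ᵐ r, r ∈ Ioc 0 t → K * |J r| ^ (n + 1) ≤ h r) :
    t < J₀ ^ (-n) / (n * K) ∧
      (1 / (n * K)) ^ (1 / n) * (J₀ ^ (-n) / (n * K) - t) ^ (-(1 / n)) ≤ J t := by
  have hintv : IntervalIntegrable h volume 0 t :=
    (intervalIntegrable_iff_integrableOn_Ioc_of_le ht).2 hint
  have hJc : ContinuousOn J (Icc 0 t) := by
    have h1 := intervalIntegral.continuousOn_primitive_interval' hintv left_mem_uIcc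
    rw [uIcc_of_le ht] at h1
    exact (continuousOn_const.add h1).congr hJ
  set g : ℝ → ℝ := fun r => |J r| ^ (n + 1) with hg
  have hgc : ContinuousOn g (Icc 0 t) :=
    hJc.abs.rpow_const fun x _ => Or.inr (by positivity)
  have hg0 : ∀ r, 0 ≤ g r := fun r => Real.rpow_nonneg (abs_nonneg _) _
  have hgi : ∀ s ∈ Icc 0 t, IntervalIntegrable g volume 0 s := fun s hs =>
    (hgc.mono (Icc_subset_Icc_right hs.2)).intervalIntegrable_of_Icc hs.1
  set y : ℝ → ℝ := fun s => J₀ + K * ∫ r in (0 : ℝ)..s, g r with hy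
  have hyJ : ∀ s ∈ Icc 0 t, y s ≤ J s := by
    intro s hs
    rw [hJ s hs]
    simp only [hy]
    rw [← intervalIntegral.integral_const_mul, intervalIntegral.integral_of_le hs.1,
      intervalIntegral.integral_of_le hs.1]
    refine add_le_add le_rfl (integral_mono_ae ?_ ?_ ?_)
    · exact ((intervalIntegrable_iff_integrableOn_Ioc_of_le hs.1).1 (hgi s hs)).const_mul K
    · exact hint.mono_set (Ioc_subset_Ioc_right hs.2)
    · filter_upwards [ae_restrict_of_ae hh, ae_restrict_mem measurableSet_Ioc] with r hr hrs
      exact hr ⟨hrs.1, hrs.2.trans hs.2⟩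
  have hyJ₀ : ∀ s ∈ Icc 0 t, J₀ ≤ y s := fun s hs =>
    le_add_of_nonneg_right (mul_nonneg hK.le
      (intervalIntegral.integral_nonneg hs.1 fun r _ => hg0 r))
  have hyc : ContinuousOn y (Icc 0 t) := by
    have h1 := intervalIntegral.continuousOn_primitive_interval' (hgi t ⟨ht, le_rfl⟩) left_mem_uIcc
    rw [uIcc_of_le ht] at h1
    exact continuousOn_const.add (continuousOn_const.mul h1)
  have hyd : ∀ s ∈ Ioo 0 t, HasDerivAt y (K * g s) s := by
    intro s hs
    have hs' : Icc 0 t ∈ 𝓝 s := Icc_mem_nhds hs.1 hs.2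
    exact ((intervalIntegral.integral_hasDerivAt_right (hgi s ⟨hs.1.le, hs.2.le⟩)
      ((hgc.mono Ioo_subset_Icc_self).stronglyMeasurableAtFilter isOpen_Ioo s hs)
      (hgc.continuousAt hs')).const_mul K).const_add J₀
  -- `y^{-n} + n K s` is nonincreasing
  set z : ℝ → ℝ := fun s => y s ^ (-n) + n * K * s with hz
  have hzd : ∀ s ∈ Ioo 0 t, HasDerivAt z (K * g s * (-n) * y s ^ (-n - 1) + n * K) s := by
    intro s hs
    have hys : 0 < y s := hJ₀.trans_le (hyJ₀ s ⟨hs.1.le, hs.2.le⟩)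
    have h1 := ((hyd s hs).rpow_const (p := -n) (Or.inl hys.ne')).add
      ((hasDerivAt_id s).const_mul (n * K))
    rw [mul_one] at h1
    exact h1
  have hanti : AntitoneOn z (Icc 0 t) := by
    refine antitoneOn_of_deriv_nonpos (convex_Icc 0 t) ?_ ?_ ?_
    · refine (hyc.rpow_const fun s hs => Or.inl (hJ₀.trans_le (hyJ₀ s hs)).ne').add ?_
      fun_prop
    · rw [interior_Icc]
      exact fun s hs => (hzd s hs).differentiableAt.differentiableWithinAt
    · rw [interior_Icc]
      intro s hs
      have hs' : s ∈ Icc 0 t := ⟨hs.1.le, hs.2.le⟩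
      have hys : 0 < y s := hJ₀.trans_le (hyJ₀ s hs')
      rw [(hzd s hs).deriv]
      have h1 : y s ^ (n + 1) ≤ g s :=
        Real.rpow_le_rpow hys.le ((hyJ s hs').trans (le_abs_self _)) (by positivity)
      have h2 : 1 ≤ g s * y s ^ (-n - 1) := by
        calc 1 = y s ^ (n + 1) * y s ^ (-n - 1) := by
              rw [← Real.rpow_add hys, show n + 1 + (-n - 1) = 0 by ring, Real.rpow_zero]
          _ ≤ _ := mul_le_mul_of_nonneg_right h1 (Real.rpow_nonneg hys.le _)
      have h3 := mul_le_mul_of_nonneg_left h2 (by positivity : 0 ≤ n * K)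
      linarith
  have hmain := hanti ⟨le_rfl, ht⟩ ⟨ht, le_rfl⟩ ht
  have hy0 : y 0 = J₀ := by simp [hy]
  simp only [hz, hy0, mul_zero, add_zero] at hmain
  have hyt : 0 < y t := hJ₀.trans_le (hyJ₀ t ⟨ht, le_rfl⟩)
  have hztpos : 0 < y t ^ (-n) := Real.rpow_pos_of_pos hyt _
  have hnK : 0 < n * K := by positivity
  have hlt : t < J₀ ^ (-n) / (n * K) := by
    rw [lt_div_iff₀ hnK]
    linarith
  refine ⟨hlt, le_trans ?_ (hyJ t ⟨ht, le_rfl⟩)⟩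
  have hd : 0 < J₀ ^ (-n) / (n * K) - t := sub_pos.2 hlt
  have h1 : (1 / (n * K)) ^ (1 / n) * (J₀ ^ (-n) / (n * K) - t) ^ (-(1 / n)) =
      (n * K * (J₀ ^ (-n) / (n * K) - t)) ^ (-(1 / n)) := by
    rw [Real.mul_rpow hnK.le hd.le, Real.rpow_neg hnK.le, one_div (n * K), Real.inv_rpow hnK.le]
  have h2 : y t = (y t ^ (-n)) ^ (-(1 / n)) := by
    rw [← Real.rpow_mul hyt.le, show -n * -(1 / n) = 1 by field_simp, Real.rpow_one]
  rw [h1, h2]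
  refine Real.rpow_le_rpow_of_nonpos hztpos ?_ (by simp [hn.le])
  have h3 : n * K * (J₀ ^ (-n) / (n * K) - t) = J₀ ^ (-n) - n * K * t := by field_simp
  rw [h3]
  linarith

section

variable {m : ℕ} {Ω : Set (E N)}

theorem IsFirstEigenfunction.integral_pos (hΩb : Bornology.IsBounded Ω) {e : E N → ℝ}
    (he : IsFirstEigenfunction m Ω e) (he0 : ∀ᵐ x ∂(volume.restrict Ω), 0 < e x) :
    Integrable e (volume.restrict Ω) ∧ 0 < ∫ x in Ω, e x := by
  have hfin : IsFiniteMeasure (volume.restrict Ω) := ⟨by simpa using hΩb.measure_lt_top⟩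
  have hi := he.memLp.integrable one_le_two
  have hnn : 0 ≤ᵐ[volume.restrict Ω] e := he0.mono fun x hx => hx.le
  refine ⟨hi, lt_of_le_of_ne (integral_nonneg_of_ae hnn) fun h => he.ne_zero ?_⟩
  exact (integral_eq_zero_iff_of_nonneg_ae hnn hi).1 h.symm

/-- Solutions with `f(v) = |v|` and positive initial Fourier coefficient blow up in finite time. -/
theorem IsWeakSolution.blowup (hΩ : MeasurableSet Ω) (hΩb : Bornology.IsBounded Ω) {n : ℝ}
    (hn : 0 < n) (hlam : firstEigenvalue m Ω < 1) {f : ℝ → ℝ} {τ : EReal} {v : ℝ → E N → ℝ}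
    (hv : IsWeakSolution m n Ω f τ v)
    (hf : ∀ t : ℝ, 0 ≤ t → (t : EReal) < τ →
      ∀ᵐ x ∂(volume.restrict Ω), f (v t x) = |v t x|) {e : E N → ℝ}
    (he : IsFirstEigenfunction m Ω e) (he0 : ∀ᵐ x ∂(volume.restrict Ω), 0 < e x)
    (hJ₀ : 0 < fourierJ n Ω e (v 0)) :
    τ ≤ (timeT m n Ω e (fourierJ n Ω e (v 0)) : EReal) ∧
      ∀ t : ℝ, 0 ≤ t → (t : EReal) < τ →
        ampA m n Ω e * (timeT m n Ω e (fourierJ n Ω e (v 0)) - t) ^ (-(1 / n)) ≤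
          fourierJ n Ω e (v t) := by
  obtain ⟨hei, hpos⟩ := he.integral_pos hΩb he0
  have hc2 : 0 < c2 n Ω e := Real.rpow_pos_of_pos hpos _
  obtain ⟨h, hh, hhae⟩ := hv.exists_fourierJ_eq hΩ hf he
  set J₀ := fourierJ n Ω e (v 0)
  have key : ∀ t : ℝ, 0 ≤ t → (t : EReal) < τ → t < timeT m n Ω e J₀ ∧
      ampA m n Ω e * (timeT m n Ω e J₀ - t) ^ (-(1 / n)) ≤ fourierJ n Ω e (v t) := by
    intro t ht htτ
    have hlt : ∀ s ≤ t, (s : EReal) < τ := fun s hs =>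
      lt_of_le_of_lt (EReal.coe_le_coe_iff.2 hs) htτ
    have hmain := blowup_of_integral_inequality hn
      (mul_pos hc2 (sub_pos.2 hlam)) hJ₀ ht
      (J := fun s => fourierJ n Ω e (v s)) (hh t ht htτ).1
      (fun s hs => (hh s hs.1 (hlt s hs.2)).2) ?_
    · rw [← mul_assoc] at hmain
      exact hmain
    · filter_upwards [hhae] with r hr hrt
      obtain ⟨hvm, hhr⟩ := hr hrt.1 (hlt r hrt.2)
      have hvm' : MemLp (fun x => |v r x|) 2 (volume.restrict Ω) := hvm.abs
      have hi1 : Integrable (fun x => |v r x| * e x) (volume.restrict Ω) :=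
        hvm'.integrable_mul he.memLp
      have hi2 : Integrable (fun x => v r x * e x) (volume.restrict Ω) :=
        hvm.integrable_mul he.memLp
      have h1 := c2_mul_abs_fourierJ_rpow_le hn hei he0 hpos hi1
      have h2 : ∫ x in Ω, v r x * e x ≤ ∫ x in Ω, |v r x| * e x := by
        refine integral_mono_ae hi2 hi1 ?_
        filter_upwards [he0] with x hx
        exact mul_le_mul_of_nonneg_right (le_abs_self _) hx.le
      have h3 := mul_le_mul_of_nonneg_left h2 (firstEigenvalue_nonneg m Ω)
      have h4 := mul_le_mul_of_nonneg_right h1 (sub_pos.2 hlam).le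
      rw [hhr]
      linarith
  refine ⟨?_, fun t ht htτ => (key t ht htτ).2⟩
  by_contra hT
  rw [not_le] at hT
  have hT0 : 0 ≤ timeT m n Ω e J₀ := div_nonneg (Real.rpow_nonneg hJ₀.le _)
    (mul_nonneg (mul_nonneg hn.le hc2.le) (sub_pos.2 hlam).le)
  exact lt_irrefl _ (key _ hT0 hT).1

theorem fourierJ_pos {n : ℝ} (hn : 0 < n) {e w : E N → ℝ} (he : MemLp e 2 (volume.restrict Ω))
    (he0 : ∀ᵐ x ∂(volume.restrict Ω), 0 < e x)
    (hw : MemLp (fun x => psi n (w x)) 2 (volume.restrict Ω))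
    (hw0 : ∀ᵐ x ∂(volume.restrict Ω), 0 ≤ w x) (hne : ¬ w =ᵐ[volume.restrict Ω] 0) :
    0 < fourierJ n Ω e w := by
  have hnn : 0 ≤ᵐ[volume.restrict Ω] fun x => psi n (w x) * e x := by
    filter_upwards [he0, hw0] with x h1 h2 using mul_nonneg (psi_nonneg h2) h1.le
  refine lt_of_le_of_ne (integral_nonneg_of_ae hnn) fun h => hne ?_
  filter_upwards [(integral_eq_zero_iff_of_nonneg_ae hnn (hw.integrable_mul he)).1 h.symm, he0]
    with x h1 h2
  exact psi_eq_zero hn ((mul_eq_zero.1 h1).resolve_right h2.ne')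

end

end PolyBlowup

theorem mainTheorem4 (N : ℕ) (hN : 1 ≤ N) (n : ℝ) (hn : 0 < n) :
    -- balls, order `m ≥ 2`, source term `|v|`, solutions of changing sign
    (∀ m : ℕ, 2 ≤ m → ∀ R : ℝ, 0 < R →
      (∀ e : E N → ℝ, IsFirstEigenfunction m (Metric.ball (0 : E N) R) e →
        (∀ᵐ x ∂(volume.restrict (Metric.ball (0 : E N) R)), 0 < e x) ∨
        (∀ᵐ x ∂(volume.restrict (Metric.ball (0 : E N) R)), e x < 0)) ∧
      (firstEigenvalue m (Metric.ball (0 : E N) R) < 1 →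
        ∀ e₁ : E N → ℝ, IsFirstEigenfunction m (Metric.ball (0 : E N) R) e₁ →
        (∀ᵐ x ∂(volume.restrict (Metric.ball (0 : E N) R)), 0 < e₁ x) →
        ∀ (τ : EReal) (v : ℝ → E N → ℝ),
        IsWeakSolution m n (Metric.ball (0 : E N) R) (fun s => |s|) τ v →
        ∀ J₀ : ℝ, J₀ = fourierJ n (Metric.ball (0 : E N) R) e₁ (v 0) → 0 < J₀ →
          τ ≤ (timeT m n (Metric.ball (0 : E N) R) e₁ J₀ : EReal) ∧
          ∀ t : ℝ, 0 ≤ t → (t : EReal) < τ →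
            ampA m n (Metric.ball (0 : E N) R) e₁ *
                (timeT m n (Metric.ball (0 : E N) R) e₁ J₀ - t) ^ (-(1 / n)) ≤
              fourierJ n (Metric.ball (0 : E N) R) e₁ (v t))) ∧
    -- bounded domains, `m = 1`, source term `v`, nonnegative solutions
    (∀ Ω : Set (E N), IsOpen Ω → IsConnected Ω → Bornology.IsBounded Ω →
      (∀ e : E N → ℝ, IsFirstEigenfunction 1 Ω e →
        (∀ᵐ x ∂(volume.restrict Ω), 0 < e x) ∨ (∀ᵐ x ∂(volume.restrict Ω), e x < 0)) ∧
      (firstEigenvalue 1 Ω < 1 →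
        ∀ e₁ : E N → ℝ, IsFirstEigenfunction 1 Ω e₁ →
        (∀ᵐ x ∂(volume.restrict Ω), 0 < e₁ x) →
        ∀ (τ : EReal) (v : ℝ → E N → ℝ), IsWeakSolution 1 n Ω (fun s => s) τ v →
        (∀ t : ℝ, 0 ≤ t → (t : EReal) < τ → ∀ᵐ x ∂(volume.restrict Ω), 0 ≤ v t x) →
        ¬ (v 0 =ᵐ[volume.restrict Ω] 0) →
        ∀ J₀ : ℝ, J₀ = fourierJ n Ω e₁ (v 0) →
          0 < J₀ ∧
          τ ≤ (timeT 1 n Ω e₁ J₀ : EReal) ∧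
          ∀ t : ℝ, 0 ≤ t → (t : EReal) < τ →
            ampA 1 n Ω e₁ * (timeT 1 n Ω e₁ J₀ - t) ^ (-(1 / n)) ≤
              fourierJ n Ω e₁ (v t))) := by
  refine ⟨fun m hm R hR => ⟨fun e he => he.ae_pos_or_ae_neg_of_ball hN (by omega) hR, ?_⟩,
    fun Ω hΩ hΩc hΩb => ⟨fun e he => he.ae_pos_or_ae_neg hN hΩ hΩc hΩb, ?_⟩⟩
  · intro hlam e₁ he he0 τ v hv J₀ hJ hJ₀
    subst hJ
    exact hv.blowup measurableSet_ball Metric.isBounded_ball hn hlam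
      (fun t _ _ => ae_of_all _ fun x => rfl) he he0 hJ₀
  · intro hlam e₁ he he0 τ v hv hv0 hne J₀ hJ
    subst hJ
    have h0 : ((0 : ℝ) : EReal) < τ := hv.pos
    have hJ₀ := fourierJ_pos hn he.memLp he0 (hv.memLp 0 le_rfl h0) (hv0 0 le_rfl h0) hne
    refine ⟨hJ₀, hv.blowup hΩ.measurableSet hΩb hn hlam (fun t ht htτ => ?_) he he0 hJ₀⟩
    filter_upwards [hv0 t ht htτ] with x hx
    exact (abs_of_nonneg hx).symm
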